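/- Let $k$ be a commutative ring, $\mathcal A$ a small DG category over $k$ and $\mathcal B\subset\mathcal A$ a full DG subcategory (given by a set of objects of $\mathcal A$). Let $\mathcal A/\mathcal B$ be the DG category obtained from $\mathcal A$ by freely adjoining, for every object $U\in\mathcal B$, a morphism $\varepsilon_U:U\to U$ of degree $-1$ with $d\varepsilon_U=\mathrm{id}_U$. So $\mathcal A/\mathcal B$ has the same objects as $\mathcal A$, and as a graded $k$-module $$\mathrm{Hom}_{\mathcal A/\mathcal B}(X,Y)=\bigoplus_{n\ge 0}\ \bigoplus_{U_1,\dots,U_n\in\mathcal B}\mathrm{Hom}_{\mathcal A}(U_n,Y)\otimes k[1]\otimes\mathrm{Hom}_{\mathcal A}(U_{n-1},U_n)\otimes k[1]\otimes\cdots\otimes k[1]\otimes\mathrm{Hom}_{\mathcal A}(X,U_1),$$ where $f_n\otimes\varepsilon\otimes\cdots\otimes\varepsilon\otimes f_0$ corresponds to $f_n\varepsilon_{U_n}f_{n-1}\cdots\varepsilon_{U_1}f_0$ and the summand for $n=0$ is $\mathrm{Hom}_{\mathcal A}(X,Y)$. For a DG category $\mathcal C$ let $\mathrm{Ho}(\mathcal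 C)$ be its homotopy category (same objects, $H^0$ of the Hom complexes as morphisms), let $\mathcal C^{\mathrm{pretr}}$ be the DG category of one-sided twisted complexes over $\mathcal C$, and let $\mathcal C^{\mathrm{tr}}=\mathrm{Ho}(\mathcal C^{\mathrm{pretr}})$, with the triangulated structure given by shifts and cones. Here a one-sided twisted complex is a formal expression $(\bigoplus_{i=1}^nC_i[r_i],q)$ with $n\ge 0$, $q=(q_{ij})$, $q_{ij}\in\mathrm{Hom}(C_j,C_i)[r_i-r_j]$ of degree $1$, $q_{ij}=0$ for $i\ge j$ and $dq+q^2=0$; a morphism of degree $l$ to $(\bigoplus_iC'_i[r'_i],q')$ is a matrix $f=(f_{ij})$, $f_{ij}\in\mathrm{Hom}(C_j,C'_i)[r'_i-r_j]$, of degree $l$, composition is matrix multiplication, and its differential is $d_{\mathrm{naive}}f+q'f-(-1)^lfq$, where $d_{\mathrm{naive}}$ is the differential of $\bigoplus_{i,j}\mathrm{Hom}(C_j[r_j],C'_i[r'_i])$. Let $\mathcal B^{\mathrm{tr}}\subset\mathcal A^{\mathrm{tr}}$ be the full subcategory of the twisted complexes all of whose terms $C_i$ are in $\mathcal B$, and let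 $\mathcal A^{\mathrm{tr}}/\mathcal B^{\mathrm{tr}}$ be the Verdier quotient, i.e. the localization of $\mathcal A^{\mathrm{tr}}$ with respect to the morphisms whose cone is isomorphic to an object of $\mathcal B^{\mathrm{tr}}$. A complex $M$ of $k$-modules is called homotopically flat over $k$ if $C\otimes_kM$ is acyclic for every acyclic complex $C$ of $k$-modules. Assume that one of the following two conditions holds: 1. $\mathrm{Hom}_{\mathcal A}(X,U)$ is homotopically flat over $k$ for all $X\in\mathcal A$, $U\in\mathcal B$; 2. $\mathrm{Hom}_{\mathcal A}(U,X)$ is homotopically flat over $k$ for all $X\in\mathcal A$, $U\in\mathcal B$. Then the functor $\mathcal A^{\mathrm{tr}}\to(\mathcal A/\mathcal B)^{\mathrm{tr}}$ induced by the inclusion $\mathcal A\to\mathcal A/\mathcal B$ sends every morphism whose cone is isomorphic to an object of $\mathcal B^{\mathrm{tr}}$ to an isomorphism, and the induced functor $$\Phi:\mathcal A^{\mathrm{tr}}/\mathcal B^{\mathrm{tr}}\to(\mathcal A/\mathcal B)^{\mathrm{tr}}$$ is an equivalence of categories. In particular, the diagram $\mathcal A\xleftarrow{\ \mathrm{id}\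 }\mathcal A\to\mathcal A/\mathcal B$ is a DG quotient of $\mathcal A$ modulo $\mathcal B$. Here a diagram of DG categories and DG functors $\mathcal A\xleftarrow{\ \pi\ }\tilde{\mathcal A}\xrightarrow{\ \xi\ }\mathcal C$ is a DG quotient of $\mathcal A$ modulo $\mathcal B$ if $\pi$ is a quasi-equivalence (it induces isomorphisms on the cohomology of all Hom complexes and an essentially surjective functor $\mathrm{Ho}(\tilde{\mathcal A})\to\mathrm{Ho}(\mathcal A)$), the functor $\mathrm{Ho}(\tilde{\mathcal A})\to\mathrm{Ho}(\mathcal C)$ is essentially surjective, and the functor $\tilde{\mathcal A}^{\mathrm{tr}}\to\mathcal C^{\mathrm{tr}}$ induces an equivalence $\mathcal A^{\mathrm{tr}}/\mathcal B^{\mathrm{tr}}\to\mathcal C^{\mathrm{tr}}$. -/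

import Mathlib

open CategoryTheory
open scoped TensorProduct

universe u

namespace DG

/-- A `ℤ`-graded `k`-module: a `k`-module that is the internal direct sum of its homogeneous
components `gr n`, `n : ℤ`. -/
structure GrMod (k : Type u) [CommRing k] : Type (u + 1) where
  /-- the underlying module -/
  carrier : Type u
  [addCommGroup : AddCommGroup carrier]
  [module : Module k carrier]
  /-- the homogeneous components -/
  gr : ℤ → Submodule k carrier
  isInternal : DirectSum.IsInternal gr

namespace GrMod

variable {k : Type u} [CommRing k]

instance : CoeSort (GrMod k) (Type u) := ⟨GrMod.carrier⟩

attribute [instance] GrMod.addCommGroup GrMod.module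

/-- A linear map sending a homogeneous `x` of degree `n` to `single n x` exhibits a grading. -/
theorem isInternal_of_coact {M : Type u} [AddCommGroup M] [Module k M] (G : ℤ → Submodule k M)
    (c : M →ₗ[k] ℤ →₀ M) (h₁ : ∀ n x, x ∈ G n → c x = Finsupp.single n x)
    (h₂ : ∀ x, x ∈ ⨆ n, G n) : DirectSum.IsInternal G := by
  refine ⟨?_, ?_⟩
  · have key : ∀ (x : DirectSum ℤ fun n => G n) (n : ℤ),
        c (DirectSum.coeAddMonoidHom G x) n = (x n : M) := by
      intro x n
      induction x using DirectSum.induction_on with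
      | zero => simp
      | of i y =>
        rw [DirectSum.coeAddMonoidHom_of, h₁ i _ y.2, DirectSum.coe_of_apply,
          Finsupp.single_apply]
        split_ifs <;> simp
      | add x y hx hy => simp [hx, hy]
    intro x y hxy
    ext n
    rw [← key, ← key, hxy]
  · intro x
    have hx := h₂ x
    induction hx using Submodule.iSup_induction' with
    | mem i x hx => exact ⟨DirectSum.of (fun n => G n) i ⟨x, hx⟩, by simp⟩
    | zero => exact ⟨0, by simp⟩
    | add x y _ _ hx hy =>
      obtain ⟨a, rfl⟩ := hx
      obtain ⟨b, rfl⟩ := hy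
      exact ⟨a + b, by simp⟩

variable (M N : GrMod k)

theorem mem_iSup (x : M) : x ∈ ⨆ n, M.gr n := by
  rw [M.isInternal.submodule_iSup_eq_top]; trivial

/-- Additive statements may be checked on homogeneous elements. -/
theorem hom_induction {P : M → Prop} (x : M) (mem : ∀ n y, y ∈ M.gr n → P y) (zero : P 0)
    (add : ∀ y z, P y → P z → P (y + z)) : P x :=
  Submodule.iSup_induction _ (motive := P) (M.mem_iSup x) mem zero add

/-- The map sending `x` to the family of its homogeneous components. -/
noncomputable def coact : M →ₗ[k] ℤ →₀ M :=
  (DirectSum.toModule k ℤ _ fun n => Finsupp.lsingle n ∘ₗ (M.gr n).subtype) ∘ₗ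
    (LinearEquiv.ofBijective (DirectSum.coeLinearMap M.gr) M.isInternal).symm.toLinearMap

theorem coact_of_mem {n : ℤ} {x : M} (hx : x ∈ M.gr n) : M.coact x = Finsupp.single n x := by
  have : (LinearEquiv.ofBijective (DirectSum.coeLinearMap M.gr) M.isInternal).symm x =
      DirectSum.lof k ℤ (fun n => M.gr n) n ⟨x, hx⟩ := by
    rw [LinearEquiv.symm_apply_eq]
    exact (DirectSum.coeLinearMap_lof M.gr n ⟨x, hx⟩).symm
  rw [coact, LinearMap.comp_apply, LinearEquiv.coe_coe, this, DirectSum.toModule_lof]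
  rfl

/-- The sign involution `x ↦ (-1)ⁿ x` for `x` homogeneous of degree `n`. -/
noncomputable def sgn : M →ₗ[k] M :=
  (Finsupp.lsum k fun n => (n.negOnePow : ℤ) • LinearMap.id) ∘ₗ M.coact

theorem sgn_of_mem {n : ℤ} {x : M} (hx : x ∈ M.gr n) : M.sgn x = (n.negOnePow : ℤ) • x := by
  rw [sgn, LinearMap.comp_apply, M.coact_of_mem hx, Finsupp.lsum_single]
  rfl

theorem sgn_mem {n : ℤ} {x : M} (hx : x ∈ M.gr n) : M.sgn x ∈ M.gr n := by
  rw [M.sgn_of_mem hx]; exact zsmul_mem hx _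

theorem sgn_sgn (x : M) : M.sgn (M.sgn x) = x := by
  induction x using M.hom_induction with
  | mem n y hy => rw [M.sgn_of_mem hy, map_zsmul, M.sgn_of_mem hy, smul_smul]; simp [← Units.val_mul]
  | zero => simp
  | add y z hy hz => simp [hy, hz]

/-- The shift `M[r]`, with `M[r]ⁿ = Mⁿ⁺ʳ`. -/
def shift (r : ℤ) : GrMod k where
  carrier := M
  gr n := M.gr (n + r)
  isInternal := isInternal_of_coact _
    ((Finsupp.lmapDomain M k fun n => n - r) ∘ₗ M.coact)
    (fun n x hx => by simp [M.coact_of_mem hx])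
    (fun x => by
      induction x using M.hom_induction with
      | mem n y hy => exact Submodule.mem_iSup_of_mem (n - r) (by simpa using hy)
      | zero => exact zero_mem _
      | add y z hy hz => exact add_mem hy hz)

/-- The degree `n` part of a direct sum is the direct sum of the degree `n` parts. -/
def directSumGr {ι : Type u} [DecidableEq ι] (M : ι → GrMod k) (n : ℤ) :
    Submodule k (DirectSum ι fun i => M i) :=
  ⨆ i, ((M i).gr n).map (DirectSum.lof k ι (fun i => M i) i)

/-- The direct sum of graded modules. -/
def directSum {ι : Type u} [DecidableEq ι] (M : ι → GrMod k) : GrMod k where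
  carrier := DirectSum ι fun i => M i
  gr := directSumGr M
  isInternal := isInternal_of_coact _
    (DirectSum.toModule k ι _ fun i =>
      Finsupp.mapRange.linearMap (DirectSum.lof k ι (fun i => M i) i) ∘ₗ (M i).coact)
    (fun n x hx => by
      unfold directSumGr at hx
      induction hx using Submodule.iSup_induction' with
      | mem i x hx =>
        obtain ⟨y, hy, rfl⟩ := hx
        rw [DirectSum.toModule_lof, LinearMap.comp_apply, (M i).coact_of_mem hy]
        simp
      | zero => simp
      | add x y _ _ hx hy => simp only [map_add, hx, hy, Finsupp.single_add])
    (fun x => by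
      induction x using DirectSum.induction_on with
      | zero => exact zero_mem _
      | add x y hx hy => exact add_mem hx hy
      | of i y =>
        induction y using (M i).hom_induction with
        | zero => rw [map_zero]; exact zero_mem _
        | add y z hy hz => rw [map_add]; exact add_mem hy hz
        | mem n y hy =>
          exact Submodule.mem_iSup_of_mem n (Submodule.mem_iSup_of_mem i ⟨y, hy, rfl⟩))

/-- The degree `n` part of `M ⊗ N` is generated by the `x ⊗ y` with `deg x + deg y = n`. -/
def tensorGr (n : ℤ) : Submodule k (M ⊗[k] N) :=
  Submodule.span k {z | ∃ a b, ∃ x ∈ M.gr a, ∃ y ∈ N.gr b, a + b = n ∧ x ⊗ₜ[k] y = z}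

variable {M N} in
theorem tmul_mem {a b n : ℤ} {x : M} {y : N} (hx : x ∈ M.gr a) (hy : y ∈ N.gr b)
    (h : a + b = n) : x ⊗ₜ[k] y ∈ tensorGr M N n :=
  Submodule.subset_span ⟨a, b, x, hx, y, hy, h, rfl⟩

variable {M N} in
theorem tensorGr_le {n : ℤ} {S : Submodule k (M ⊗[k] N)}
    (h : ∀ a b x y, x ∈ M.gr a → y ∈ N.gr b → a + b = n → x ⊗ₜ[k] y ∈ S) :
    tensorGr M N n ≤ S :=
  Submodule.span_le.2 fun _ ⟨_, _, _, hx, _, hy, e, hz⟩ => hz ▸ h _ _ _ _ hx hy e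

/-- The tensor product over `k` of graded modules. -/
def tensor : GrMod k where
  carrier := M ⊗[k] N
  gr := tensorGr M N
  isInternal := isInternal_of_coact _
    (TensorProduct.lift <|
      (Finsupp.lsum k fun a => LinearMap.flip <| (Finsupp.lsum k fun b =>
        LinearMap.flip ((TensorProduct.mk k M N).compr₂ (Finsupp.lsingle (a + b)))) ∘ₗ N.coact) ∘ₗ
          M.coact)
    (fun n x hx => by
      unfold tensorGr at hx
      induction hx using Submodule.span_induction with
      | mem z hz =>
        obtain ⟨a, b, x, hx, y, hy, rfl, rfl⟩ := hz
        simp [M.coact_of_mem hx, N.coact_of_mem hy]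
      | zero => simp
      | add x y _ _ hx hy => simp only [map_add, hx, hy, Finsupp.single_add]
      | smul c x _ hx => simp only [map_smul, hx, Finsupp.smul_single])
    (fun z => by
      induction z using TensorProduct.induction_on with
      | zero => exact zero_mem _
      | add x y hx hy => exact add_mem hx hy
      | tmul x y =>
        induction x using M.hom_induction with
        | zero => simp
        | add x x' hx hx' => rw [TensorProduct.add_tmul]; exact add_mem hx hx'
        | mem a x hx =>
          induction y using N.hom_induction with
          | zero => simp
          | add y y' hy hy' => rw [TensorProduct.tmul_add]; exact add_mem hy hy'
          | mem b y hy =>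
            exact Submodule.mem_iSup_of_mem (a + b)
              (tmul_mem hx hy rfl))

end GrMod

/-- A complex of `k`-modules (cohomological grading), presented as a graded module with a
differential of degree `1`. -/
structure Cpx (k : Type u) [CommRing k] : Type (u + 1) extends GrMod k where
  /-- the differential -/
  d : carrier →ₗ[k] carrier
  d_mem : ∀ {n : ℤ} {x : carrier}, x ∈ gr n → d x ∈ gr (n + 1)
  d_d : ∀ x : carrier, d (d x) = 0

namespace Cpx

variable {k : Type u} [CommRing k]

instance : CoeSort (Cpx k) (Type u) := ⟨fun M => M.carrier⟩

variable (M N : Cpx k)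

theorem d_sgn (x : M) : M.d (M.sgn x) = - M.sgn (M.d x) := by
  induction x using M.hom_induction with
  | mem n y hy =>
    rw [M.sgn_of_mem hy, M.sgn_of_mem (M.d_mem hy), map_zsmul, Int.negOnePow_succ]
    simp
  | zero => simp
  | add y z hy hz => simp [hy, hz]; abel

/-- A complex is acyclic if all its cocycles are coboundaries. -/
def IsAcyclic : Prop := ∀ x : M, M.d x = 0 → ∃ y : M, M.d y = x

/-- The differential of the tensor product: `d (x ⊗ y) = dx ⊗ y + (-1)ⁿ x ⊗ dy` for `x` of
degree `n`. -/
noncomputable def tensorD : M ⊗[k] N →ₗ[k] M ⊗[k] N :=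
  TensorProduct.map M.d LinearMap.id + TensorProduct.map M.sgn N.d

theorem tensorD_tmul (x : M) (y : N) :
    tensorD M N (x ⊗ₜ y) = M.d x ⊗ₜ y + M.sgn x ⊗ₜ N.d y := rfl

/-- The tensor product of complexes. -/
noncomputable def tensor : Cpx k where
  toGrMod := M.toGrMod.tensor N.toGrMod
  d := tensorD M N
  d_mem {n z} hz := (GrMod.tensorGr_le (S := (GrMod.tensorGr _ _ (n + 1)).comap (tensorD M N))
    fun _ _ _ _ hx hy h => add_mem (GrMod.tmul_mem (M.d_mem hx) hy (by omega))
      (GrMod.tmul_mem (M.sgn_mem hx) (N.d_mem hy) (by omega))) hz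
  d_d z := by
    refine TensorProduct.induction_on (motive := fun z : M ⊗[k] N =>
      tensorD M N (tensorD M N z) = 0) z ?_ ?_ ?_
    · simp
    · intro x y
      simp [tensorD_tmul, M.d_d, N.d_d, d_sgn, TensorProduct.neg_tmul]
    · intro x y hx hy
      rw [map_add, map_add, hx, hy, add_zero]

/-- A complex `M` of `k`-modules is homotopically flat if `C ⊗ M` is acyclic for every acyclic
complex `C` of `k`-modules. -/
def IsHoFlat : Prop := ∀ C : Cpx k, C.IsAcyclic → (C.tensor M).IsAcyclic

end Cpx

/-- A (small) differential graded category over `k`. The linear map `comp` sends `g` and `f`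
to the composition `g ∘ f`. -/
structure DGCat (k : Type u) [CommRing k] : Type (u + 1) where
  /-- the objects -/
  Obj : Type u
  /-- the complexes of morphisms -/
  Hom : Obj → Obj → Cpx k
  /-- the identity morphisms -/
  one : ∀ X, Hom X X
  /-- the composition `(g, f) ↦ g ∘ f` -/
  comp : ∀ {X Y Z}, Hom Y Z →ₗ[k] Hom X Y →ₗ[k] Hom X Z
  one_mem : ∀ X, one X ∈ (Hom X X).gr 0
  comp_mem : ∀ {X Y Z} {m n : ℤ} {g : Hom Y Z} {f : Hom X Y},
    g ∈ (Hom Y Z).gr m → f ∈ (Hom X Y).gr n → comp g f ∈ (Hom X Z).gr (m + n)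
  one_comp : ∀ {X Y} (f : Hom X Y), comp (one Y) f = f
  comp_one : ∀ {X Y} (f : Hom X Y), comp f (one X) = f
  assoc : ∀ {X Y Z W} (h : Hom Z W) (g : Hom Y Z) (f : Hom X Y),
    comp (comp h g) f = comp h (comp g f)
  leibniz : ∀ {X Y Z} {m : ℤ} {g : Hom Y Z} (f : Hom X Y), g ∈ (Hom Y Z).gr m →
    (Hom X Z).d (comp g f) =
      comp ((Hom Y Z).d g) f + (m.negOnePow : ℤ) • comp g ((Hom X Y).d f)

/-- Composition of morphisms in a DG category. -/
notation:80 g:81 "⊚" f:80 => DGCat.comp _ g f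

namespace DGCat

variable {k : Type u} [CommRing k] (A : DGCat k)

variable {A} in
theorem d_one (X : A.Obj) : (A.Hom X X).d (A.one X) = 0 := by
  have h := A.leibniz (A.one X) (A.one_mem X)
  simpa [A.one_comp, A.comp_one] using h

variable {A} in
theorem leibniz_sgn {X Y Z : A.Obj} (g : A.Hom Y Z) (f : A.Hom X Y) :
    (A.Hom X Z).d (g ⊚ f) = (A.Hom Y Z).d g ⊚ f + (A.Hom Y Z).sgn g ⊚ (A.Hom X Y).d f := by
  induction g using (A.Hom Y Z).hom_induction with
  | mem n y hy => simp [A.leibniz f hy, (A.Hom Y Z).sgn_of_mem hy]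
  | zero => simp
  | add y z hy hz => simp only [map_add, LinearMap.add_apply, hy, hz]; abel

variable {A} in
theorem sgn_comp {X Y Z : A.Obj} (g : A.Hom Y Z) (f : A.Hom X Y) :
    (A.Hom X Z).sgn (g ⊚ f) = (A.Hom Y Z).sgn g ⊚ (A.Hom X Y).sgn f := by
  induction g using (A.Hom Y Z).hom_induction with
  | mem m y hy =>
    induction f using (A.Hom X Y).hom_induction with
    | mem n x hx =>
      rw [GrMod.sgn_of_mem _ (A.comp_mem hy hx), GrMod.sgn_of_mem _ hy, GrMod.sgn_of_mem _ hx]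
      simp [smul_smul, Int.negOnePow_add]
    | zero => simp
    | add y z hy hz => simp only [map_add, hy, hz]
  | zero => simp
  | add y z hy hz => simp only [map_add, LinearMap.add_apply, hy, hz]

/-! ### The DG category `A/B` -/

section Quotient

variable (B : Set A.Obj)

/-- For a list `[Uₙ, …, U₁]` of objects of `B`, the graded module
`Hom(Uₙ, Y) ⊗ k[1] ⊗ Hom(Uₙ₋₁, Uₙ) ⊗ k[1] ⊗ ⋯ ⊗ k[1] ⊗ Hom(X, U₁)`; its element
`fₙ ⊗ ⋯ ⊗ f₀` stands for the formal word `fₙ ε fₙ₋₁ ε ⋯ ε f₀`. -/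
noncomputable def Word (X : A.Obj) : List B → A.Obj → GrMod k
  | [], Y => (A.Hom X Y).toGrMod
  | U :: l, Y => ((A.Hom U.1 Y).toGrMod.tensor (Word X l U.1)).shift 1

open scoped Classical in
/-- The graded module of morphisms `X → Y` in `A/B`: the direct sum over all finite sequences of
objects of `B` of the modules of formal words. -/
noncomputable def QHomGr (X Y : A.Obj) : GrMod k := GrMod.directSum fun l => Word A B X l Y

variable {A B} {X Y Z W : A.Obj}

namespace Quot

/-- The word `f ε t`. -/
noncomputable def wcons (U : B) (l : List B) :
    A.Hom U.1 Y →ₗ[k] Word A B X l U.1 →ₗ[k] Word A B X (U :: l) Y :=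
  TensorProduct.mk k (A.Hom U.1 Y) (Word A B X l U.1)

/-- Linear maps out of the module of words are bilinear maps. -/
noncomputable def wlift (U : B) (l : List B) {P : Type u} [AddCommGroup P] [Module k P]
    (φ : A.Hom U.1 Y →ₗ[k] Word A B X l U.1 →ₗ[k] P) : Word A B X (U :: l) Y →ₗ[k] P :=
  TensorProduct.lift φ

theorem wlift_wcons (U : B) (l : List B) {P : Type u} [AddCommGroup P] [Module k P]
    (φ : A.Hom U.1 Y →ₗ[k] Word A B X l U.1 →ₗ[k] P) (f : A.Hom U.1 Y) (t : Word A B X l U.1) :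
    wlift U l φ (wcons U l f t) = φ f t :=
  TensorProduct.lift.tmul f t

/-- A word as a morphism of `A/B`. -/
noncomputable def ofWord (l : List B) : Word A B X l Y →ₗ[k] QHomGr A B X Y := by
  classical
  exact DirectSum.lof k (List B) (fun l => Word A B X l Y) l

/-- Linear maps out of the direct sum. -/
noncomputable def qlift {P : Type u} [AddCommGroup P] [Module k P]
    (φ : ∀ l : List B, Word A B X l Y →ₗ[k] P) : QHomGr A B X Y →ₗ[k] P := by
  classical
  exact DirectSum.toModule k (List B) P φ

theorem qlift_ofWord {P : Type u} [AddCommGroup P] [Module k P]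
    (φ : ∀ l : List B, Word A B X l Y →ₗ[k] P) (l : List B) (w : Word A B X l Y) :
    qlift φ (ofWord l w) = φ l w := by
  classical
  exact DirectSum.toModule_lof (M := fun l => Word A B X l Y) k l w

/-- The inclusion of the morphisms of `A` into those of `A/B`. -/
noncomputable def incl : A.Hom X Y →ₗ[k] QHomGr A B X Y :=
  ofWord (X := X) (Y := Y) ([] : List B)

/-- The operation `(f, t) ↦ f ε t`. -/
noncomputable def push (U : B) : A.Hom U.1 Y →ₗ[k] QHomGr A B X U.1 →ₗ[k] QHomGr A B X Y :=
  LinearMap.flip (qlift fun l => LinearMap.flip ((wcons U l).compr₂ (ofWord (U :: l))))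

theorem push_ofWord (U : B) (l : List B) (f : A.Hom U.1 Y) (t : Word A B X l U.1) :
    push U f (ofWord l t) = ofWord (U :: l) (wcons U l f t) := by
  simp [push, qlift_ofWord]

theorem q_induction {P : ∀ {Y : A.Obj}, QHomGr A B X Y → Prop} (x : QHomGr A B X Y)
    (zero : ∀ {Y}, P (0 : QHomGr A B X Y))
    (add : ∀ {Y} (x y : QHomGr A B X Y), P x → P y → P (x + y))
    (hincl : ∀ {Y} (f : A.Hom X Y), P (incl (B := B) f))
    (hpush : ∀ {Y} (U : B) (f : A.Hom U.1 Y) (t : QHomGr A B X U.1), P t → P (push U f t)) :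
    P x := by
  classical
  have key : ∀ (l : List B) (Y : A.Obj) (w : Word A B X l Y), P (ofWord l w) := by
    intro l
    induction l with
    | nil => exact fun Y w => hincl w
    | cons U l ih =>
      intro Y w
      refine TensorProduct.induction_on (motive := fun w : A.Hom U.1 Y ⊗[k] Word A B X l U.1 =>
        P (ofWord (U :: l) (w : Word A B X (U :: l) Y))) w ?_ ?_ ?_
      · exact (map_zero (ofWord (X := X) (Y := Y) (U :: l))).symm ▸ zero
      · intro f t
        have := hpush U f _ (ih _ t)
        rwa [push_ofWord] at this
      · intro a b ha hb
        exact (map_add (ofWord (X := X) (Y := Y) (U :: l)) a b).symm ▸ add _ _ ha hb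
  refine DirectSum.induction_on (motive := fun x : DirectSum (List B) fun l => Word A B X l Y =>
        P (x : QHomGr A B X Y)) x zero (fun l w => key l Y w) fun a b => add a b

theorem q_hom_induction {P : ∀ {Y : A.Obj}, ℤ → QHomGr A B X Y → Prop} {n : ℤ}
    {x : QHomGr A B X Y} (hx : x ∈ (QHomGr A B X Y).gr n)
    (zero : ∀ {Y n}, P n (0 : QHomGr A B X Y))
    (add : ∀ {Y n} (x y : QHomGr A B X Y), P n x → P n y → P n (x + y))
    (smul : ∀ {Y n} (c : k) (x : QHomGr A B X Y), P n x → P n (c • x))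
    (hincl : ∀ {Y n} (f : A.Hom X Y), f ∈ (A.Hom X Y).gr n → P n (incl (B := B) f))
    (hpush : ∀ {Y m n} (U : B) (f : A.Hom U.1 Y) (t : QHomGr A B X U.1),
      f ∈ (A.Hom U.1 Y).gr m → P n t → P (m + n - 1) (push U f t)) :
    P n x := by
  classical
  let S : ∀ (Y : A.Obj) (n : ℤ), Submodule k (QHomGr A B X Y) := fun Y n =>
    { carrier := {x | P n x}, zero_mem' := zero, add_mem' := fun ha hb => add _ _ ha hb,
      smul_mem' := fun c _ h => smul c _ h }
  have key : ∀ (l : List B) (Y : A.Obj) (n : ℤ),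
      (Word A B X l Y).gr n ≤ (S Y n).comap (ofWord l) := by
    intro l
    induction l with
    | nil => exact fun Y n w hw => hincl w hw
    | cons U l ih =>
      intro Y n
      refine GrMod.tensorGr_le (M := (A.Hom U.1 Y).toGrMod) (N := Word A B X l U.1) (n := n + 1)
        (S := (S Y n).comap (ofWord (U :: l))) ?_
      intro a b f t hf ht hab
      have := hpush U f _ hf (ih _ _ ht)
      rw [push_ofWord, hab, add_sub_cancel_right] at this
      exact this
  have : GrMod.directSumGr (fun l => Word A B X l Y) n ≤ S Y n :=
    iSup_le fun l => Submodule.map_le_iff_le_comap.2 (key l Y n)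
  exact this hx

theorem incl_mem {n : ℤ} {f : A.Hom X Y} (hf : f ∈ (A.Hom X Y).gr n) :
    incl (B := B) f ∈ (QHomGr A B X Y).gr n := by
  classical
  exact Submodule.mem_iSup_of_mem (p := fun l : List B =>
    ((Word A B X l Y).gr n).map (DirectSum.lof k (List B) (fun l => Word A B X l Y) l)) []
    ⟨f, hf, rfl⟩

theorem push_mem {m n p : ℤ} (U : B) {f : A.Hom U.1 Y} {t : QHomGr A B X U.1}
    (hf : f ∈ (A.Hom U.1 Y).gr m) (ht : t ∈ (QHomGr A B X U.1).gr n) (h : m + n = p + 1) :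
    push U f t ∈ (QHomGr A B X Y).gr p := by
  classical
  have : GrMod.directSumGr (fun l => Word A B X l U.1) n ≤
      ((QHomGr A B X Y).gr p).comap (push U f) := by
    refine iSup_le fun l => ?_
    rintro _ ⟨w, hw, rfl⟩
    change push U f (ofWord l w) ∈ (QHomGr A B X Y).gr p
    rw [push_ofWord]
    exact Submodule.mem_iSup_of_mem (p := fun l : List B =>
      ((Word A B X l Y).gr p).map (DirectSum.lof k (List B) (fun l => Word A B X l Y) l)) (U :: l)
      ⟨_, GrMod.tmul_mem hf hw h, rfl⟩
  exact this ht

theorem sgn_incl (f : A.Hom X Y) :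
    (QHomGr A B X Y).sgn (incl f) = incl ((A.Hom X Y).sgn f) := by
  induction f using (A.Hom X Y).hom_induction with
  | mem n y hy => rw [GrMod.sgn_of_mem _ hy, GrMod.sgn_of_mem _ (incl_mem hy), map_zsmul]
  | zero => simp
  | add y z hy hz => simp only [map_add, hy, hz]

theorem sgn_push (U : B) (f : A.Hom U.1 Y) (t : QHomGr A B X U.1) :
    (QHomGr A B X Y).sgn (push U f t) =
      - push U ((A.Hom U.1 Y).sgn f) ((QHomGr A B X U.1).sgn t) := by
  induction f using (A.Hom U.1 Y).hom_induction with
  | mem m y hy =>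
    induction t using (QHomGr A B X U.1).hom_induction with
    | mem n x hx =>
      rw [GrMod.sgn_of_mem _ (push_mem U hy hx (p := m + n - 1) (by ring)),
        GrMod.sgn_of_mem _ hy, GrMod.sgn_of_mem _ hx, Int.negOnePow_sub, Int.negOnePow_add]
      simp [smul_smul]
    | zero => simp
    | add y z hy hz => simp only [map_add, hy, hz, neg_add]
  | zero => simp
  | add y z hy hz => simp only [map_add, LinearMap.add_apply, hy, hz, neg_add]

/-- Composition of a word with a morphism of `A` on the left. -/
noncomputable def actWord : ∀ (l : List B) {Y Z : A.Obj},
    A.Hom Y Z →ₗ[k] Word A B X l Y →ₗ[k] QHomGr A B X Z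
  | [], _, _ => A.comp.compr₂ incl
  | U :: l, _, _ => LinearMap.flip <| wlift U l <| LinearMap.flip <|
      (LinearMap.llcomp k _ _ _).compl₁₂ ((push U).flip ∘ₗ ofWord l) A.comp.flip

/-- Composition of a morphism of `A/B` with a morphism of `A` on the left. -/
noncomputable def act : A.Hom Y Z →ₗ[k] QHomGr A B X Y →ₗ[k] QHomGr A B X Z :=
  LinearMap.flip (qlift fun l => LinearMap.flip (actWord l))

theorem act_ofWord (h : A.Hom Y Z) (l : List B) (w : Word A B X l Y) :
    act h (ofWord l w) = actWord l h w :=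
  LinearMap.congr_fun (qlift_ofWord (fun l => LinearMap.flip (actWord l)) l w) h

theorem actWord_wcons (h : A.Hom Y Z) (U : B) (l : List B) (f : A.Hom U.1 Y)
    (w : Word A B X l U.1) :
    actWord (U :: l) h (wcons U l f w) = push U (h ⊚ f) (ofWord l w) :=
  LinearMap.congr_fun (wlift_wcons U l (LinearMap.flip
    ((LinearMap.llcomp k _ _ _).compl₁₂ ((push U).flip ∘ₗ ofWord l) A.comp.flip)) f w) h

theorem act_incl (h : A.Hom Y Z) (f : A.Hom X Y) :
    act h (incl (B := B) f) = incl (h ⊚ f) :=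
  act_ofWord h [] f

/-- Two linear maps which agree on words `f ε w` agree on all `f ε t`. -/
theorem push_ext {U : B} {P : Type u} [AddCommGroup P] [Module k P]
    {φ ψ : QHomGr A B X U.1 →ₗ[k] P} (h : ∀ l w, φ (ofWord l w) = ψ (ofWord l w)) : φ = ψ := by
  classical
  refine LinearMap.ext fun t => DirectSum.induction_on
    (motive := fun x : DirectSum (List B) fun l => Word A B X l U.1 =>
        φ (x : QHomGr A B X U.1) = ψ x) t ?_ (fun l w => h l w) fun a b ha hb => ?_
  · exact (map_zero φ).trans (map_zero ψ).symm
  · exact (map_add φ a b).trans ((congrArg₂ _ ha hb).trans (map_add ψ a b).symm)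

theorem act_push (U : B) (h : A.Hom Y Z) (f : A.Hom U.1 Y) (t : QHomGr A B X U.1) :
    act h (push U f t) = push U (h ⊚ f) t := by
  refine LinearMap.congr_fun (push_ext (φ := act h ∘ₗ push U f) (ψ := push U (h ⊚ f))
    fun l w => ?_) t
  simp only [LinearMap.comp_apply, push_ofWord, act_ofWord, actWord_wcons]

/-- Composition of a morphism of `A/B` with a word on the left. -/
noncomputable def compWord : ∀ (l : List B) {Z : A.Obj},
    Word A B Y l Z →ₗ[k] QHomGr A B X Y →ₗ[k] QHomGr A B X Z
  | [], _ => act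
  | U :: l, _ => wlift U l <| (LinearMap.llcomp k _ _ _).compl₁₂ (push U) (compWord l)

/-- Composition in `A/B`. -/
noncomputable def comp : QHomGr A B Y Z →ₗ[k] QHomGr A B X Y →ₗ[k] QHomGr A B X Z :=
  qlift fun l => compWord l

theorem comp_ofWord (l : List B) (w : Word A B Y l Z) (b : QHomGr A B X Y) :
    comp (ofWord l w) b = compWord l w b :=
  LinearMap.congr_fun (qlift_ofWord (fun l => compWord l) l w) b

theorem compWord_wcons (U : B) (l : List B) (f : A.Hom U.1 Z) (w : Word A B Y l U.1)
    (b : QHomGr A B X Y) :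
    compWord (U :: l) (wcons U l f w) b = push U f (compWord l w b) :=
  LinearMap.congr_fun (wlift_wcons U l _ f w) b

theorem comp_incl (f : A.Hom Y Z) (b : QHomGr A B X Y) : comp (incl f) b = act f b :=
  comp_ofWord [] f b

theorem comp_push (U : B) (f : A.Hom U.1 Z) (t : QHomGr A B Y U.1) (b : QHomGr A B X Y) :
    comp (push U f t) b = push U f (comp t b) := by
  refine LinearMap.congr_fun (push_ext (φ := comp.flip b ∘ₗ push U f)
    (ψ := push U f ∘ₗ comp.flip b) fun l w => ?_) t
  simp only [LinearMap.comp_apply, LinearMap.flip_apply, push_ofWord, comp_ofWord, compWord_wcons]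

/-- The differential on words, determined by `d(f ε t) = df ε t + (-1)ᵖ f t - (-1)ᵖ f ε dt` for
`f` homogeneous of degree `p`. -/
noncomputable def dWord : ∀ (l : List B) {Y : A.Obj}, Word A B X l Y →ₗ[k] QHomGr A B X Y
  | [], Y => incl ∘ₗ (A.Hom X Y).d
  | U :: l, Y => wlift U l <| (push U ∘ₗ (A.Hom U.1 Y).d).compl₂ (ofWord l) +
      (act ∘ₗ (A.Hom U.1 Y).sgn).compl₂ (ofWord l) -
      (push U ∘ₗ (A.Hom U.1 Y).sgn).compl₂ (dWord l)

/-- The differential of the Hom complexes of `A/B`. -/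
noncomputable def qd : QHomGr A B X Y →ₗ[k] QHomGr A B X Y :=
  qlift fun l => dWord l

theorem qd_ofWord (l : List B) (w : Word A B X l Y) : qd (ofWord l w) = dWord l w :=
  qlift_ofWord (fun l => dWord l) l w

theorem dWord_wcons (U : B) (l : List B) (f : A.Hom U.1 Y) (w : Word A B X l U.1) :
    dWord (U :: l) (wcons U l f w) = push U ((A.Hom U.1 Y).d f) (ofWord l w) +
      act ((A.Hom U.1 Y).sgn f) (ofWord l w) - push U ((A.Hom U.1 Y).sgn f) (dWord l w) :=
  wlift_wcons U l _ f w

theorem qd_incl (f : A.Hom X Y) : qd (incl (B := B) f) = incl ((A.Hom X Y).d f) :=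
  qd_ofWord [] f

theorem qd_push (U : B) (f : A.Hom U.1 Y) (t : QHomGr A B X U.1) :
    qd (push U f t) = push U ((A.Hom U.1 Y).d f) t + act ((A.Hom U.1 Y).sgn f) t -
      push U ((A.Hom U.1 Y).sgn f) (qd t) := by
  refine LinearMap.congr_fun (push_ext (φ := qd ∘ₗ push U f)
    (ψ := push U ((A.Hom U.1 Y).d f) + act ((A.Hom U.1 Y).sgn f) -
      push U ((A.Hom U.1 Y).sgn f) ∘ₗ qd) fun l w => ?_) t
  simp only [LinearMap.comp_apply, LinearMap.sub_apply, LinearMap.add_apply, push_ofWord,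
    qd_ofWord, dWord_wcons]

theorem act_act (h : A.Hom Z W) (g : A.Hom Y Z) (x : QHomGr A B X Y) :
    act h (act g x) = act (h ⊚ g) x := by
  refine q_induction (P := fun {Y} x => ∀ g : A.Hom Y Z, act h (act g x) = act (h ⊚ g) x) x
    ?_ ?_ ?_ ?_ g
  · intros; simp
  · intro Y x y hx hy g; simp only [map_add, hx, hy]
  · intro Y f g; simp only [act_incl, A.assoc]
  · intro Y U f t _ g; simp only [act_push, A.assoc]

theorem act_one (x : QHomGr A B X Y) : act (A.one Y) x = x := by
  refine q_induction (P := fun {Y} x => act (A.one Y) x = x) x ?_ ?_ ?_ ?_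
  · intros; simp
  · intro Y x y hx hy; simp only [map_add, hx, hy]
  · intro Y f; simp only [act_incl, A.one_comp]
  · intro Y U f t _; simp only [act_push, A.one_comp]

theorem comp_act (h : A.Hom Z W) (a : QHomGr A B Y Z) (b : QHomGr A B X Y) :
    comp (act h a) b = act h (comp a b) := by
  refine q_induction (P := fun {Z} a => ∀ h : A.Hom Z W, comp (act h a) b = act h (comp a b)) a
    ?_ ?_ ?_ ?_ h
  · intros; simp
  · intro Y x y hx hy g; simp only [map_add, LinearMap.add_apply, hx, hy]
  · intro Y f g; simp only [act_incl, comp_incl, act_act]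
  · intro Y U f t _ g; simp only [act_push, comp_push]

theorem comp_assoc (a : QHomGr A B Z W) (b : QHomGr A B Y Z) (c : QHomGr A B X Y) :
    comp (comp a b) c = comp a (comp b c) := by
  refine q_induction (P := fun {W} a => comp (comp a b) c = comp a (comp b c)) a ?_ ?_ ?_ ?_
  · intros; simp
  · intro Y x y hx hy; simp only [map_add, LinearMap.add_apply, hx, hy]
  · intro Y f; simp only [comp_incl, comp_act]
  · intro Y U f t ht; simp only [comp_push, ht]

theorem comp_one (a : QHomGr A B X Y) : comp a (incl (A.one X)) = a := by
  refine q_induction (P := fun {Y} a => comp a (incl (A.one X)) = a) a ?_ ?_ ?_ ?_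
  · intros; simp
  · intro Y x y hx hy; simp only [map_add, LinearMap.add_apply, hx, hy]
  · intro Y f; simp only [comp_incl, act_incl, A.comp_one]
  · intro Y U f t ht; simp only [comp_push, ht]

theorem act_mem {m n : ℤ} {h : A.Hom Y Z} {x : QHomGr A B X Y} (hh : h ∈ (A.Hom Y Z).gr m)
    (hx : x ∈ (QHomGr A B X Y).gr n) : act h x ∈ (QHomGr A B X Z).gr (m + n) := by
  have := q_hom_induction (P := fun {Y} n x => x ∈ (QHomGr A B X Y).gr n ∧
    ∀ (m : ℤ) (h : A.Hom Y Z), h ∈ (A.Hom Y Z).gr m → act h x ∈ (QHomGr A B X Z).gr (m + n)) hx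
    ?_ ?_ ?_ ?_ ?_
  · exact this.2 m h hh
  · exact fun {Y n} => ⟨zero_mem _, fun m h _ => by rw [map_zero]; exact zero_mem _⟩
  · exact fun {Y n} x y hx hy => ⟨add_mem hx.1 hy.1, fun m h hh => by
      rw [map_add]; exact add_mem (hx.2 m h hh) (hy.2 m h hh)⟩
  · exact fun {Y n} c x hx => ⟨Submodule.smul_mem _ _ hx.1, fun m h hh => by
      rw [map_smul]; exact Submodule.smul_mem _ _ (hx.2 m h hh)⟩
  · exact fun {Y n} f hf => ⟨incl_mem hf, fun m h hh => by
      rw [act_incl]; exact incl_mem (A.comp_mem hh hf)⟩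
  · exact fun {Y p n} U f t hf ht => ⟨push_mem U hf ht.1 (by ring), fun m h hh => by
      rw [act_push]; exact push_mem U (A.comp_mem hh hf) ht.1 (by ring)⟩

theorem comp_mem {m n : ℤ} {a : QHomGr A B Y Z} {b : QHomGr A B X Y}
    (ha : a ∈ (QHomGr A B Y Z).gr m) (hb : b ∈ (QHomGr A B X Y).gr n) :
    comp a b ∈ (QHomGr A B X Z).gr (m + n) := by
  refine q_hom_induction (P := fun {Z} m a => comp a b ∈ (QHomGr A B X Z).gr (m + n)) ha
    ?_ ?_ ?_ ?_ ?_
  · intro Y m; simp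
  · intro Y m x y hx hy; rw [map_add, LinearMap.add_apply]; exact add_mem hx hy
  · intro Y m c x hx; rw [map_smul, LinearMap.smul_apply]; exact Submodule.smul_mem _ _ hx
  · intro Y m f hf; rw [comp_incl]; exact act_mem hf hb
  · intro Y p m U f t hf ht; rw [comp_push]; exact push_mem U hf ht (by ring)

theorem qd_mem {n : ℤ} {x : QHomGr A B X Y} (hx : x ∈ (QHomGr A B X Y).gr n) :
    qd x ∈ (QHomGr A B X Y).gr (n + 1) := by
  refine (q_hom_induction (P := fun {Y} n x => x ∈ (QHomGr A B X Y).gr n ∧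
    qd x ∈ (QHomGr A B X Y).gr (n + 1)) hx ?_ ?_ ?_ ?_ ?_).2
  · intro Y m; simp
  · intro Y m x y hx hy; rw [map_add]; exact ⟨add_mem hx.1 hy.1, add_mem hx.2 hy.2⟩
  · intro Y m c x hx; rw [map_smul]
    exact ⟨Submodule.smul_mem _ _ hx.1, Submodule.smul_mem _ _ hx.2⟩
  · intro Y m f hf; rw [qd_incl]; exact ⟨incl_mem hf, incl_mem ((A.Hom X Y).d_mem hf)⟩
  · intro Y p m U f t hf ht
    refine ⟨push_mem U hf ht.1 (by ring), ?_⟩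
    rw [qd_push]
    refine sub_mem (add_mem (push_mem U ((A.Hom _ _).d_mem hf) ht.1 (by ring)) ?_)
      (push_mem U ((A.Hom _ _).sgn_mem hf) ht.2 (by ring))
    have := act_mem ((A.Hom _ _).sgn_mem hf) ht.1
    rwa [sub_add_cancel]

theorem qd_act (h : A.Hom Y Z) (x : QHomGr A B X Y) :
    qd (act h x) = act ((A.Hom Y Z).d h) x + act ((A.Hom Y Z).sgn h) (qd x) := by
  refine q_induction (P := fun {Y} x => ∀ h : A.Hom Y Z,
    qd (act h x) = act ((A.Hom Y Z).d h) x + act ((A.Hom Y Z).sgn h) (qd x)) x ?_ ?_ ?_ ?_ h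
  · intros; simp
  · intro Y x y hx hy h; simp only [map_add, hx, hy]; abel
  · intro Y f h; simp only [act_incl, qd_incl, leibniz_sgn, map_add]
  · intro Y U f t _ h
    simp only [act_push, qd_push, leibniz_sgn, sgn_comp, map_add, map_sub, act_act,
      LinearMap.add_apply]
    abel

theorem qd_comp (a : QHomGr A B Y Z) (b : QHomGr A B X Y) :
    qd (comp a b) = comp (qd a) b + comp ((QHomGr A B Y Z).sgn a) (qd b) := by
  refine q_induction (P := fun {Z} a =>
    qd (comp a b) = comp (qd a) b + comp ((QHomGr A B Y Z).sgn a) (qd b)) a ?_ ?_ ?_ ?_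
  · intros; simp
  · intro Y x y hx hy; simp only [map_add, LinearMap.add_apply, hx, hy]; abel
  · intro Y f; simp only [comp_incl, qd_incl, sgn_incl, qd_act]
  · intro Y U f t ht
    simp only [comp_push, qd_push, sgn_push, ht, map_add, map_sub, map_neg, LinearMap.add_apply,
      LinearMap.sub_apply, LinearMap.neg_apply, comp_act]
    abel

theorem qd_qd (x : QHomGr A B X Y) : qd (qd x) = 0 := by
  refine q_induction (P := fun {Y} x => qd (qd x) = 0) x ?_ ?_ ?_ ?_
  · intros; simp
  · intro Y x y hx hy; simp only [map_add, hx, hy, add_zero]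
  · intro Y f; simp only [qd_incl, Cpx.d_d, map_zero]
  · intro Y U f t ht
    simp only [qd_push, map_add, map_sub, Cpx.d_d, Cpx.d_sgn, qd_act, GrMod.sgn_sgn, ht, map_neg,
      LinearMap.neg_apply, map_zero, LinearMap.zero_apply]
    abel

end Quot

variable (A B)

/-- The DG category `A/B` obtained from `A` by freely adjoining, for every object `U` of `B`,
a morphism `ε : U → U` of degree `-1` with `dε = id`. -/
noncomputable def quot : DGCat k where
  Obj := A.Obj
  Hom X Y :=
    { toGrMod := QHomGr A B X Y
      d := Quot.qd
      d_mem := Quot.qd_mem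
      d_d := Quot.qd_qd }
  one X := Quot.incl (A.one X)
  comp := Quot.comp
  one_mem X := Quot.incl_mem (A.one_mem X)
  comp_mem := Quot.comp_mem
  one_comp f := by rw [Quot.comp_incl, Quot.act_one]
  comp_one f := Quot.comp_one f
  assoc := Quot.comp_assoc
  leibniz {X Y Z m g} f hg := by
    rw [Quot.qd_comp, GrMod.sgn_of_mem _ hg, map_zsmul, LinearMap.smul_apply]

variable {A B}

/-- The adjoined morphism `ε : U → U`. -/
noncomputable def eps (U : B) : (A.quot B).Hom U.1 U.1 :=
  Quot.push U (A.one U.1) (Quot.incl (A.one U.1))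

theorem eps_mem (U : B) : eps U ∈ ((A.quot B).Hom U.1 U.1).gr (-1) :=
  Quot.push_mem U (A.one_mem _) (Quot.incl_mem (A.one_mem _)) (by norm_num)

theorem d_eps (U : B) : ((A.quot B).Hom U.1 U.1).d (eps U) = (A.quot B).one U.1 := by
  refine (Quot.qd_push U (A.one U.1) (Quot.incl (A.one U.1))).trans ?_
  rw [Quot.qd_incl, d_one, GrMod.sgn_of_mem _ (A.one_mem U.1)]
  simp [Quot.act_one]
  rfl

/-- The word `f ε t` is the composition of `f`, `ε` and `t`. -/
theorem push_eq (U : B) (f : A.Hom U.1 Y) (t : QHomGr A B X U.1) :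
    Quot.push U f t = Quot.comp (Quot.incl f) (Quot.comp (eps U) t) := by
  refine Eq.symm (Eq.trans (congrArg (Quot.comp (Quot.incl f))
    ((Quot.comp_push U (A.one U.1) (Quot.incl (A.one U.1)) t).trans (congrArg _
      ((Quot.comp_incl _ _).trans (Quot.act_one t))))) ?_)
  rw [Quot.comp_incl, Quot.act_push, A.comp_one]

end Quotient

/-! ### The homotopy category -/

/-- Closed morphisms of degree `0`. -/
def closed (X Y : A.Obj) : Submodule k (A.Hom X Y) :=
  (A.Hom X Y).gr 0 ⊓ LinearMap.ker (A.Hom X Y).d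

/-- The closed morphisms of degree `0` which are coboundaries. -/
def exact (X Y : A.Obj) : Submodule k (A.closed X Y) :=
  (((A.Hom X Y).gr (-1)).map (A.Hom X Y).d).comap (A.closed X Y).subtype

/-- The type of objects of the homotopy category of `A`. -/
@[ext]
structure Ho : Type u where
  /-- the underlying object of `A` -/
  obj : A.Obj

variable {A}

theorem comp_closed {X Y Z : A.Obj} {g : A.Hom Y Z} {f : A.Hom X Y} (hg : g ∈ A.closed Y Z)
    (hf : f ∈ A.closed X Y) : g ⊚ f ∈ A.closed X Z := by
  refine ⟨by simpa using A.comp_mem hg.1 hf.1, ?_⟩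
  have h₁ : (A.Hom Y Z).d g = 0 := hg.2
  have h₂ : (A.Hom X Y).d f = 0 := hf.2
  simp [LinearMap.mem_ker, A.leibniz f hg.1, h₁, h₂]

theorem one_closed (X : A.Obj) : A.one X ∈ A.closed X X := ⟨A.one_mem X, d_one X⟩

/-- Two closed morphisms of degree `0` are homotopic if their difference is a coboundary. -/
def Homotopic {X Y : A.Obj} (f g : A.Hom X Y) : Prop :=
  ∃ h ∈ (A.Hom X Y).gr (-1), (A.Hom X Y).d h = f - g

theorem Homotopic.comp {X Y Z : A.Obj} {g g' : A.Hom Y Z} {f f' : A.Hom X Y}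
    (hg : Homotopic g g') (hf : Homotopic f f') (hg' : g' ∈ A.closed Y Z)
    (hf₀ : f ∈ A.closed X Y) : Homotopic (g ⊚ f) (g' ⊚ f') := by
  obtain ⟨u, hu, hu'⟩ := hg
  obtain ⟨v, hv, hv'⟩ := hf
  have h₁ : (A.Hom Y Z).d g' = 0 := hg'.2
  have h₂ : (A.Hom X Y).d f = 0 := hf₀.2
  refine ⟨u ⊚ f + g' ⊚ v, add_mem ?_ ?_, ?_⟩
  · simpa using A.comp_mem hu hf₀.1
  · simpa using A.comp_mem hg'.1 hv
  · rw [map_add, A.leibniz f hu, A.leibniz v hg'.1, hu', hv', h₁, h₂]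
    simp

/-- The homotopy category: the morphisms are the zeroth cohomology groups of the complexes of
morphisms of `A`. -/
instance : Category.{u} (Ho A) where
  Hom X Y := A.closed X.obj Y.obj ⧸ A.exact X.obj Y.obj
  id X := Submodule.Quotient.mk ⟨A.one X.obj, one_closed _⟩
  comp := Quotient.map₂ (fun f g => ⟨g.1 ⊚ f.1, comp_closed g.2 f.2⟩) (by
    intro f f' hf g g' hg
    exact (Submodule.quotientRel_def _).2 (Homotopic.comp
      ((Submodule.quotientRel_def _).1 hg) ((Submodule.quotientRel_def _).1 hf) g'.2 f.2))
  id_comp := by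
    rintro X Y ⟨f⟩
    exact congrArg _ (Subtype.ext (A.comp_one f.1))
  comp_id := by
    rintro X Y ⟨f⟩
    exact congrArg _ (Subtype.ext (A.one_comp f.1))
  assoc := by
    rintro X Y Z W ⟨f⟩ ⟨g⟩ ⟨h⟩
    exact congrArg _ (Subtype.ext (A.assoc h.1 g.1 f.1).symm)

namespace Ho

/-- The class of a closed morphism of degree `0`. -/
def cls {X Y : Ho A} (f : A.Hom X.obj Y.obj) (hf : f ∈ A.closed X.obj Y.obj) : X ⟶ Y :=
  Submodule.Quotient.mk ⟨f, hf⟩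

theorem cls_eq_iff {X Y : Ho A} {f g : A.Hom X.obj Y.obj} {hf : f ∈ A.closed X.obj Y.obj}
    {hg : g ∈ A.closed X.obj Y.obj} : (cls f hf : X ⟶ Y) = cls g hg ↔ Homotopic f g :=
  Submodule.Quotient.eq _

theorem cls_surjective {X Y : Ho A} (φ : X ⟶ Y) : ∃ f hf, φ = cls f hf := by
  obtain ⟨f, rfl⟩ := Submodule.Quotient.mk_surjective _ φ
  exact ⟨f.1, f.2, rfl⟩

theorem cls_comp {X Y Z : Ho A} (f : A.Hom X.obj Y.obj) (hf : f ∈ A.closed X.obj Y.obj)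
    (g : A.Hom Y.obj Z.obj) (hg : g ∈ A.closed Y.obj Z.obj) :
    (cls f hf : X ⟶ Y) ≫ (cls g hg : Y ⟶ Z) = cls (g ⊚ f) (comp_closed hg hf) := rfl

theorem cls_one (X : Ho A) : cls (A.one X.obj) (one_closed _) = 𝟙 X := rfl

instance : Preadditive (Ho A) where
  homGroup X Y := inferInstanceAs (AddCommGroup (A.closed X.obj Y.obj ⧸ A.exact X.obj Y.obj))
  add_comp := by
    rintro X Y Z ⟨f⟩ ⟨f'⟩ ⟨g⟩
    exact congrArg Submodule.Quotient.mk (Subtype.ext (map_add (A.comp g.1) f.1 f'.1))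
  comp_add := by
    rintro X Y Z ⟨f⟩ ⟨g⟩ ⟨g'⟩
    exact congrArg Submodule.Quotient.mk (Subtype.ext (LinearMap.map_add₂ A.comp g.1 g'.1 f.1))

theorem cls_add {X Y : Ho A} {f g : A.Hom X.obj Y.obj} (hf : f ∈ A.closed X.obj Y.obj)
    (hg : g ∈ A.closed X.obj Y.obj) :
    (cls f hf : X ⟶ Y) + cls g hg = cls (f + g) (add_mem hf hg) := rfl

theorem cls_neg {X Y : Ho A} {f : A.Hom X.obj Y.obj} (hf : f ∈ A.closed X.obj Y.obj) :
    -(cls f hf : X ⟶ Y) = cls (-f) (neg_mem hf) := rfl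

theorem cls_zero {X Y : Ho A} : (cls 0 (zero_mem _) : X ⟶ Y) = 0 := rfl

theorem cls_congr {X Y : Ho A} {f g : A.Hom X.obj Y.obj} {hf : f ∈ A.closed X.obj Y.obj}
    {hg : g ∈ A.closed X.obj Y.obj} (h : f = g) : (cls f hf : X ⟶ Y) = cls g hg := by
  subst h; rfl

theorem comp_mem' {X Y Z : A.Obj} {m n p : ℤ} {g : A.Hom Y Z} {f : A.Hom X Y}
    (hg : g ∈ (A.Hom Y Z).gr m) (hf : f ∈ (A.Hom X Y).gr n) (h : m + n = p) :
    g ⊚ f ∈ (A.Hom X Z).gr p := h ▸ A.comp_mem hg hf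

theorem d_comp_zero {X Y Z : A.Obj} {g : A.Hom Y Z} {f : A.Hom X Y}
    (hg : (A.Hom Y Z).d g = 0) (hf : (A.Hom X Y).d f = 0) : (A.Hom X Z).d (g ⊚ f) = 0 := by
  rw [leibniz_sgn, hg, hf]; simp

theorem homotopic_of_eq {X Y : A.Obj} {f g : A.Hom X Y} (h : f = g) : Homotopic f g :=
  ⟨0, zero_mem _, by simp [h]⟩

/-- An isomorphism in the homotopy category from a pair of inverse closed morphisms. -/
@[simps]
def isoMk {X Y : Ho A} (f : A.Hom X.obj Y.obj) (g : A.Hom Y.obj X.obj)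
    (hf : f ∈ A.closed X.obj Y.obj) (hg : g ∈ A.closed Y.obj X.obj)
    (hfg : Homotopic (f ⊚ g) (A.one _)) (hgf : Homotopic (g ⊚ f) (A.one _)) : X ≅ Y where
  hom := cls f hf
  inv := cls g hg
  hom_inv_id := cls_eq_iff.2 hgf
  inv_hom_id := cls_eq_iff.2 hfg

end Ho

/-! ### Shifts and cones, and the triangulated structure on the homotopy category -/

/-- A cone of a morphism `f : X ⟶ Y`: as a graded object it is `Y ⊕ X[1]`, with inclusions `inr`,
`inl` and projections `snd`, `fst`, and its differential is twisted by `f`. -/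
structure Cone {X Y : A.Obj} (f : A.Hom X Y) where
  /-- the cone -/
  pt : A.Obj
  /-- the inclusion of `Y` -/
  inr : A.Hom Y pt
  /-- the projection to `X`, of degree `1` -/
  fst : A.Hom pt X
  /-- the inclusion of `X`, of degree `-1` -/
  inl : A.Hom X pt
  /-- the projection to `Y` -/
  snd : A.Hom pt Y
  inr_mem : inr ∈ (A.Hom Y pt).gr 0
  fst_mem : fst ∈ (A.Hom pt X).gr 1
  inl_mem : inl ∈ (A.Hom X pt).gr (-1)
  snd_mem : snd ∈ (A.Hom pt Y).gr 0
  fst_inl : fst ⊚ inl = A.one X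
  snd_inr : snd ⊚ inr = A.one Y
  fst_inr : fst ⊚ inr = 0
  snd_inl : snd ⊚ inl = 0
  total : inl ⊚ fst + inr ⊚ snd = A.one pt
  d_inr : (A.Hom Y pt).d inr = 0
  d_fst : (A.Hom pt X).d fst = 0
  d_inl : (A.Hom X pt).d inl = inr ⊚ f
  d_snd : (A.Hom pt Y).d snd = -(f ⊚ fst)

/-- A strongly pretriangulated DG category: one with a zero object, shifts of objects and cones
of closed morphisms of degree `0`. The shift `X[n]` comes with a closed isomorphism `X → X[n]` of
degree `-n`. -/
class StrongPretriangulated (A : DGCat k) where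
  /-- the zero object -/
  zero : A.Obj
  one_zero : A.one zero = 0
  /-- the shifts -/
  sh : ℤ → A.Obj → A.Obj
  /-- the isomorphism `X → X[n]` of degree `-n` -/
  up : ∀ n X, A.Hom X (sh n X)
  /-- the isomorphism `X[n] → X` of degree `n` -/
  dn : ∀ n X, A.Hom (sh n X) X
  up_mem : ∀ n X, up n X ∈ (A.Hom X (sh n X)).gr (-n)
  dn_mem : ∀ n X, dn n X ∈ (A.Hom (sh n X) X).gr n
  d_up : ∀ n X, (A.Hom X (sh n X)).d (up n X) = 0
  d_dn : ∀ n X, (A.Hom (sh n X) X).d (dn n X) = 0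
  up_dn : ∀ n X, up n X ⊚ dn n X = A.one _
  dn_up : ∀ n X, dn n X ⊚ up n X = A.one _
  /-- the cones -/
  cone : ∀ {X Y : A.Obj} (f : A.Hom X Y), f ∈ A.closed X Y → Cone f

namespace Ho

variable [SP : StrongPretriangulated A]

open StrongPretriangulated

theorem dn_up_assoc {n : ℤ} {X Y : A.Obj} (f : A.Hom Y X) : dn n X ⊚ up n X ⊚ f = f := by
  rw [← A.assoc, dn_up, A.one_comp]

theorem up_dn_assoc {n : ℤ} {X Y : A.Obj} (f : A.Hom Y (sh n X)) :
    up n X ⊚ dn n X ⊚ f = f := by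
  rw [← A.assoc, up_dn, A.one_comp]

theorem shift_closed (n : ℤ) {X Y : A.Obj} {f : A.Hom X Y} (hf : f ∈ A.closed X Y) :
    up n Y ⊚ f ⊚ dn n X ∈ A.closed (sh n X) (sh n Y) :=
  ⟨comp_mem' (up_mem n Y) (comp_mem' hf.1 (dn_mem n X) rfl) (by ring),
    d_comp_zero (d_up n Y) (d_comp_zero hf.2 (d_dn n X))⟩

/-- The shift functor on objects. -/
abbrev shObj (n : ℤ) (X : Ho A) : Ho A := ⟨sh n X.obj⟩

/-- The shift functors on the homotopy category; under the identifications `X → X[n]` they are the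
identity on morphisms. -/
def shFunctor (n : ℤ) : Ho A ⥤ Ho A where
  obj := shObj n
  map {X Y} := Quotient.map (fun f => ⟨up n Y.obj ⊚ f.1 ⊚ dn n X.obj, shift_closed n f.2⟩) (by
    intro f g hfg
    obtain ⟨h, hh, hh'⟩ : Homotopic f.1 g.1 := (Submodule.quotientRel_def _).1 hfg
    refine (Submodule.quotientRel_def _).2 (?_ : Homotopic _ _)
    refine ⟨n.negOnePow.1 • (up n Y.obj ⊚ h ⊚ dn n X.obj), zsmul_mem (comp_mem' (up_mem _ _)
      (comp_mem' hh (dn_mem _ _) rfl) (by ring)) _, ?_⟩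
    change (A.Hom (sh n X.obj) (sh n Y.obj)).d _ = up n Y.obj ⊚ f.1 ⊚ dn n X.obj -
      up n Y.obj ⊚ g.1 ⊚ dn n X.obj
    rw [map_zsmul, A.leibniz _ (up_mem _ _), A.leibniz _ hh, d_up, d_dn, hh']
    simp [smul_smul])
  map_id X := congrArg Submodule.Quotient.mk (Subtype.ext (by
    change up n X.obj ⊚ A.one X.obj ⊚ dn n X.obj = A.one _
    rw [A.one_comp, up_dn]))
  map_comp := by
    rintro X Y Z ⟨f⟩ ⟨g⟩
    refine congrArg Submodule.Quotient.mk (Subtype.ext ?_)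
    change up n Z.obj ⊚ (g.1 ⊚ f.1) ⊚ dn n X.obj =
      (up n Z.obj ⊚ g.1 ⊚ dn n Y.obj) ⊚ (up n Y.obj ⊚ f.1 ⊚ dn n X.obj)
    simp only [A.assoc, dn_up_assoc]

theorem shFunctor_map_mk (n : ℤ) {X Y : Ho A} (f : A.Hom X.obj Y.obj)
    (hf : f ∈ A.closed X.obj Y.obj) :
    (shFunctor n).map (cls f hf : X ⟶ Y) =
      (cls (up n Y.obj ⊚ f ⊚ dn n X.obj) (shift_closed n hf) : shObj n X ⟶ shObj n Y) := rfl

/-- `X[0] ≅ X`. -/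
def shZero : shFunctor (A := A) 0 ≅ 𝟭 (Ho A) :=
  NatIso.ofComponents (fun X => isoMk (dn 0 X.obj) (up 0 X.obj) ⟨dn_mem _ _, d_dn _ _⟩
    ⟨(by simpa using up_mem 0 X.obj : up 0 X.obj ∈ (A.Hom X.obj (sh 0 X.obj)).gr 0), d_up _ _⟩ (homotopic_of_eq (dn_up _ _))
    (homotopic_of_eq (up_dn _ _))) (by
    intro X Y φ
    obtain ⟨f, hf, rfl⟩ := cls_surjective φ
    refine cls_congr (?_ : dn 0 Y.obj ⊚ up 0 Y.obj ⊚ f ⊚ dn 0 X.obj = f ⊚ dn 0 X.obj)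
    rw [dn_up_assoc])

/-- `X[m + n] ≅ X[m][n]`. -/
def shAdd (m n : ℤ) : shFunctor (A := A) (m + n) ≅ shFunctor m ⋙ shFunctor n :=
  NatIso.ofComponents (fun X => isoMk (X := shObj (m + n) X) (Y := shObj n (shObj m X))
      (up n (sh m X.obj) ⊚ up m X.obj ⊚ dn (m + n) X.obj)
      (up (m + n) X.obj ⊚ dn m X.obj ⊚ dn n (sh m X.obj))
      ⟨comp_mem' (up_mem _ _) (comp_mem' (up_mem _ _) (dn_mem _ _) rfl) (by ring),
        d_comp_zero (d_up _ _) (d_comp_zero (d_up _ _) (d_dn _ _))⟩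
      ⟨comp_mem' (up_mem _ _) (comp_mem' (dn_mem _ _) (dn_mem _ _) rfl) (by ring),
        d_comp_zero (d_up _ _) (d_comp_zero (d_dn _ _) (d_dn _ _))⟩
      (homotopic_of_eq (by simp only [A.assoc, dn_up_assoc, up_dn_assoc]; exact up_dn _ _))
      (homotopic_of_eq (by simp only [A.assoc, dn_up_assoc]; exact up_dn _ _))) (by
    intro X Y φ
    obtain ⟨f, hf, rfl⟩ := cls_surjective φ
    refine cls_congr (?_ : (up n (sh m Y.obj) ⊚ up m Y.obj ⊚ dn (m + n) Y.obj) ⊚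
      (up (m + n) Y.obj ⊚ f ⊚ dn (m + n) X.obj) = (up n (sh m Y.obj) ⊚
        (up m Y.obj ⊚ f ⊚ dn m X.obj) ⊚ dn n (sh m X.obj)) ⊚
          (up n (sh m X.obj) ⊚ up m X.obj ⊚ dn (m + n) X.obj))
    simp only [A.assoc, dn_up_assoc])

theorem eqToHom_sh {X : Ho A} {m n : ℤ} (h : m = n) (e : shObj m X = shObj n X) :
    eqToHom e = (cls (up n X.obj ⊚ dn m X.obj) ⟨comp_mem' (up_mem _ _) (dn_mem _ _) (by omega),
      d_comp_zero (d_up _ _) (d_dn _ _)⟩ : shObj m X ⟶ shObj n X) := by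
  subst h
  exact cls_congr (up_dn _ _).symm

/-- The shifts form a weak action of `ℤ`. -/
def shCore : ShiftMkCore (Ho A) ℤ where
  F := shFunctor
  zero := shZero
  add := shAdd
  assoc_hom_app m₁ m₂ m₃ X := by
    refine Eq.trans ?_ (congrArg (fun t : shObj (m₁ + m₂ + m₃) X ⟶ shObj (m₁ + (m₂ + m₃)) X =>
      t ≫ ((shAdd m₁ (m₂ + m₃)).hom.app X ≫ (shAdd m₂ m₃).hom.app (shObj m₁ X)))
      (eqToHom_sh (add_assoc m₁ m₂ m₃) _).symm)
    refine cls_congr (?_ : (up m₃ _ ⊚ (up m₂ _ ⊚ up m₁ X.obj ⊚ dn (m₁ + m₂) X.obj) ⊚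
      dn m₃ _) ⊚ (up m₃ _ ⊚ up (m₁ + m₂) X.obj ⊚ dn (m₁ + m₂ + m₃) X.obj) =
      ((up m₃ _ ⊚ up m₂ _ ⊚ dn (m₂ + m₃) _) ⊚ (up (m₂ + m₃) _ ⊚ up m₁ X.obj ⊚
        dn (m₁ + (m₂ + m₃)) X.obj)) ⊚ (up (m₁ + (m₂ + m₃)) X.obj ⊚ dn (m₁ + m₂ + m₃) X.obj))
    simp only [A.assoc, dn_up_assoc]
  zero_add_hom_app n X := by
    refine Eq.trans ?_ (congrArg (fun t : shObj (0 + n) X ⟶ shObj n X =>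
      t ≫ (shFunctor n).map (shZero.inv.app X)) (eqToHom_sh (zero_add n) _).symm)
    refine cls_congr (?_ : up n _ ⊚ up 0 X.obj ⊚ dn (0 + n) X.obj =
      (up n _ ⊚ up 0 X.obj ⊚ dn n X.obj) ⊚ (up n X.obj ⊚ dn (0 + n) X.obj))
    simp only [A.assoc, dn_up_assoc]
  add_zero_hom_app n X := by
    refine Eq.trans ?_ (congrArg (fun t : shObj (n + 0) X ⟶ shObj n X =>
      t ≫ shZero.inv.app (shObj n X)) (eqToHom_sh (add_zero n) _).symm)
    refine cls_congr (?_ : up 0 _ ⊚ up n X.obj ⊚ dn (n + 0) X.obj =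
      up 0 _ ⊚ (up n X.obj ⊚ dn (n + 0) X.obj))
    rfl

instance : HasShift (Ho A) ℤ := hasShiftMk _ _ shCore

instance (n : ℤ) : (shiftFunctor (Ho A) n).Additive where
  map_add := by
    intro X Y φ ψ
    obtain ⟨f, hf, rfl⟩ := cls_surjective φ
    obtain ⟨g, hg, rfl⟩ := cls_surjective ψ
    refine cls_congr (?_ : up n Y.obj ⊚ (f + g) ⊚ dn n X.obj =
      up n Y.obj ⊚ f ⊚ dn n X.obj + up n Y.obj ⊚ g ⊚ dn n X.obj)
    simp

instance : Limits.HasZeroObject (Ho A) :=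
  ⟨⟨⟨SP.zero⟩, (Limits.IsZero.iff_id_eq_zero _).2 (cls_congr one_zero)⟩⟩

end Ho

variable (A)

variable {A}

namespace Ho

namespace Aux

variable {X Y : A.Obj} {f : A.Hom X Y} (C : Cone f)

theorem fst_inl_assoc {W : A.Obj} (a : A.Hom W X) : C.fst ⊚ C.inl ⊚ a = a := by
  rw [← A.assoc, C.fst_inl, A.one_comp]
theorem snd_inr_assoc {W : A.Obj} (a : A.Hom W Y) : C.snd ⊚ C.inr ⊚ a = a := by
  rw [← A.assoc, C.snd_inr, A.one_comp]
theorem fst_inr_assoc {W : A.Obj} (a : A.Hom W Y) : C.fst ⊚ C.inr ⊚ a = 0 := by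
  rw [← A.assoc, C.fst_inr]; simp
theorem snd_inl_assoc {W : A.Obj} (a : A.Hom W X) : C.snd ⊚ C.inl ⊚ a = 0 := by
  rw [← A.assoc, C.snd_inl]; simp
theorem inr_snd : C.inr ⊚ C.snd = A.one _ - C.inl ⊚ C.fst := by rw [← C.total]; abel
theorem inr_snd_assoc {W : A.Obj} (a : A.Hom W C.pt) :
    C.inr ⊚ C.snd ⊚ a = a - C.inl ⊚ C.fst ⊚ a := by
  rw [← A.assoc, inr_snd]; simp [A.one_comp, A.assoc]
theorem sgn_inr : (A.Hom _ _).sgn C.inr = C.inr := by simp [GrMod.sgn_of_mem _ C.inr_mem]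
theorem sgn_snd : (A.Hom _ _).sgn C.snd = C.snd := by simp [GrMod.sgn_of_mem _ C.snd_mem]
theorem sgn_fst : (A.Hom _ _).sgn C.fst = -C.fst := by simp [GrMod.sgn_of_mem _ C.fst_mem]
theorem sgn_inl : (A.Hom _ _).sgn C.inl = -C.inl := by simp [GrMod.sgn_of_mem _ C.inl_mem]
theorem sgn_closed (hf : f ∈ A.closed X Y) : (A.Hom _ _).sgn f = f := by
  simp [GrMod.sgn_of_mem _ hf.1]
theorem inr_closed {X Y : A.Obj} {f : A.Hom X Y} (C : Cone f) : C.inr ∈ A.closed Y C.pt :=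
  ⟨C.inr_mem, C.d_inr⟩

theorem complete_std {X Y X' Y' : A.Obj} {f : A.Hom X Y} (C : Cone f)
    {f' : A.Hom X' Y'} (C' : Cone f') {a : A.Hom X X'}
    {b : A.Hom Y Y'} (ha : a ∈ A.closed X X') (hb : b ∈ A.closed Y Y')
    (h : Homotopic (b ⊚ f) (f' ⊚ a)) :
    ∃ c ∈ A.closed C.pt C'.pt, c ⊚ C.inr = C'.inr ⊚ b ∧ C'.fst ⊚ c = a ⊚ C.fst := by
  obtain ⟨h, hh, hd⟩ := h
  have hda : (A.Hom _ _).d a = 0 := ha.2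
  have hdb : (A.Hom _ _).d b = 0 := hb.2
  have hsh : (A.Hom _ _).sgn h = -h := by simp [GrMod.sgn_of_mem _ hh]
  refine ⟨C'.inr ⊚ b ⊚ C.snd + C'.inl ⊚ a ⊚ C.fst + C'.inr ⊚ h ⊚ C.fst, ⟨?_, ?_⟩, ?_, ?_⟩
  · exact add_mem (add_mem (comp_mem' C'.inr_mem (comp_mem' hb.1 C.snd_mem rfl) rfl)
      (comp_mem' C'.inl_mem (comp_mem' ha.1 C.fst_mem rfl) rfl))
      (comp_mem' C'.inr_mem (comp_mem' hh C.fst_mem rfl) rfl)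
  · refine LinearMap.mem_ker.2 ?_
    simp only [ map_add, leibniz_sgn, C.d_snd, C.d_fst, C'.d_inr, C'.d_inl, hda,
      hdb, hd, sgn_inr, sgn_inl, sgn_closed hb, sgn_closed ha, hsh]
    simp [A.assoc]
  · simp [A.assoc, C.snd_inr, C.fst_inr, A.comp_one]
  · simp [fst_inr_assoc, fst_inl_assoc]

theorem contr {X : A.Obj} (C : Cone (A.one X)) : Homotopic (A.one C.pt) 0 := by
  refine ⟨C.inl ⊚ C.snd, comp_mem' C.inl_mem C.snd_mem (by ring), ?_⟩
  rw [leibniz_sgn, C.d_inl, C.d_snd, sgn_inl, ← C.total]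
  simp [A.comp_one, A.one_comp]
  abel

end Aux

variable [SP : StrongPretriangulated A]

open StrongPretriangulated Pretriangulated Aux

namespace Aux

theorem sgn_up_one (X : A.Obj) : (A.Hom _ _).sgn (up 1 X) = -up 1 X := by
  simp [GrMod.sgn_of_mem _ (up_mem 1 X)]
theorem sgn_dn_one (X : A.Obj) : (A.Hom _ _).sgn (dn 1 X) = -dn 1 X := by
  simp [GrMod.sgn_of_mem _ (dn_mem 1 X)]
theorem sgn_up_neg (X : A.Obj) : (A.Hom _ _).sgn (up (-1) X) = -up (-1) X := by
  simp [GrMod.sgn_of_mem _ (up_mem (-1) X)]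
theorem sgn_dn_neg (X : A.Obj) : (A.Hom _ _).sgn (dn (-1) X) = -dn (-1) X := by
  simp [GrMod.sgn_of_mem _ (dn_mem (-1) X)]

end Aux

theorem up_fst_closed {X Y : A.Obj} {f : A.Hom X Y} (C : Cone f) :
    up 1 X ⊚ C.fst ∈ A.closed C.pt (sh 1 X) :=
  ⟨comp_mem' (up_mem _ _) C.fst_mem (by ring), d_comp_zero (d_up _ _) C.d_fst⟩

/-- The standard triangle `X → Y → Cone f → X[1]`. -/
def stdTriangle {X Y : A.Obj} (f : A.Hom X Y) (hf : f ∈ A.closed X Y) (C : Cone f) :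
    Triangle (Ho A) :=
  Triangle.mk (X := (⟨X⟩ : Ho A)) (Y := ⟨Y⟩) (Z := ⟨C.pt⟩) (cls f hf)
    (cls C.inr (inr_closed C))
    (cls (X := ⟨C.pt⟩) (Y := ⟨sh 1 X⟩) (up 1 X ⊚ C.fst) (up_fst_closed C))

/-- The distinguished triangles are those isomorphic to a standard triangle. -/
def distTriangles : Set (Triangle (Ho A)) :=
  {T | ∃ (X Y : A.Obj) (f : A.Hom X Y) (hf : f ∈ A.closed X Y) (C : Cone f),
    Nonempty (T ≅ stdTriangle f hf C)}

theorem contractible_mem (X : Ho A) : contractibleTriangle X ∈ distTriangles := by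
  let C := cone (A.one X.obj) (one_closed _)
  have hz : Limits.IsZero (⟨C.pt⟩ : Ho A) := by
    rw [Limits.IsZero.iff_id_eq_zero]
    exact cls_eq_iff.2 (contr C)
  refine ⟨_, _, A.one X.obj, one_closed _, C, ⟨Triangle.isoMk _ _ (Iso.refl _) (Iso.refl _)
    ((Limits.isZero_zero _).iso hz) ?_ ?_ ?_⟩⟩
  · rfl
  · exact hz.eq_of_tgt _ _
  · exact (Limits.isZero_zero (Ho A)).eq_of_src _ _

theorem dist_of_iso {T T' : Triangle (Ho A)} (e : T' ≅ T) (h : T ∈ distTriangles) :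
    T' ∈ distTriangles := by
  obtain ⟨X, Y, f, hf, C, ⟨e'⟩⟩ := h
  exact ⟨X, Y, f, hf, C, ⟨e ≪≫ e'⟩⟩

theorem complete_dist (T₁ T₂ : Triangle (Ho A)) (h₁ : T₁ ∈ distTriangles)
    (h₂ : T₂ ∈ distTriangles) (a : T₁.obj₁ ⟶ T₂.obj₁) (b : T₁.obj₂ ⟶ T₂.obj₂)
    (comm : T₁.mor₁ ≫ b = a ≫ T₂.mor₁) :
    ∃ c : T₁.obj₃ ⟶ T₂.obj₃, T₁.mor₂ ≫ c = b ≫ T₂.mor₂ ∧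
      T₁.mor₃ ≫ a⟦(1 : ℤ)⟧' = c ≫ T₂.mor₃ := by
  obtain ⟨X, Y, f, hf, C, ⟨e⟩⟩ := h₁
  obtain ⟨X', Y', f', hf', C', ⟨e'⟩⟩ := h₂
  obtain ⟨a', ha', ea⟩ := cls_surjective (X := ⟨X⟩) (Y := ⟨X'⟩) (e.inv.hom₁ ≫ a ≫ e'.hom.hom₁)
  obtain ⟨b', hb', eb⟩ := cls_surjective (X := ⟨Y⟩) (Y := ⟨Y'⟩) (e.inv.hom₂ ≫ b ≫ e'.hom.hom₂)
  have key : (stdTriangle f hf C).mor₁ ≫ (e.inv.hom₂ ≫ b ≫ e'.hom.hom₂) =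
      (e.inv.hom₁ ≫ a ≫ e'.hom.hom₁) ≫ (stdTriangle f' hf' C').mor₁ := by
    have h1 := e.inv.comm₁
    have h2 := e'.hom.comm₁
    rw [Category.assoc, Category.assoc, ← h2, reassoc_of% h1, reassoc_of% comm]
  have key' : (stdTriangle f hf C).mor₁ ≫ cls (X := ⟨Y⟩) (Y := ⟨Y'⟩) b' hb' =
      cls (X := ⟨X⟩) (Y := ⟨X'⟩) a' ha' ≫ (stdTriangle f' hf' C').mor₁ := ea ▸ eb ▸ key
  obtain ⟨c, hc, hc₁, hc₂⟩ := complete_std C C' ha' hb' (cls_eq_iff.1 key')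
  let c' : (stdTriangle f hf C).obj₃ ⟶ (stdTriangle f' hf' C').obj₃ := cls c hc
  have k₁ : (stdTriangle f hf C).mor₂ ≫ c' =
      (e.inv.hom₂ ≫ b ≫ e'.hom.hom₂) ≫ (stdTriangle f' hf' C').mor₂ := by
    exact Eq.trans (cls_congr hc₁ : _ = (cls b' hb' : (⟨Y⟩ : Ho A) ⟶ ⟨Y'⟩) ≫
      (stdTriangle f' hf' C').mor₂) (congrArg (fun t => t ≫ (stdTriangle f' hf' C').mor₂) eb.symm)
  have k₂ : (stdTriangle f hf C).mor₃ ≫ (e.inv.hom₁ ≫ a ≫ e'.hom.hom₁)⟦(1 : ℤ)⟧' =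
      c' ≫ (stdTriangle f' hf' C').mor₃ := by
    refine Eq.trans (congrArg (fun t => _ ≫ (shiftFunctor (Ho A) (1 : ℤ)).map t) ea) ?_
    refine cls_congr (?_ : (up 1 X' ⊚ a' ⊚ dn 1 X) ⊚ (up 1 X ⊚ C.fst) = (up 1 X' ⊚ C'.fst) ⊚ c)
    simp only [A.assoc, dn_up_assoc, hc₂]
  refine ⟨e.hom.hom₃ ≫ c' ≫ e'.inv.hom₃, ?_, ?_⟩
  · have h1 := e.hom.comm₂
    have h2 := e'.inv.comm₂
    rw [reassoc_of% h1, reassoc_of% k₁, h2]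
    simp
  · have h1 := e.hom.comm₃
    have h2 := e'.inv.comm₃
    rw [Category.assoc, Category.assoc, ← h2, ← reassoc_of% k₂, ← reassoc_of% h1]
    simp [← Functor.map_comp]

namespace Aux

variable {X Y : A.Obj} {f : A.Hom X Y} (C : Cone f) (D : Cone C.inr)

theorem rot_closed : up 1 X ⊚ C.fst ⊚ D.snd ∈ A.closed D.pt (sh 1 X) := by
  refine ⟨comp_mem' (up_mem _ _) (comp_mem' C.fst_mem D.snd_mem rfl) (by ring), ?_⟩
  refine LinearMap.mem_ker.2 ?_
  simp only [leibniz_sgn, d_up, C.d_fst, D.d_snd, sgn_up_one, sgn_fst]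
  simp [fst_inr_assoc]

theorem rot_closed' (hf : f ∈ A.closed X Y) :
    (D.inr ⊚ C.inl - D.inl ⊚ f) ⊚ dn 1 X ∈ A.closed (sh 1 X) D.pt := by
  have hdf : (A.Hom _ _).d f = 0 := hf.2
  refine ⟨comp_mem' (sub_mem (comp_mem' D.inr_mem C.inl_mem rfl)
      (comp_mem' D.inl_mem hf.1 rfl)) (dn_mem _ _) (by ring), ?_⟩
  refine LinearMap.mem_ker.2 ?_
  simp only [map_sub, LinearMap.sub_apply]
  simp only [leibniz_sgn, d_dn, D.d_inr, C.d_inl, D.d_inl, hdf, sgn_inr, sgn_inl]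
  simp [A.assoc]

theorem rot_hom : (up 1 X ⊚ C.fst ⊚ D.snd) ⊚ ((D.inr ⊚ C.inl - D.inl ⊚ f) ⊚ dn 1 X) =
    A.one _ := by
  simp [A.assoc, snd_inr_assoc, fst_inl_assoc, snd_inl_assoc, up_dn]

theorem rot_inv :
    Homotopic (((D.inr ⊚ C.inl - D.inl ⊚ f) ⊚ dn 1 X) ⊚ (up 1 X ⊚ C.fst ⊚ D.snd))
      (A.one _) := by
  refine ⟨-(D.inl ⊚ C.snd ⊚ D.snd), neg_mem (comp_mem' D.inl_mem
    (comp_mem' C.snd_mem D.snd_mem rfl) (by ring)), ?_⟩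
  simp only [map_neg, leibniz_sgn, D.d_inl, C.d_snd, D.d_snd, sgn_inl, sgn_snd]
  simp [A.assoc, dn_up_assoc, snd_inr_assoc, inr_snd_assoc, inr_snd]
  abel

theorem rot_comm :
    Homotopic (up 1 Y ⊚ D.fst) ((-(up 1 Y ⊚ f ⊚ dn 1 X)) ⊚ (up 1 X ⊚ C.fst ⊚ D.snd)) := by
  refine ⟨up 1 Y ⊚ C.snd ⊚ D.snd, comp_mem' (up_mem _ _)
    (comp_mem' C.snd_mem D.snd_mem rfl) (by ring), ?_⟩
  simp only [map_neg, leibniz_sgn, d_up, C.d_snd, D.d_snd, sgn_up_one, sgn_snd]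
  simp [A.assoc, dn_up_assoc, snd_inr_assoc]

variable (E : Cone (-(C.fst ⊚ dn (-1) C.pt)))

theorem inv_closed (hf : f ∈ A.closed X Y) :
    f ⊚ E.snd + C.snd ⊚ dn (-1) C.pt ⊚ E.fst ∈ A.closed E.pt Y := by
  have hdf : (A.Hom _ _).d f = 0 := hf.2
  refine ⟨add_mem (comp_mem' hf.1 E.snd_mem rfl)
    (comp_mem' C.snd_mem (comp_mem' (dn_mem _ _) E.fst_mem rfl) rfl), ?_⟩
  refine LinearMap.mem_ker.2 ?_
  simp only [leibniz_sgn, map_add, d_dn, hdf, E.d_snd, E.d_fst, C.d_snd, sgn_closed hf, sgn_snd]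
  simp [A.assoc]

theorem inv_closed' : E.inl ⊚ up (-1) C.pt ⊚ C.inr ∈ A.closed Y E.pt := by
  refine ⟨comp_mem' E.inl_mem (comp_mem' (up_mem _ _) C.inr_mem rfl) (by ring), ?_⟩
  refine LinearMap.mem_ker.2 ?_
  simp only [leibniz_sgn, d_up, E.d_inl, C.d_inr]
  simp [A.assoc, dn_up_assoc, C.fst_inr]

theorem inv_hom : (f ⊚ E.snd + C.snd ⊚ dn (-1) C.pt ⊚ E.fst) ⊚
    (E.inl ⊚ up (-1) C.pt ⊚ C.inr) = A.one _ := by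
  simp [A.assoc, fst_inl_assoc, snd_inl_assoc, dn_up_assoc, C.snd_inr]

theorem inv_inv : Homotopic ((E.inl ⊚ up (-1) C.pt ⊚ C.inr) ⊚
    (f ⊚ E.snd + C.snd ⊚ dn (-1) C.pt ⊚ E.fst)) (A.one _) := by
  refine ⟨E.inl ⊚ up (-1) C.pt ⊚ C.inl ⊚ E.snd, comp_mem' E.inl_mem (comp_mem' (up_mem _ _)
    (comp_mem' C.inl_mem E.snd_mem rfl) rfl) (by ring), ?_⟩
  simp only [leibniz_sgn, d_up, E.d_inl, E.d_snd, C.d_inl, sgn_inl, sgn_up_neg]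
  simp [A.assoc, dn_up_assoc, up_dn_assoc, fst_inl_assoc, inr_snd_assoc, inr_snd]
  abel

theorem inv_comm : Homotopic (up 1 _ ⊚ E.fst) ((up 1 _ ⊚ up (-1) C.pt ⊚ C.inr) ⊚
    (f ⊚ E.snd + C.snd ⊚ dn (-1) C.pt ⊚ E.fst)) := by
  refine ⟨-(up 1 _ ⊚ up (-1) C.pt ⊚ C.inl ⊚ E.snd), neg_mem (comp_mem' (up_mem _ _)
    (comp_mem' (up_mem _ _) (comp_mem' C.inl_mem E.snd_mem rfl) rfl) (by ring)), ?_⟩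
  simp only [map_neg, leibniz_sgn, d_up, E.d_snd, C.d_inl, sgn_inl, sgn_up_neg, sgn_up_one]
  simp [A.assoc, up_dn_assoc, inr_snd_assoc]
  abel

end Aux

theorem rotate_std {X Y : A.Obj} (f : A.Hom X Y) (hf : f ∈ A.closed X Y) (C : Cone f) :
    (stdTriangle f hf C).rotate ∈ distTriangles := by
  let D := cone C.inr (inr_closed C)
  refine ⟨_, _, C.inr, inr_closed C, D, ⟨Iso.symm (Triangle.isoMk _ _ (Iso.refl _) (Iso.refl _)
    (isoMk (X := ⟨D.pt⟩) (Y := ⟨sh 1 X⟩) _ _ (rot_closed C D) (rot_closed' C D hf)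
      (homotopic_of_eq (rot_hom C D)) (rot_inv C D)) ?_ ?_ ?_)⟩⟩
  · exact (Category.comp_id _).trans (Category.id_comp _).symm
  · refine Eq.trans (cls_congr (?_ : (up 1 X ⊚ C.fst ⊚ D.snd) ⊚ D.inr = up 1 X ⊚ C.fst))
      (Category.id_comp _).symm
    simp [A.assoc, D.snd_inr, A.comp_one]
  · refine Eq.trans ?_ (cls_eq_iff (X := ⟨D.pt⟩) (Y := ⟨sh 1 Y⟩) (hf := up_fst_closed D)
      (hg := comp_closed (neg_mem (shift_closed 1 hf)) (rot_closed C D)) |>.2 (rot_comm C D))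
    refine Eq.trans ?_ (Category.comp_id _)
    exact congrArg _ (CategoryTheory.Functor.map_id _ _)

theorem shiftAdd'_hom_app (X : Ho A) (i j n : ℤ) (h : i + j = n) :
    (shiftFunctorAdd' (Ho A) i j n h).hom.app X =
      (cls (X := shObj n X) (Y := shObj j (shObj i X)) (up j (sh i X.obj) ⊚ up i X.obj ⊚ dn n X.obj)
        ⟨comp_mem' (up_mem _ _) (comp_mem' (up_mem _ _) (dn_mem _ _) rfl) (by omega),
        d_comp_zero (d_up _ _) (d_comp_zero (d_up _ _) (d_dn _ _))⟩) := by
  subst h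
  rw [shiftFunctorAdd'_eq_shiftFunctorAdd]
  rfl

theorem shiftAdd'_inv_app (X : Ho A) (i j n : ℤ) (h : i + j = n) :
    (shiftFunctorAdd' (Ho A) i j n h).inv.app X =
      (cls (X := shObj j (shObj i X)) (Y := shObj n X) (up n X.obj ⊚ dn i X.obj ⊚ dn j (sh i X.obj))
        ⟨comp_mem' (up_mem _ _) (comp_mem' (dn_mem _ _) (dn_mem _ _) rfl) (by omega),
        d_comp_zero (d_up _ _) (d_comp_zero (d_dn _ _) (d_dn _ _))⟩) := by
  subst h
  rw [shiftFunctorAdd'_eq_shiftFunctorAdd]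
  rfl

theorem compNeg_hom_app (X : Ho A) (i j : ℤ) (h : i + j = 0) :
    (shiftFunctorCompIsoId (Ho A) i j h).hom.app X =
      (cls (X := shObj j (shObj i X)) (Y := X) (dn i X.obj ⊚ dn j (sh i X.obj))
        ⟨comp_mem' (dn_mem _ _) (dn_mem _ _) h, d_comp_zero (d_dn _ _) (d_dn _ _)⟩) := by
  dsimp only [shiftFunctorCompIsoId, Iso.trans_hom, Iso.symm_hom, NatTrans.comp_app]
  refine Eq.trans (congrArg (fun t => t ≫ (shiftFunctorZero (Ho A) ℤ).hom.app X)
    (shiftAdd'_inv_app X i j 0 h)) ?_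
  refine cls_congr (?_ : dn 0 X.obj ⊚ up 0 X.obj ⊚ dn i X.obj ⊚ dn j (sh i X.obj) = _)
  rw [dn_up_assoc]

theorem compNeg_inv_app (X : Ho A) (i j : ℤ) (h : i + j = 0) :
    (shiftFunctorCompIsoId (Ho A) i j h).inv.app X =
      (cls (X := X) (Y := shObj j (shObj i X)) (up j (sh i X.obj) ⊚ up i X.obj)
        ⟨comp_mem' (up_mem _ _) (up_mem _ _) (by omega), d_comp_zero (d_up _ _) (d_up _ _)⟩) := by
  dsimp only [shiftFunctorCompIsoId, Iso.trans_inv, Iso.symm_inv, NatTrans.comp_app]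
  refine Eq.trans (congrArg (fun t => (shiftFunctorZero (Ho A) ℤ).inv.app X ≫ t)
    (shiftAdd'_hom_app X i j 0 h)) ?_
  refine cls_congr (?_ : (up j (sh i X.obj) ⊚ up i X.obj ⊚ dn 0 X.obj) ⊚ up 0 X.obj = _)
  rw [A.assoc, A.assoc, dn_up, A.comp_one]

theorem inv_aux_closed {X Y : A.Obj} {f : A.Hom X Y} (C : Cone f) :
    -(C.fst ⊚ dn (-1) C.pt) ∈ A.closed (sh (-1) C.pt) X :=
  neg_mem ⟨comp_mem' C.fst_mem (dn_mem _ _) (by ring), d_comp_zero C.d_fst (d_dn _ _)⟩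

theorem invRotate_std {X Y : A.Obj} (f : A.Hom X Y) (hf : f ∈ A.closed X Y) (C : Cone f) :
    (stdTriangle f hf C).invRotate ∈ distTriangles := by
  let E := cone _ (inv_aux_closed C)
  refine ⟨_, _, _, inv_aux_closed C, E, ⟨Iso.symm (Triangle.isoMk _ _ (Iso.refl _) (Iso.refl _)
    (isoMk (X := ⟨E.pt⟩) (Y := ⟨Y⟩) _ _ (inv_closed C E hf) (inv_closed' C E)
      (homotopic_of_eq (inv_hom C E)) (inv_inv C E)) ?_ ?_ ?_)⟩⟩
  · refine (Category.comp_id _).trans (Eq.trans ?_ (Category.id_comp _).symm)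
    change _ = -(((shiftFunctor (Ho A) (-1 : ℤ)).map (stdTriangle f hf C).mor₃) ≫
      (shiftFunctorCompIsoId (Ho A) (1 : ℤ) (-1) (by norm_num)).hom.app (⟨X⟩ : Ho A))
    refine Eq.trans ?_ (congrArg (fun t => -(((shiftFunctor (Ho A) (-1 : ℤ)).map
      (stdTriangle f hf C).mor₃) ≫ t)) (compNeg_hom_app (⟨X⟩ : Ho A) 1 (-1) (by norm_num)).symm)
    refine cls_congr (?_ : -(C.fst ⊚ dn (-1) C.pt) =
      -((dn 1 X ⊚ dn (-1) (sh 1 X)) ⊚ (up (-1) (sh 1 X) ⊚ (up 1 X ⊚ C.fst) ⊚ dn (-1) C.pt)))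
    simp [A.assoc, dn_up_assoc]
  · refine Eq.trans (cls_congr (?_ : (f ⊚ E.snd + C.snd ⊚ dn (-1) C.pt ⊚ E.fst) ⊚ E.inr = f))
      (Category.id_comp _).symm
    simp [A.assoc, E.snd_inr, E.fst_inr, A.comp_one]
  · refine Eq.trans (congrArg _ (CategoryTheory.Functor.map_id _ _)) (Eq.trans (Category.comp_id _) ?_)
    refine Eq.trans ?_ (congrArg (fun t => cls _ (inv_closed C E hf) ≫
      ((stdTriangle f hf C).mor₂ ≫ t))
      (compNeg_inv_app (⟨C.pt⟩ : Ho A) (-1) 1 (by norm_num)).symm)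
    refine Eq.trans (cls_eq_iff (X := ⟨E.pt⟩) (Y := ⟨sh 1 (sh (-1) C.pt)⟩)
      (hf := up_fst_closed E) (hg := comp_closed (comp_closed ⟨comp_mem' (up_mem _ _) (up_mem _ _)
        (by norm_num), d_comp_zero (d_up _ _) (d_up _ _)⟩ (inr_closed C)) (inv_closed C E hf))
      |>.2 (by simpa only [A.assoc] using inv_comm C E)) rfl

theorem rotate_dist (T : Triangle (Ho A)) :
    T ∈ distTriangles ↔ T.rotate ∈ distTriangles := by
  constructor
  · rintro ⟨X, Y, f, hf, C, ⟨e⟩⟩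
    exact dist_of_iso ((rotate (Ho A)).mapIso e) (rotate_std f hf C)
  · rintro ⟨X, Y, f, hf, C, ⟨e⟩⟩
    exact dist_of_iso ((rotCompInvRot (C := Ho A)).app T ≪≫ (invRotate (Ho A)).mapIso e)
      (invRotate_std f hf C)

/-- The triangulated structure on the homotopy category: the distinguished triangles are those
isomorphic to the triangles `X → Y → Cone f → X[1]` given by cones. -/
instance : Pretriangulated (Ho A) where
  distinguishedTriangles := distTriangles
  isomorphic_distinguished T h _ e := dist_of_iso e h
  contractible_distinguished := contractible_mem
  distinguished_cocone_triangle {X Y} φ := by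
    obtain ⟨f, hf, rfl⟩ := cls_surjective φ
    exact ⟨_, _, _, X.obj, Y.obj, f, hf, cone f hf, ⟨Iso.refl _⟩⟩
  rotate_distinguished_triangle := rotate_dist
  complete_distinguished_triangle_morphism T₁ T₂ h₁ h₂ a b comm :=
    complete_dist T₁ T₂ h₁ h₂ a b comm

end Ho

variable (A)

/-! ### Twisted complexes -/

section Sums

variable {A}

/-- The entries of an identity matrix: the identity if `i = j` and `0` otherwise. -/
def delta {ι : Type} [DecidableEq ι] (K : ι → A.Obj) (i j : ι) : A.Hom (K j) (K i) :=
  if h : i = j then h ▸ A.one (K i) else 0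

section delta

variable {ι : Type} [DecidableEq ι] (K : ι → A.Obj)

theorem delta_self (i : ι) : delta K i i = A.one (K i) := by simp [delta]

theorem delta_ne {i j : ι} (h : i ≠ j) : delta K i j = 0 := by simp [delta, h]

theorem delta_mem {i j : ι} {n : ℤ} (h : i = j → n = 0) :
    delta K i j ∈ (A.Hom (K j) (K i)).gr n := by
  by_cases e : i = j
  · subst e; rw [delta_self, h rfl]; exact A.one_mem _
  · rw [delta_ne K e]; exact zero_mem _

theorem d_delta (i j : ι) : (A.Hom (K j) (K i)).d (delta K i j) = 0 := by
  by_cases e : i = j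
  · subst e; rw [delta_self, d_one]
  · rw [delta_ne K e, map_zero]

theorem sum_delta_comp [Fintype ι] {X : A.Obj} (i : ι) (f : ∀ l, A.Hom X (K l)) :
    ∑ l, delta K i l ⊚ f l = f i := by
  rw [Finset.sum_eq_single i]
  · rw [delta_self, A.one_comp]
  · intro l _ h; rw [delta_ne K h.symm]; simp
  · simp

theorem sum_comp_delta [Fintype ι] {X : A.Obj} (j : ι) (f : ∀ l, A.Hom (K l) X) :
    ∑ l, f l ⊚ delta K l j = f j := by
  rw [Finset.sum_eq_single j]
  · rw [delta_self, A.comp_one]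
  · intro l _ h; rw [delta_ne K h]; simp
  · simp

theorem delta_comp_inj {κ : Type} [DecidableEq κ] (e : κ → ι) (he : e.Injective) (i j : κ) :
    delta K (e i) (e j) = delta (fun s => K (e s)) i j := by
  by_cases h : i = j
  · subst h; rw [delta_self, delta_self]
  · rw [delta_ne K (he.ne h), delta_ne _ h]

end delta

variable (A)

/-- A formal finite direct sum `⨁ C i [r i]` of shifts of objects of `A`. -/
structure Fam : Type u where
  /-- the number of summands -/
  n : ℕ
  /-- the objects -/
  C : Fin n → A.Obj
  /-- the shifts -/
  r : Fin n → ℤ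

variable {A}

/-- The matrices of morphisms `⨁ C j [r j] → ⨁ C' i [r' i]`; the degree `l` part of
`Hom(C j [r j], C' i [r' i])` is the degree `l + r' i - r j` part of `Hom(C j, C' i)`. -/
def matGr (X Y : Fam A) : GrMod k where
  carrier := ∀ i j, A.Hom (X.C j) (Y.C i)
  gr l :=
    { carrier := {f | ∀ i j, f i j ∈ (A.Hom (X.C j) (Y.C i)).gr (l + Y.r i - X.r j)}
      add_mem' := fun hf hg i j => add_mem (hf i j) (hg i j)
      zero_mem' := fun _ _ => zero_mem _
      smul_mem' := fun c _ hf i j => Submodule.smul_mem _ c (hf i j) }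
  isInternal := by
    let E : ∀ i j, A.Hom (X.C j) (Y.C i) →ₗ[k] ∀ i j, A.Hom (X.C j) (Y.C i) := fun i j =>
      LinearMap.single k (fun i => ∀ j, (A.Hom (X.C j) (Y.C i)).carrier) i ∘ₗ
        LinearMap.single k (fun j => (A.Hom (X.C j) (Y.C i)).carrier) j
    have hE : ∀ f : ∀ i j, A.Hom (X.C j) (Y.C i), f = ∑ i, ∑ j, E i j (f i j) := by
      intro f
      have h : ∀ i, ∑ j, E i j (f i j) = Pi.single i (f i) := fun i => by
        simp only [E, LinearMap.comp_apply]
        rw [← map_sum]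
        exact congrArg (Pi.single i) (Finset.univ_sum_single (f i))
      rw [Finset.sum_congr rfl fun i _ => h i]
      exact (Finset.univ_sum_single f).symm
    refine GrMod.isInternal_of_coact _ (∑ i, ∑ j, Finsupp.lmapDomain _ k
      (fun n => n - Y.r i + X.r j) ∘ₗ Finsupp.mapRange.linearMap (E i j) ∘ₗ
        (A.Hom (X.C j) (Y.C i)).coact ∘ₗ LinearMap.proj j ∘ₗ LinearMap.proj i) ?_ ?_
    · intro n f hf
      have h : ∀ i j, f i j ∈ (A.Hom (X.C j) (Y.C i)).gr (n + Y.r i - X.r j) := hf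
      conv_rhs => rw [hE f]
      rw [← Finsupp.lsingle_apply (R := k), map_sum]
      simp only [map_sum, LinearMap.sum_apply, LinearMap.comp_apply, LinearMap.proj_apply]
      refine Finset.sum_congr rfl fun i _ => Finset.sum_congr rfl fun j _ => ?_
      have e : n + Y.r i - X.r j - Y.r i + X.r j = n := by ring
      rw [GrMod.coact_of_mem _ (h i j)]
      simp [e]
    · intro f
      rw [hE f]
      refine sum_mem fun i _ => sum_mem fun j _ => ?_
      generalize f i j = x
      induction x using (A.Hom (X.C j) (Y.C i)).hom_induction with
      | mem n y hy =>
        refine Submodule.mem_iSup_of_mem (n - Y.r i + X.r j) fun i' j' => ?_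
        by_cases hi : i' = i
        · subst hi
          by_cases hj : j' = j
          · subst hj
            have e : n - Y.r i' + X.r j' + Y.r i' - X.r j' = n := by ring
            simpa [E, e] using hy
          · simp [E, hj]
        · simp [E, hi]
      | zero => rw [map_zero]; exact zero_mem _
      | add y z hy hz => rw [map_add]; exact add_mem hy hz

/-- The complexes of matrices: the differential of `Hom(C, C' [r])` is that of `Hom(C, C')`
times `(-1)ʳ`. -/
def matCpx (X Y : Fam A) : Cpx k where
  toGrMod := matGr X Y
  d := LinearMap.pi fun i => LinearMap.pi fun j =>
    ((Y.r i).negOnePow : ℤ) • ((A.Hom (X.C j) (Y.C i)).d ∘ₗ LinearMap.proj j ∘ₗ LinearMap.proj i)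
  d_mem {n f} hf i j := by
    have h : f i j ∈ (A.Hom (X.C j) (Y.C i)).gr (n + Y.r i - X.r j) := hf i j
    have h' := (A.Hom (X.C j) (Y.C i)).d_mem h
    rw [show n + Y.r i - X.r j + 1 = n + 1 + Y.r i - X.r j by ring] at h'
    exact zsmul_mem h' _
  d_d f := by
    refine funext fun i => funext fun j => ?_
    change ((Y.r i).negOnePow : ℤ) • (A.Hom (X.C j) (Y.C i)).d
      (((Y.r i).negOnePow : ℤ) • (A.Hom (X.C j) (Y.C i)).d (f i j)) = 0
    rw [map_zsmul, (A.Hom (X.C j) (Y.C i)).d_d]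
    simp

variable (A)

/-- The DG category of formal finite direct sums of shifts of objects of `A`. -/
def sums : DGCat k where
  Obj := Fam A
  Hom := matCpx
  one X := fun i j => delta X.C i j
  comp {X Y Z} := LinearMap.mk₂ k (fun g f => fun i j => ∑ l, g i l ⊚ f l j)
    (fun g g' f => by
      refine funext fun i => funext fun j => ?_
      exact (Finset.sum_congr rfl fun l _ => LinearMap.map_add₂ A.comp (g i l) (g' i l) (f l j)).trans
        Finset.sum_add_distrib)
    (fun c g f => by
      refine funext fun i => funext fun j => ?_
      exact (Finset.sum_congr rfl fun l _ => LinearMap.map_smul₂ A.comp c (g i l) (f l j)).trans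
        Finset.smul_sum.symm)
    (fun g f f' => by
      refine funext fun i => funext fun j => ?_
      exact (Finset.sum_congr rfl fun l _ => map_add (A.comp (g i l)) (f l j) (f' l j)).trans
        Finset.sum_add_distrib)
    (fun c g f => by
      refine funext fun i => funext fun j => ?_
      exact (Finset.sum_congr rfl fun l _ => map_smul (A.comp (g i l)) c (f l j)).trans
        Finset.smul_sum.symm)
  one_mem X i j := delta_mem _ fun h => by subst h; ring
  comp_mem {X Y Z m n g f} hg hf i j :=
    by
    have hg' : ∀ i l, g i l ∈ (A.Hom (Y.C l) (Z.C i)).gr (m + Z.r i - Y.r l) := hg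
    have hf' : ∀ l j, f l j ∈ (A.Hom (X.C j) (Y.C l)).gr (n + Y.r l - X.r j) := hf
    change ∑ l, g i l ⊚ f l j ∈ (A.Hom (X.C j) (Z.C i)).gr (m + n + Z.r i - X.r j)
    exact Submodule.sum_mem _ fun l _ => Ho.comp_mem' (hg' i l) (hf' l j) (by ring)
  one_comp {X Y} f := by
    refine funext fun i => funext fun j => ?_
    exact sum_delta_comp Y.C i fun l => f l j
  comp_one {X Y} f := by
    refine funext fun i => funext fun j => ?_
    exact sum_comp_delta X.C j fun l => f i l
  assoc {X Y Z W} h g f := by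
    refine funext fun i => funext fun j => ?_
    change ∑ l, (∑ l', h i l' ⊚ g l' l) ⊚ f l j = ∑ l', h i l' ⊚ (∑ l, g l' l ⊚ f l j)
    simp only [map_sum, LinearMap.sum_apply, A.assoc]
    exact Finset.sum_comm
  leibniz {X Y Z m g} f hg := by
    refine funext fun i => funext fun j => ?_
    have hg' : ∀ i l, g i l ∈ (A.Hom (Y.C l) (Z.C i)).gr (m + Z.r i - Y.r l) := hg
    change ((Z.r i).negOnePow : ℤ) • (A.Hom (X.C j) (Z.C i)).d (∑ l, g i l ⊚ f l j) =
      ∑ l, (((Z.r i).negOnePow : ℤ) • (A.Hom (Y.C l) (Z.C i)).d (g i l)) ⊚ f l j +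
      (m.negOnePow : ℤ) • ∑ l, g i l ⊚ (((Y.r l).negOnePow : ℤ) • (A.Hom (X.C j) (Y.C l)).d (f l j))
    rw [map_sum, Finset.smul_sum, Finset.smul_sum, ← Finset.sum_add_distrib]
    refine Finset.sum_congr rfl fun l _ => ?_
    rw [A.leibniz _ (hg' i l), smul_add, smul_smul, LinearMap.map_smul_of_tower,
      LinearMap.map_smul_of_tower, LinearMap.smul_apply, smul_smul]
    congr 2
    rw [← Units.val_mul, ← Units.val_mul, ← Int.negOnePow_add, ← Int.negOnePow_add]
    congr 1
    rw [Int.negOnePow_eq_iff]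
    exact ⟨Z.r i - Y.r l, by ring⟩

end Sums

section Twist

variable {A}

/-- The twisted differential `f ↦ df + q' f - (-1)ˡ f q` (for `f` of degree `l`). -/
noncomputable def twistD {X Y : A.Obj} (q : A.Hom X X) (q' : A.Hom Y Y) :
    A.Hom X Y →ₗ[k] A.Hom X Y :=
  (A.Hom X Y).d + A.comp q' - A.comp.flip q ∘ₗ (A.Hom X Y).sgn

theorem twistD_apply {X Y : A.Obj} (q : A.Hom X X) (q' : A.Hom Y Y) (f : A.Hom X Y) :
    twistD q q' f = (A.Hom X Y).d f + q' ⊚ f - (A.Hom X Y).sgn f ⊚ q := rfl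

theorem twistD_mem {X Y : A.Obj} {q : A.Hom X X} {q' : A.Hom Y Y} (hq : q ∈ (A.Hom X X).gr 1)
    (hq' : q' ∈ (A.Hom Y Y).gr 1) {n : ℤ} {f : A.Hom X Y} (hf : f ∈ (A.Hom X Y).gr n) :
    twistD q q' f ∈ (A.Hom X Y).gr (n + 1) :=
  sub_mem (add_mem ((A.Hom X Y).d_mem hf) (Ho.comp_mem' hq' hf (add_comm _ _)))
    (Ho.comp_mem' (GrMod.sgn_mem _ hf) hq rfl)

theorem twistD_twistD {X Y : A.Obj} {q : A.Hom X X} {q' : A.Hom Y Y} (hq : q ∈ (A.Hom X X).gr 1)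
    (hq' : q' ∈ (A.Hom Y Y).gr 1) (mc : (A.Hom X X).d q + q ⊚ q = 0)
    (mc' : (A.Hom Y Y).d q' + q' ⊚ q' = 0) (f : A.Hom X Y) :
    twistD q q' (twistD q q' f) = 0 := by
  have h₁ : (A.Hom X X).sgn q = -q := by simp [GrMod.sgn_of_mem _ hq]
  have h₂ : (A.Hom Y Y).sgn q' = -q' := by simp [GrMod.sgn_of_mem _ hq']
  have h₃ : (A.Hom Y Y).d q' ⊚ f = -(q' ⊚ q' ⊚ f) := by
    rw [← A.assoc, eq_neg_of_add_eq_zero_left mc', map_neg, LinearMap.neg_apply]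
  have h₄ : f ⊚ (A.Hom X X).d q = -(f ⊚ q ⊚ q) := by
    rw [eq_neg_of_add_eq_zero_left mc, map_neg]
  simp only [twistD_apply, map_add, map_sub, leibniz_sgn, sgn_comp, Cpx.d_sgn, Cpx.d_d, GrMod.sgn_sgn, h₁, h₂, h₃, h₄,
    LinearMap.neg_apply, map_neg, A.assoc]
  abel

theorem twistD_comp {X Y Z : A.Obj} (q : A.Hom X X) (q' : A.Hom Y Y) (q'' : A.Hom Z Z) {m : ℤ}
    {g : A.Hom Y Z} (f : A.Hom X Y) (hg : g ∈ (A.Hom Y Z).gr m) :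
    twistD q q'' (g ⊚ f) = twistD q' q'' g ⊚ f + (m.negOnePow : ℤ) • g ⊚ twistD q q' f := by
  have h : (m.negOnePow : ℤ) • g = (A.Hom Y Z).sgn g := (GrMod.sgn_of_mem _ hg).symm
  have h' : ∀ t : A.Hom X Y, (m.negOnePow : ℤ) • g ⊚ t = (A.Hom Y Z).sgn g ⊚ t := fun t => by
    rw [← h]; exact (map_zsmul (A.comp.flip t) _ g).symm
  rw [h']
  simp only [twistD_apply, leibniz_sgn, sgn_comp, map_add, map_sub, LinearMap.add_apply,
    LinearMap.sub_apply, A.assoc]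
  abel

variable (A) {O : Type u} (X : O → A.Obj) (q : ∀ o, A.Hom (X o) (X o))

/-- Twisting the differentials: the objects are equipped with an endomorphism `q` of degree `1`
with `dq + q² = 0`, and the new differential sends `f` of degree `l` to
`df + q' f - (-1)ˡ f q`. -/
noncomputable def twist (hq : ∀ o, q o ∈ (A.Hom (X o) (X o)).gr 1)
    (mc : ∀ o, (A.Hom (X o) (X o)).d (q o) + q o ⊚ q o = 0) : DGCat k where
  Obj := O
  Hom o o' :=
    { toGrMod := (A.Hom (X o) (X o')).toGrMod
      d := twistD (q o) (q o')
      d_mem := twistD_mem (hq o) (hq o')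
      d_d := twistD_twistD (hq o) (hq o') (mc o) (mc o') }
  one o := A.one (X o)
  comp := A.comp
  one_mem _ := A.one_mem _
  comp_mem := A.comp_mem
  one_comp := A.one_comp
  comp_one := A.comp_one
  assoc := A.assoc
  leibniz {o₁ o₂ o₃ _ _} f hg := twistD_comp (q o₁) (q o₂) (q o₃) f hg

end Twist

/-- The entries of a morphism of direct sums. -/
def entry {A : DGCat k} {X Y : Fam A} (f : A.sums.Hom X Y) (i : Fin Y.n) (j : Fin X.n) :
    A.Hom (X.C j) (Y.C i) := f i j

/-- A one-sided twisted complex `(⨁ C i [r i], q)` over `A`: `q` is an endomorphism of degree `1`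
with `q i j = 0` for `i ≥ j` and `dq + q² = 0`. -/
structure TwCpx extends Fam A where
  /-- the twisting -/
  q : A.sums.Hom toFam toFam
  q_mem : q ∈ (A.sums.Hom toFam toFam).gr 1
  q_tri : ∀ i j, j ≤ i → entry q i j = 0
  mc : (A.sums.Hom toFam toFam).d q + q ⊚ q = 0

/-- The DG category of one-sided twisted complexes over `A`. A morphism of degree `l` is a matrix
`f` of morphisms and its differential is `d f + q' f - (-1)ˡ f q`, where `d f` is the differential
of `f` as a morphism of direct sums. -/
noncomputable def pretr : DGCat k :=
  A.sums.twist (O := TwCpx A) (fun K => K.toFam) (fun K => K.q) (fun K => K.q_mem) (fun K => K.mc)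

/-! Zero object, shifts and cones of twisted complexes. -/

section PretrStructure

variable {A}

theorem zero_comp {X Y Z : A.Obj} (f : A.Hom X Y) : (0 : A.Hom Y Z) ⊚ f = 0 := by simp

theorem comp_zero {X Y Z : A.Obj} (g : A.Hom Y Z) : g ⊚ (0 : A.Hom X Y) = 0 := by simp

theorem sum_corner {ι κ : Type} [Fintype κ] [DecidableEq ι] [DecidableEq κ] (K : ι ⊕ κ → A.Obj)
    (f : ∀ i j, A.Hom (K (Sum.inr j)) (K (Sum.inr i))) (s s' : ι ⊕ κ)
    (h : ∀ i j, s = Sum.inr i → s' = Sum.inr j → f i j = 0) :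
    ∑ i, delta K s (Sum.inr i) ⊚ ∑ j, f i j ⊚ delta K (Sum.inr j) s' = 0 := by
  simp only [map_sum]
  refine Finset.sum_eq_zero fun i _ => Finset.sum_eq_zero fun j _ => ?_
  by_cases hi : s = Sum.inr i
  · by_cases hj : s' = Sum.inr j
    · rw [h i j hi hj, zero_comp, comp_zero]
    · rw [delta_ne K (Ne.symm hj), comp_zero, comp_zero]
  · rw [delta_ne K hi, zero_comp]

theorem sum_corner' {ι κ : Type} [Fintype ι] [DecidableEq ι] [DecidableEq κ] (K : ι ⊕ κ → A.Obj)
    (f : ∀ i j, A.Hom (K (Sum.inl j)) (K (Sum.inl i))) (s s' : ι ⊕ κ)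
    (h : ∀ i j, s = Sum.inl i → s' = Sum.inl j → f i j = 0) :
    ∑ i, delta K s (Sum.inl i) ⊚ ∑ j, f i j ⊚ delta K (Sum.inl j) s' = 0 := by
  simp only [map_sum]
  refine Finset.sum_eq_zero fun i _ => Finset.sum_eq_zero fun j _ => ?_
  by_cases hi : s = Sum.inl i
  · by_cases hj : s' = Sum.inl j
    · rw [h i j hi hj, zero_comp, comp_zero]
    · rw [delta_ne K (Ne.symm hj), comp_zero, comp_zero]
  · rw [delta_ne K hi, zero_comp]

theorem sum_corner'' {ι κ : Type} [Fintype ι] [Fintype κ] [DecidableEq ι] [DecidableEq κ]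
    (K : ι ⊕ κ → A.Obj) (f : ∀ i j, A.Hom (K (Sum.inr j)) (K (Sum.inl i))) (s s' : ι ⊕ κ)
    (h : ∀ i j, s = Sum.inl i → s' ≠ Sum.inr j) :
    ∑ i, delta K s (Sum.inl i) ⊚ ∑ j, f i j ⊚ delta K (Sum.inr j) s' = 0 := by
  simp only [map_sum]
  refine Finset.sum_eq_zero fun i _ => Finset.sum_eq_zero fun j _ => ?_
  by_cases hi : s = Sum.inl i
  · rw [delta_ne K (h i j hi).symm, comp_zero, comp_zero]
  · rw [delta_ne K hi, zero_comp]

theorem sums_d_eq_zero {X Y : Fam A} (f : A.sums.Hom X Y)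
    (h : ∀ i j, (A.Hom (X.C j) (Y.C i)).d (entry f i j) = 0) : (A.sums.Hom X Y).d f = 0 := by
  refine funext fun i => funext fun j => ?_
  change ((Y.r i).negOnePow : ℤ) • (A.Hom (X.C j) (Y.C i)).d (entry f i j) = 0
  rw [h, smul_zero]

theorem sums_mem {X Y : Fam A} {f : A.sums.Hom X Y} {n : ℤ}
    (h : ∀ i j, entry f i j ∈ (A.Hom (X.C j) (Y.C i)).gr (n + Y.r i - X.r j)) :
    f ∈ (A.sums.Hom X Y).gr n := h

namespace Fam

/-- The shift `X[m]` of a formal direct sum. -/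
def shift (m : ℤ) (X : Fam A) : Fam A := ⟨X.n, X.C, fun i => X.r i + m⟩

/-- The identity matrix `X → X[m]`. -/
def up (m : ℤ) (X : Fam A) : A.sums.Hom X (X.shift m) := fun i j => delta X.C i j

/-- The identity matrix `X[m] → X`. -/
def dn (m : ℤ) (X : Fam A) : A.sums.Hom (X.shift m) X := fun i j => delta X.C i j

theorem up_mem (m : ℤ) (X : Fam A) : up m X ∈ (A.sums.Hom X (X.shift m)).gr (-m) :=
  fun i j => delta_mem _ fun h => by subst h; simp only [shift]; ring

theorem dn_mem (m : ℤ) (X : Fam A) : dn m X ∈ (A.sums.Hom (X.shift m) X).gr m :=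
  fun i j => delta_mem _ fun h => by subst h; simp only [shift]; ring

theorem d_up (m : ℤ) (X : Fam A) : (A.sums.Hom X (X.shift m)).d (up m X) = 0 :=
  sums_d_eq_zero _ fun i j => d_delta X.C i j

theorem d_dn (m : ℤ) (X : Fam A) : (A.sums.Hom (X.shift m) X).d (dn m X) = 0 :=
  sums_d_eq_zero _ fun i j => d_delta X.C i j

theorem up_dn (m : ℤ) (X : Fam A) : up m X ⊚ dn m X = A.sums.one (X.shift m) :=
  funext fun i => funext fun j => sum_delta_comp X.C i fun l => delta X.C l j

theorem dn_up (m : ℤ) (X : Fam A) : dn m X ⊚ up m X = A.sums.one X :=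
  funext fun i => funext fun j => sum_delta_comp X.C i fun l => delta X.C l j

theorem up_comp_dn (m : ℤ) (X : Fam A) (f : A.sums.Hom X X) (i j : Fin X.n) :
    entry (X := X.shift m) (Y := X.shift m) (up m X ⊚ f ⊚ dn m X) i j = entry f i j :=
  (sum_delta_comp X.C i _).trans (sum_comp_delta X.C j _)

/-- The objects occurring in `Y ⊕ X[1]`. -/
abbrev coneC (Y X : Fam A) : Fin Y.n ⊕ Fin X.n → A.Obj := Sum.elim Y.C X.C

/-- The direct sum `Y ⊕ X[1]`. -/
def cone (Y X : Fam A) : Fam A where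
  n := Y.n + X.n
  C t := coneC Y X (finSumFinEquiv.symm t)
  r t := Sum.elim Y.r (fun i => X.r i + 1) (finSumFinEquiv.symm t)

variable (Y X : Fam A)

/-- The inclusion `Y → Y ⊕ X[1]`. -/
def inr : A.sums.Hom Y (cone Y X) := fun t j =>
  delta (coneC Y X) (finSumFinEquiv.symm t) (Sum.inl j)

/-- The projection `Y ⊕ X[1] → X`. -/
def fst : A.sums.Hom (cone Y X) X := fun i t =>
  delta (coneC Y X) (Sum.inr i) (finSumFinEquiv.symm t)

/-- The inclusion `X → Y ⊕ X[1]`. -/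
def inl : A.sums.Hom X (cone Y X) := fun t j =>
  delta (coneC Y X) (finSumFinEquiv.symm t) (Sum.inr j)

/-- The projection `Y ⊕ X[1] → Y`. -/
def snd : A.sums.Hom (cone Y X) Y := fun i t =>
  delta (coneC Y X) (Sum.inl i) (finSumFinEquiv.symm t)

theorem inr_mem : inr Y X ∈ (A.sums.Hom Y (cone Y X)).gr 0 :=
  sums_mem fun i j => delta_mem (coneC Y X) (i := finSumFinEquiv.symm i) (j := Sum.inl j) fun h => by
    simp [cone, h]

theorem fst_mem : fst Y X ∈ (A.sums.Hom (cone Y X) X).gr 1 :=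
  sums_mem fun i j => delta_mem (coneC Y X) (i := Sum.inr i) (j := finSumFinEquiv.symm j) fun h => by
    simp only [cone, ← h, Sum.elim_inr]; ring

theorem inl_mem : inl Y X ∈ (A.sums.Hom X (cone Y X)).gr (-1) :=
  sums_mem fun i j => delta_mem (coneC Y X) (i := finSumFinEquiv.symm i) (j := Sum.inr j) fun h => by
    simp [cone, h]

theorem snd_mem : snd Y X ∈ (A.sums.Hom (cone Y X) Y).gr 0 :=
  sums_mem fun i j => delta_mem (coneC Y X) (i := Sum.inl i) (j := finSumFinEquiv.symm j) fun h => by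
    simp [cone, ← h]

theorem d_inr : (A.sums.Hom Y (cone Y X)).d (inr Y X) = 0 :=
  sums_d_eq_zero _ fun i j => d_delta (coneC Y X) (finSumFinEquiv.symm i) (Sum.inl j)

theorem d_fst : (A.sums.Hom (cone Y X) X).d (fst Y X) = 0 :=
  sums_d_eq_zero _ fun i j => d_delta (coneC Y X) (Sum.inr i) (finSumFinEquiv.symm j)

theorem d_inl : (A.sums.Hom X (cone Y X)).d (inl Y X) = 0 :=
  sums_d_eq_zero _ fun i j => d_delta (coneC Y X) (finSumFinEquiv.symm i) (Sum.inr j)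

theorem d_snd : (A.sums.Hom (cone Y X) Y).d (snd Y X) = 0 :=
  sums_d_eq_zero _ fun i j => d_delta (coneC Y X) (Sum.inl i) (finSumFinEquiv.symm j)

theorem sum_delta_delta (s s' : Fin Y.n ⊕ Fin X.n) :
    ∑ t : Fin (cone Y X).n, delta (coneC Y X) s (finSumFinEquiv.symm t) ⊚
      delta (coneC Y X) (finSumFinEquiv.symm t) s' = delta (coneC Y X) s s' :=
  (finSumFinEquiv.symm.sum_comp fun l => delta (coneC Y X) s l ⊚ delta (coneC Y X) l s').trans
    (sum_delta_comp (coneC Y X) s fun l => delta (coneC Y X) l s')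

theorem fst_inl : fst Y X ⊚ inl Y X = A.sums.one X :=
  funext fun i => funext fun j => (sum_delta_delta Y X (Sum.inr i) (Sum.inr j)).trans
    (delta_comp_inj (coneC Y X) Sum.inr Sum.inr_injective i j)

theorem snd_inr : snd Y X ⊚ inr Y X = A.sums.one Y :=
  funext fun i => funext fun j => (sum_delta_delta Y X (Sum.inl i) (Sum.inl j)).trans
    (delta_comp_inj (coneC Y X) Sum.inl Sum.inl_injective i j)

theorem fst_inr : fst Y X ⊚ inr Y X = 0 :=
  funext fun i => funext fun j => (sum_delta_delta Y X (Sum.inr i) (Sum.inl j)).trans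
    (delta_ne _ Sum.inr_ne_inl)

theorem snd_inl : snd Y X ⊚ inl Y X = 0 :=
  funext fun i => funext fun j => (sum_delta_delta Y X (Sum.inl i) (Sum.inr j)).trans
    (delta_ne _ Sum.inl_ne_inr)

theorem total : inl Y X ⊚ fst Y X + inr Y X ⊚ snd Y X = A.sums.one (cone Y X) := by
  refine funext fun t => funext fun t' => ?_
  refine Eq.trans ?_ (delta_comp_inj (coneC Y X) finSumFinEquiv.symm
    finSumFinEquiv.symm.injective t t')
  rw [← sum_delta_comp (coneC Y X) (finSumFinEquiv.symm t)
    fun l => delta (coneC Y X) l (finSumFinEquiv.symm t'), Fintype.sum_sum_type, add_comm]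
  rfl

/-- `Y ⊕ X[1]` as the cone of the zero morphism. -/
def sumCone : Cone (0 : A.sums.Hom X Y) where
  pt := cone Y X
  inr := inr Y X
  fst := fst Y X
  inl := inl Y X
  snd := snd Y X
  inr_mem := inr_mem Y X
  fst_mem := fst_mem Y X
  inl_mem := inl_mem Y X
  snd_mem := snd_mem Y X
  fst_inl := fst_inl Y X
  snd_inr := snd_inr Y X
  fst_inr := fst_inr Y X
  snd_inl := snd_inl Y X
  total := total Y X
  d_inr := d_inr Y X
  d_fst := d_fst Y X
  d_inl := (d_inl Y X).trans (comp_zero _).symm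
  d_snd := (d_snd Y X).trans ((congrArg _ (zero_comp _)).trans neg_zero).symm

end Fam

theorem zsmul_comp {X Y Z : A.Obj} (n : ℤ) (g : A.Hom Y Z) (f : A.Hom X Y) :
    (n • g) ⊚ f = n • g ⊚ f :=
  map_zsmul (A.comp.flip f) n g

namespace TwistAux

theorem sgn_q {X : A.Obj} {q : A.Hom X X} (hq : q ∈ (A.Hom X X).gr 1) :
    (A.Hom X X).sgn q = -q := by
  simp [GrMod.sgn_of_mem _ hq]

section shift

variable {X X' : A.Obj} {q : A.Hom X X} {m : ℤ} {up : A.Hom X X'} {dn : A.Hom X' X}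

theorem negOnePow_mul_self (m : ℤ) : (m.negOnePow : ℤ) * (m.negOnePow : ℤ) = 1 := by
  rw [← Units.val_mul, Int.units_mul_self, Units.val_one]

theorem sgn_up (hup : up ∈ (A.Hom X X').gr (-m)) :
    (A.Hom X X').sgn up = (m.negOnePow : ℤ) • up := by
  rw [GrMod.sgn_of_mem _ hup, Int.negOnePow_neg]

theorem shift_mc (mc : (A.Hom X X).d q + q ⊚ q = 0) (hup : up ∈ (A.Hom X X').gr (-m))
    (d_up : (A.Hom X X').d up = 0) (d_dn : (A.Hom X' X).d dn = 0) (dn_up : dn ⊚ up = A.one X) :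
    (A.Hom X' X').d ((m.negOnePow : ℤ) • (up ⊚ q ⊚ dn)) +
      ((m.negOnePow : ℤ) • (up ⊚ q ⊚ dn)) ⊚ ((m.negOnePow : ℤ) • (up ⊚ q ⊚ dn)) = 0 := by
  have h : dn ⊚ up ⊚ q ⊚ dn = q ⊚ dn := by rw [← A.assoc, dn_up, A.one_comp]
  simp only [map_zsmul, LinearMap.smul_apply, leibniz_sgn, d_up, d_dn, sgn_up hup, A.assoc, h,
    smul_smul, negOnePow_mul_self, eq_neg_of_add_eq_zero_left mc, comp_zero, zero_comp, add_zero,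
    zero_add, one_smul, LinearMap.neg_apply, map_neg, smul_neg, neg_add_cancel]

theorem shift_d_up (hup : up ∈ (A.Hom X X').gr (-m)) (d_up : (A.Hom X X').d up = 0)
    (dn_up : dn ⊚ up = A.one X) :
    (A.Hom X X').d up + ((m.negOnePow : ℤ) • (up ⊚ q ⊚ dn)) ⊚ up -
      (A.Hom X X').sgn up ⊚ q = 0 := by
  simp only [d_up, sgn_up hup, zsmul_comp, A.assoc, dn_up, A.comp_one, zero_add, sub_self]

theorem shift_d_dn (hdn : dn ∈ (A.Hom X' X).gr m) (d_dn : (A.Hom X' X).d dn = 0)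
    (dn_up : dn ⊚ up = A.one X) :
    (A.Hom X' X).d dn + q ⊚ dn -
      (A.Hom X' X).sgn dn ⊚ ((m.negOnePow : ℤ) • (up ⊚ q ⊚ dn)) = 0 := by
  have h : dn ⊚ up ⊚ q ⊚ dn = q ⊚ dn := by rw [← A.assoc, dn_up, A.one_comp]
  simp only [d_dn, GrMod.sgn_of_mem _ hdn, h, map_zsmul, LinearMap.smul_apply, smul_smul,
    negOnePow_mul_self, one_smul, zero_add, sub_self]

end shift

section cone

open Ho.Aux

variable {X Y : A.Obj} (C : Cone (0 : A.Hom X Y)) (q : A.Hom X X) (q' : A.Hom Y Y) (f : A.Hom X Y)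

/-- The twisting of the cone of `f`. -/
def coneQ : A.Hom C.pt C.pt := C.inr ⊚ q' ⊚ C.snd + C.inr ⊚ f ⊚ C.fst - C.inl ⊚ q ⊚ C.fst

variable {q q' f}

theorem coneQ_mem (hq : q ∈ (A.Hom X X).gr 1) (hq' : q' ∈ (A.Hom Y Y).gr 1)
    (hf : f ∈ (A.Hom X Y).gr 0) : coneQ C q q' f ∈ (A.Hom C.pt C.pt).gr 1 :=
  sub_mem (add_mem (Ho.comp_mem' C.inr_mem (Ho.comp_mem' hq' C.snd_mem rfl) (by ring))
    (Ho.comp_mem' C.inr_mem (Ho.comp_mem' hf C.fst_mem rfl) (by ring)))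
    (Ho.comp_mem' C.inl_mem (Ho.comp_mem' hq C.fst_mem rfl) (by ring))

theorem cone_mc (hq : q ∈ (A.Hom X X).gr 1) (hq' : q' ∈ (A.Hom Y Y).gr 1)
    (hf : f ∈ (A.Hom X Y).gr 0) (mc : (A.Hom X X).d q + q ⊚ q = 0)
    (mc' : (A.Hom Y Y).d q' + q' ⊚ q' = 0)
    (hd : (A.Hom X Y).d f + q' ⊚ f - (A.Hom X Y).sgn f ⊚ q = 0) :
    (A.Hom C.pt C.pt).d (coneQ C q q' f) + coneQ C q q' f ⊚ coneQ C q q' f = 0 := by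
  have hs : (A.Hom X Y).sgn f = f := by simp [GrMod.sgn_of_mem _ hf]
  rw [hs] at hd
  have hd' : (A.Hom X Y).d f = f ⊚ q - q' ⊚ f := by
    rw [← sub_eq_zero, ← hd]; abel
  simp only [coneQ, map_add, map_sub, LinearMap.add_apply, LinearMap.sub_apply, leibniz_sgn,
    C.d_inr, C.d_snd, C.d_inl, C.d_fst, sgn_inr, sgn_inl, sgn_q hq, sgn_q hq', hs,
    eq_neg_of_add_eq_zero_left mc, eq_neg_of_add_eq_zero_left mc', hd', A.assoc]
  simp only [zero_comp, comp_zero, neg_zero, map_neg, LinearMap.neg_apply, A.assoc, snd_inr_assoc, fst_inl_assoc,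
    fst_inr_assoc, snd_inl_assoc]
  abel

theorem cone_d_inr : (A.Hom Y C.pt).d C.inr + coneQ C q q' f ⊚ C.inr -
    (A.Hom Y C.pt).sgn C.inr ⊚ q' = 0 := by
  simp [coneQ, C.d_inr, sgn_inr, A.assoc, C.snd_inr, C.fst_inr, A.comp_one]

theorem cone_d_fst : (A.Hom C.pt X).d C.fst + q ⊚ C.fst -
    (A.Hom C.pt X).sgn C.fst ⊚ coneQ C q q' f = 0 := by
  simp [coneQ, C.d_fst, sgn_fst, fst_inr_assoc, fst_inl_assoc]

theorem cone_d_inl : (A.Hom X C.pt).d C.inl + coneQ C q q' f ⊚ C.inl -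
    (A.Hom X C.pt).sgn C.inl ⊚ q = C.inr ⊚ f := by
  simp [coneQ, C.d_inl, sgn_inl, A.assoc, C.snd_inl, C.fst_inl, A.comp_one]

theorem cone_d_snd : (A.Hom C.pt Y).d C.snd + q' ⊚ C.snd -
    (A.Hom C.pt Y).sgn C.snd ⊚ coneQ C q q' f = -(f ⊚ C.fst) := by
  simp [coneQ, C.d_snd, sgn_snd, snd_inr_assoc, snd_inl_assoc]

end cone

end TwistAux

namespace TwCpx

/-- The zero object. -/
def zero : TwCpx A where
  n := 0
  C i := i.elim0
  r i := i.elim0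
  q i := i.elim0
  q_mem i := i.elim0
  q_tri i := i.elim0
  mc := funext fun i => i.elim0

/-- The shift `K[m]`, whose twisting is `(-1)ᵐ q`. -/
noncomputable def shift (m : ℤ) (K : TwCpx A) : TwCpx A where
  toFam := K.toFam.shift m
  q := (m.negOnePow : ℤ) • (Fam.up m K.toFam ⊚ K.q ⊚ Fam.dn m K.toFam)
  q_mem := zsmul_mem (Ho.comp_mem' (Fam.up_mem _ _) (Ho.comp_mem' K.q_mem (Fam.dn_mem _ _) rfl)
    (by ring)) _
  q_tri i j hij :=
    smul_eq_zero_of_right (M := ℤ) (A := (A.Hom (K.C j) (K.C i)).carrier) _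
      ((Fam.up_comp_dn m K.toFam K.q i j).trans (K.q_tri i j hij))
  mc := TwistAux.shift_mc K.mc (Fam.up_mem m _) (Fam.d_up m _) (Fam.d_dn m _) (Fam.dn_up m _)

theorem castAdd_le {m n : ℕ} {i j : Fin m} (h : (finSumFinEquiv (Sum.inl j) : Fin (m + n)) ≤
    finSumFinEquiv (Sum.inl i)) : j ≤ i := by
  have h' := Fin.le_def.1 h
  simp only [finSumFinEquiv_apply_left, Fin.val_castAdd] at h'
  exact Fin.le_def.2 h'

theorem natAdd_le {m n : ℕ} {i j : Fin n} (h : (finSumFinEquiv (Sum.inr j) : Fin (m + n)) ≤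
    finSumFinEquiv (Sum.inr i)) : j ≤ i := by
  have h' := Fin.le_def.1 h
  simp only [finSumFinEquiv_apply_right, Fin.val_natAdd] at h'
  exact Fin.le_def.2 (by omega)

theorem not_natAdd_le {m n : ℕ} {i : Fin m} {j : Fin n}
    (h : (finSumFinEquiv (Sum.inr j) : Fin (m + n)) ≤ finSumFinEquiv (Sum.inl i)) : False := by
  simp [Fin.le_def] at h
  omega

section cone

variable {K L : TwCpx A} (f : A.sums.Hom K.toFam L.toFam)

theorem coneQ_tri (t t' : Fin (Fam.cone L.toFam K.toFam).n) (h : t' ≤ t) :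
    entry (X := Fam.cone L.toFam K.toFam) (Y := Fam.cone L.toFam K.toFam)
      (TwistAux.coneQ (Fam.sumCone L.toFam K.toFam) K.q L.q f) t t' = 0 := by
  have h' : ∀ s s' : Fin L.n ⊕ Fin K.n, finSumFinEquiv.symm t = s →
      finSumFinEquiv.symm t' = s' → finSumFinEquiv s' ≤ finSumFinEquiv s := by
    rintro s s' rfl rfl
    have e := fun x : Fin (L.n + K.n) => Equiv.apply_symm_apply finSumFinEquiv x
    exact (e t').trans_le (le_of_le_of_eq h (e t).symm)
  have e₁ := sum_corner' (Fam.coneC L.toFam K.toFam) (fun i j => entry L.q i j)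
    (finSumFinEquiv.symm t) (finSumFinEquiv.symm t') fun i j hi hj => L.q_tri i j (castAdd_le (h' _ _ hi hj))
  have e₂ := sum_corner'' (Fam.coneC L.toFam K.toFam) (fun i j => entry f i j)
    (finSumFinEquiv.symm t) (finSumFinEquiv.symm t') fun i j hi hj => by
      exact not_natAdd_le (h' _ _ hi hj)
  have e₃ := sum_corner (Fam.coneC L.toFam K.toFam) (fun i j => entry K.q i j)
    (finSumFinEquiv.symm t) (finSumFinEquiv.symm t') fun i j hi hj => K.q_tri i j (natAdd_le (h' _ _ hi hj))
  have key : ∀ {M : Type u} [AddCommGroup M] {a b c : M}, a = 0 → b = 0 → c = 0 →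
      a + b - c = 0 := by
    rintro M _ a b c rfl rfl rfl; simp
  exact key e₁ e₂ e₃

/-- The cone of a closed morphism of degree `0`: the direct sum `L ⊕ K[1]` with the twisting
given by those of `L` and `K[1]` and by `f`. -/
noncomputable def coneObj (hf : f ∈ A.pretr.closed K L) : TwCpx A where
  toFam := Fam.cone L.toFam K.toFam
  q := TwistAux.coneQ (Fam.sumCone L.toFam K.toFam) K.q L.q f
  q_mem := TwistAux.coneQ_mem (Fam.sumCone L.toFam K.toFam) K.q_mem L.q_mem hf.1
  q_tri := coneQ_tri f
  mc := TwistAux.cone_mc (Fam.sumCone L.toFam K.toFam) K.q_mem L.q_mem hf.1 K.mc L.mc hf.2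

/-- The cone of a closed morphism of degree `0`. -/
noncomputable def cone (hf : f ∈ A.pretr.closed K L) : Cone (A := A.pretr) f where
  pt := coneObj f hf
  inr := Fam.inr L.toFam K.toFam
  fst := Fam.fst L.toFam K.toFam
  inl := Fam.inl L.toFam K.toFam
  snd := Fam.snd L.toFam K.toFam
  inr_mem := Fam.inr_mem _ _
  fst_mem := Fam.fst_mem _ _
  inl_mem := Fam.inl_mem _ _
  snd_mem := Fam.snd_mem _ _
  fst_inl := Fam.fst_inl _ _
  snd_inr := Fam.snd_inr _ _
  fst_inr := Fam.fst_inr _ _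
  snd_inl := Fam.snd_inl _ _
  total := Fam.total _ _
  d_inr := TwistAux.cone_d_inr (Fam.sumCone L.toFam K.toFam)
  d_fst := TwistAux.cone_d_fst (Fam.sumCone L.toFam K.toFam)
  d_inl := TwistAux.cone_d_inl (Fam.sumCone L.toFam K.toFam)
  d_snd := TwistAux.cone_d_snd (Fam.sumCone L.toFam K.toFam)

end cone

end TwCpx

variable (A)

/-- Zero object, shifts and cones of twisted complexes. -/
noncomputable instance : StrongPretriangulated A.pretr where
  zero := TwCpx.zero
  one_zero := funext fun i => i.elim0
  sh := TwCpx.shift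
  up m K := Fam.up m K.toFam
  dn m K := Fam.dn m K.toFam
  up_mem m K := Fam.up_mem m K.toFam
  dn_mem m K := Fam.dn_mem m K.toFam
  d_up m K := TwistAux.shift_d_up (Fam.up_mem m K.toFam) (Fam.d_up _ _) (Fam.dn_up _ _)
  d_dn m K := TwistAux.shift_d_dn (Fam.dn_mem m K.toFam) (Fam.d_dn _ _) (Fam.dn_up _ _)
  up_dn m K := Fam.up_dn m K.toFam
  dn_up m K := Fam.dn_up m K.toFam
  cone f hf := TwCpx.cone f hf

end PretrStructure

/-! ### DG functors and DG quotients -/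

end DGCat

/-- A DG functor. -/
structure DGFunctor {k : Type u} [CommRing k] (A C : DGCat k) where
  /-- the map on objects -/
  obj : A.Obj → C.Obj
  /-- the maps of complexes of morphisms -/
  map : ∀ {X Y}, A.Hom X Y →ₗ[k] C.Hom (obj X) (obj Y)
  map_mem : ∀ {X Y} {n : ℤ} {f : A.Hom X Y}, f ∈ (A.Hom X Y).gr n →
    map f ∈ (C.Hom (obj X) (obj Y)).gr n
  map_d : ∀ {X Y} (f : A.Hom X Y), map ((A.Hom X Y).d f) = (C.Hom (obj X) (obj Y)).d (map f)
  map_one : ∀ X, map (A.one X) = C.one (obj X)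
  map_comp : ∀ {X Y Z} (g : A.Hom Y Z) (f : A.Hom X Y), map (g ⊚ f) = map g ⊚ map f

namespace DGFunctor

variable {k : Type u} [CommRing k] {A C : DGCat k} (F : DGFunctor A C)

/-- The identity DG functor. -/
def id (A : DGCat k) : DGFunctor A A where
  obj X := X
  map := LinearMap.id
  map_mem h := h
  map_d _ := rfl
  map_one _ := rfl
  map_comp _ _ := rfl

theorem map_sgn {X Y : A.Obj} (f : A.Hom X Y) :
    F.map ((A.Hom X Y).sgn f) = (C.Hom (F.obj X) (F.obj Y)).sgn (F.map f) := by
  induction f using (A.Hom X Y).hom_induction with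
  | mem n y hy => rw [GrMod.sgn_of_mem _ hy, GrMod.sgn_of_mem _ (F.map_mem hy), map_zsmul]
  | zero => simp
  | add y z hy hz => simp only [map_add, hy, hz]

theorem map_closed {X Y : A.Obj} {f : A.Hom X Y} (hf : f ∈ A.closed X Y) :
    F.map f ∈ C.closed (F.obj X) (F.obj Y) :=
  ⟨F.map_mem hf.1, (F.map_d f).symm.trans ((congrArg F.map hf.2).trans (map_zero _))⟩

theorem map_homotopic {X Y : A.Obj} {f g : A.Hom X Y} (h : DGCat.Homotopic f g) :
    DGCat.Homotopic (F.map f) (F.map g) := by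
  obtain ⟨u, hu, hd⟩ := h
  exact ⟨F.map u, F.map_mem hu, by rw [← F.map_d, hd, map_sub]⟩

/-- The functor between homotopy categories induced by a DG functor. -/
def ho : A.Ho ⥤ C.Ho where
  obj X := ⟨F.obj X.obj⟩
  map := Quotient.map (fun f => ⟨F.map f.1, F.map_closed f.2⟩) (fun _ _ h =>
    (Submodule.quotientRel_def _).2 (F.map_homotopic ((Submodule.quotientRel_def _).1 h)))
  map_id X := congrArg Submodule.Quotient.mk (Subtype.ext (F.map_one X.obj))
  map_comp := by
    rintro X Y Z ⟨f⟩ ⟨g⟩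
    exact congrArg Submodule.Quotient.mk (Subtype.ext (F.map_comp g.1 f.1))

theorem map_delta {ι : Type} [DecidableEq ι] (K : ι → A.Obj) (i j : ι) :
    F.map (DGCat.delta K i j) = DGCat.delta (fun i => F.obj (K i)) i j := by
  by_cases h : i = j
  · subst h; rw [DGCat.delta_self, DGCat.delta_self, F.map_one]
  · rw [DGCat.delta_ne K h, DGCat.delta_ne _ h, map_zero]

theorem map_mc {X : A.Obj} {q : A.Hom X X} (h : (A.Hom X X).d q + q ⊚ q = 0) :
    (C.Hom (F.obj X) (F.obj X)).d (F.map q) + F.map q ⊚ F.map q = 0 := by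
  rw [← F.map_d, ← F.map_comp, ← map_add, h, map_zero]

theorem map_twist_d {X Y : A.Obj} (q : A.Hom X X) (q' : A.Hom Y Y) (f : A.Hom X Y) :
    F.map ((A.Hom X Y).d f + q' ⊚ f - (A.Hom X Y).sgn f ⊚ q) =
      (C.Hom (F.obj X) (F.obj Y)).d (F.map f) + F.map q' ⊚ F.map f -
        (C.Hom (F.obj X) (F.obj Y)).sgn (F.map f) ⊚ F.map q := by
  rw [map_sub, map_add, F.map_d, F.map_comp, F.map_comp, F.map_sgn]

/-- The extension of a DG functor to formal finite direct sums of shifts. -/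
def sums : DGFunctor A.sums C.sums where
  obj X := ⟨X.n, fun i => F.obj (X.C i), X.r⟩
  map :=
    { toFun := fun f i j => F.map (DGCat.entry f i j)
      map_add' := fun _ _ => funext fun _ => funext fun _ => map_add F.map _ _
      map_smul' := fun _ _ => funext fun _ => funext fun _ => map_smul F.map _ _ }
  map_mem h i j := F.map_mem (h i j)
  map_d {X Y} f := funext fun i => funext fun j => by
    refine (map_zsmul F.map ((Y.r i).negOnePow : ℤ) _).trans ?_
    exact congrArg (fun t => ((Y.r i).negOnePow : ℤ) • t) (F.map_d (DGCat.entry f i j))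
  map_one X := funext fun i => funext fun j => F.map_delta X.C i j
  map_comp {X Y Z} g f := funext fun i => funext fun j =>
    (map_sum F.map (fun l => DGCat.entry g i l ⊚ DGCat.entry f l j) Finset.univ).trans
      (Finset.sum_congr rfl fun l _ => F.map_comp _ _)

/-- The extension of a DG functor to twisted complexes, on objects. -/
def twObj (K : A.TwCpx) : C.TwCpx where
  toFam := F.sums.obj K.toFam
  q := F.sums.map K.q
  q_mem := F.sums.map_mem K.q_mem
  q_tri i j h := (congrArg F.map (K.q_tri i j h)).trans (map_zero _)
  mc := F.sums.map_mc K.mc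

/-- The extension of a DG functor to twisted complexes. -/
noncomputable def pretr : DGFunctor A.pretr C.pretr where
  obj := F.twObj
  map {K L} := F.sums.map (X := K.toFam) (Y := L.toFam)
  map_mem h := F.sums.map_mem h
  map_d {K L} f := F.sums.map_twist_d K.q L.q f
  map_one K := F.sums.map_one K.toFam
  map_comp g f := F.sums.map_comp g f

/-- The functor `A^tr → C^tr` induced by a DG functor `A → C`, where `A^tr` is the homotopy
category of the DG category of twisted complexes over `A`. -/
noncomputable def tr : A.pretr.Ho ⥤ C.pretr.Ho := F.pretr.ho

/-- A DG functor is a quasi-equivalence if it induces isomorphisms on the cohomology of the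
complexes of morphisms and an essentially surjective functor on homotopy categories. -/
structure IsQuasiEquivalence : Prop where
  injective : ∀ {X Y} (x : A.Hom X Y), (A.Hom X Y).d x = 0 →
    (∃ z, (C.Hom (F.obj X) (F.obj Y)).d z = F.map x) → ∃ z, (A.Hom X Y).d z = x
  surjective : ∀ {X Y} (y : C.Hom (F.obj X) (F.obj Y)), (C.Hom (F.obj X) (F.obj Y)).d y = 0 →
    ∃ x, (A.Hom X Y).d x = 0 ∧ ∃ z, (C.Hom (F.obj X) (F.obj Y)).d z = F.map x - y
  essSurj : F.ho.EssSurj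

end DGFunctor

namespace DGCat

variable {k : Type u} [CommRing k] {A : DGCat k} (B : Set A.Obj)

variable (A) in
/-- The DG functor `A → A/B`. -/
noncomputable def toQuot : DGFunctor A (A.quot B) where
  obj X := X
  map := Quot.incl
  map_mem := Quot.incl_mem
  map_d f := (Quot.qd_incl f).symm
  map_one _ := rfl
  map_comp g f := ((Quot.comp_incl g _).trans (Quot.act_incl g f)).symm

/-- The full subcategory `B^tr` of `A^tr`: the twisted complexes all of whose terms are objects
of `B`. -/
def trSub : ObjectProperty A.pretr.Ho := fun K => ∀ i, (TwCpx.toFam (A := A) K.obj).C i ∈ B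

/-- The Verdier quotient `A^tr/B^tr`: the localization of `A^tr` with respect to the morphisms
whose cone is isomorphic to an object of `B^tr`. -/
abbrev VerdierQuotient : Type u := (trSub B).trW.Localization

/-- A diagram `A ← A' → C` is a DG quotient of `A` modulo `B` if `π : A' → A` is a
quasi-equivalence, the functor between homotopy categories induced by `ξ : A' → C` is essentially
surjective and the functor `A'^tr → C^tr` induces an equivalence `A^tr/B^tr → C^tr`. -/
structure IsDGQuotient {A' C : DGCat k} (π : DGFunctor A' A) (ξ : DGFunctor A' C) : Prop where
  quasiEquivalence : π.IsQuasiEquivalence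
  essSurj : ξ.ho.EssSurj
  equivalence : ∃ Φ : VerdierQuotient B ⥤ C.pretr.Ho,
    Nonempty (π.tr ⋙ (trSub B).trW.Q ⋙ Φ ≅ ξ.tr) ∧ Φ.IsEquivalence

end DGCat

end DG

/-! Let `F` be the functor from twisted complexes over `A` to twisted complexes over `A/B`. Over
`A/B` the identity of each `U` in `B` is the boundary of `ε`. A twisted complex is an iterated cone
of shifted objects, so twisted complexes over `A/B` with terms in `B` are contractible, and `F`
inverts the morphisms whose cone lies in `B^tr`.

Call a composition of inclusions `Y → cone(U[r] → Y)` with `U` in `B` an attachment; attachments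
become invertible in the Verdier quotient. By a calculus of fractions
(`localization_lift_isEquivalence`) it suffices that `F`, on homotopy categories, is essentially
surjective, and full and faithful after attachments to the target. Fullness and faithfulness both
come from one lifting property, `LiftsFrom`: if `z : F X → F Y` has `dz = F a`, then after an
attachment `s : Y → Y'` the morphism `F s ∘ z` equals some `F b` up to a coboundary. For `a = 0`
this gives fullness; for `z` a homotopy between `F g` and `F h` it gives faithfulness. Since the
property passes to cones (`LiftsFrom.cone`), only the sources `X[0]` matter. There the morphisms
over `A/B` are identified (`compare`, `compareInv`) with those of the quotient of the category of
twisted complexes by the objects `U[0]`, where cones are available.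

The heart is `Quot.exists_reduction`. Filter `Hom(X, Y)` in the quotient by the number of letters
`ε`. A graded piece of positive length is, up to shift, `Hom(U, Y) ⊗ D`, with `U` in `B` and `D` the
complex of shorter words `X → U`. If `dz` comes from length `0`, the top components of `z` are
cocycles of such pieces, and they can be removed if they become coboundaries after attachments.
Attachments kill the cohomology of `Hom(U, -)`: a cocycle `U → Y` bounds in its own cone. In the
limit `Hom(U, -)` is therefore acyclic. Under the first condition `D` is flat, so the tensor product
becomes acyclic. Under the second condition the limit is acyclic and flat, so its tensor product
with any `D` is acyclic.

No limit is formed. Any complex embeds in an acyclic `hull` by attaching free cells, and an element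
involves only finitely many of them. If `D` is flat, the cocycle bounds in `hull(Hom(U, Y)) ⊗ D`,
and the finitely many cells used are realized in `Hom(U, Y')` by attaching cones
(`exists_realize_cells`). If the `Hom(U, Y)` are flat, it bounds in `Hom(U, Y) ⊗ hull(D)`, and the
cells are eliminated from the top down, because the coefficient of a top cell is a cocycle and can
be killed (`exists_kill_tensor_of_flat_left`).

Essential surjectivity follows from fullness up to attachments: the image contains all `X[r]`, and
any morphism between objects of the image can be replaced by the image of a morphism with an
isomorphic cone. -/

namespace DG

/-! ### Homogeneous components -/

namespace GrMod

variable {k : Type u} [CommRing k] (M N : GrMod k)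

/-- The homogeneous component of degree `n`. -/
noncomputable def proj (n : ℤ) : M →ₗ[k] M := Finsupp.lapply n ∘ₗ M.coact

variable {M N}

theorem proj_of_mem {n : ℤ} {x : M} (hx : x ∈ M.gr n) : M.proj n x = x := by
  simp [proj, M.coact_of_mem hx]

theorem proj_of_mem_ne {m n : ℤ} {x : M} (hx : x ∈ M.gr m) (h : m ≠ n) : M.proj n x = 0 := by
  simp [proj, M.coact_of_mem hx, h]

theorem proj_mem (n : ℤ) (x : M) : M.proj n x ∈ M.gr n := by
  induction x using M.hom_induction with
  | mem m y hy =>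
    by_cases h : m = n
    · subst h; rwa [proj_of_mem hy]
    · rw [proj_of_mem_ne hy h]; exact zero_mem _
  | zero => rw [map_zero]; exact zero_mem _
  | add y z hy hz => rw [map_add]; exact add_mem hy hz

theorem sum_proj (x : M) : ∃ s : Finset ℤ, ∑ n ∈ s, M.proj n x = x := by
  refine ⟨(M.coact x).support, ?_⟩
  have h : (Finsupp.lsum k fun _ => LinearMap.id) ∘ₗ M.coact = (LinearMap.id : M →ₗ[k] M) := by
    refine LinearMap.ext fun x => ?_
    induction x using M.hom_induction with
    | mem m y hy => simp [M.coact_of_mem hy]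
    | zero => simp
    | add y z hy hz => rw [map_add, hy, hz, map_add]
  exact LinearMap.congr_fun h x

/-- A linear map of degree `r` commutes with taking homogeneous components. -/
theorem proj_map {r : ℤ} (φ : M →ₗ[k] N) (h : ∀ n x, x ∈ M.gr n → φ x ∈ N.gr (n + r))
    (n : ℤ) (x : M) : N.proj (n + r) (φ x) = φ (M.proj n x) := by
  induction x using M.hom_induction with
  | mem m y hy =>
    by_cases e : m = n
    · subst e; rw [proj_of_mem hy, proj_of_mem (h _ _ hy)]
    · rw [proj_of_mem_ne hy e, proj_of_mem_ne (h _ _ hy) (by omega), map_zero]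
  | zero => simp
  | add y z hy hz => simp only [map_add, hy, hz]

theorem sgn_map (φ : M →ₗ[k] N) (h : ∀ n x, x ∈ M.gr n → φ x ∈ N.gr n) (x : M) :
    N.sgn (φ x) = φ (M.sgn x) := by
  induction x using M.hom_induction with
  | mem m y hy => rw [M.sgn_of_mem hy, N.sgn_of_mem (h _ _ hy), map_zsmul]
  | zero => simp
  | add y z hy hz => simp only [map_add, hy, hz]

variable (M) in
/-- The part of even degree. -/
noncomputable def even : M →ₗ[k] M :=
  (Finsupp.lsum k fun n : ℤ => if Even n then LinearMap.id else 0) ∘ₗ M.coact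

theorem even_of_mem {n : ℤ} {x : M} (hx : x ∈ M.gr n) :
    M.even x = if Even n then x else 0 := by
  rw [even, LinearMap.comp_apply, M.coact_of_mem hx, Finsupp.lsum_single]
  split_ifs <;> rfl

variable (M) in
/-- The part of odd degree. -/
noncomputable def odd : M →ₗ[k] M :=
  (Finsupp.lsum k fun n : ℤ => if Even n then 0 else LinearMap.id) ∘ₗ M.coact

theorem odd_of_mem {n : ℤ} {x : M} (hx : x ∈ M.gr n) :
    M.odd x = if Even n then 0 else x := by
  rw [odd, LinearMap.comp_apply, M.coact_of_mem hx, Finsupp.lsum_single]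
  split_ifs <;> rfl

theorem even_add_odd (x : M) : M.even x + M.odd x = x := by
  induction x using M.hom_induction with
  | mem m y hy => rw [even_of_mem hy, odd_of_mem hy]; split_ifs <;> simp
  | zero => simp
  | add y z hy hz => nth_rewrite 3 [← hy, ← hz]; simp only [map_add]; abel

theorem even_mem {n : ℤ} {x : M} (hx : x ∈ M.gr n) : M.even x ∈ M.gr n := by
  rw [even_of_mem hx]; split_ifs; exacts [hx, zero_mem _]

theorem odd_mem {n : ℤ} {x : M} (hx : x ∈ M.gr n) : M.odd x ∈ M.gr n := by
  rw [odd_of_mem hx]; split_ifs; exacts [zero_mem _, hx]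

theorem even_even (x : M) : M.even (M.even x) = M.even x := by
  induction x using M.hom_induction with
  | mem m y hy => rw [even_of_mem (even_mem hy), even_of_mem hy]; split_ifs <;> rfl
  | zero => simp
  | add y z hy hz => simp only [map_add, hy, hz]

theorem odd_odd (x : M) : M.odd (M.odd x) = M.odd x := by
  induction x using M.hom_induction with
  | mem m y hy => rw [odd_of_mem (odd_mem hy), odd_of_mem hy]; split_ifs <;> rfl
  | zero => simp
  | add y z hy hz => simp only [map_add, hy, hz]

theorem even_odd (x : M) : M.even (M.odd x) = 0 := by
  induction x using M.hom_induction with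
  | mem m y hy => rw [even_of_mem (odd_mem hy), odd_of_mem hy]; split_ifs <;> rfl
  | zero => simp
  | add y z hy hz => simp only [map_add, hy, hz, add_zero]

theorem odd_even (x : M) : M.odd (M.even x) = 0 := by
  induction x using M.hom_induction with
  | mem m y hy => rw [odd_of_mem (even_mem hy), even_of_mem hy]; split_ifs <;> rfl
  | zero => simp
  | add y z hy hz => simp only [map_add, hy, hz, add_zero]

theorem even_sgn (x : M) : M.even (M.sgn x) = M.even x := by
  induction x using M.hom_induction with
  | mem m y hy =>
    rw [even_of_mem (M.sgn_mem hy), even_of_mem hy, M.sgn_of_mem hy]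
    split_ifs with h
    · simp [Int.negOnePow_even _ h]
    · rfl
  | zero => simp
  | add y z hy hz => simp only [map_add, hy, hz]

theorem odd_sgn (x : M) : M.odd (M.sgn x) = -M.odd x := by
  induction x using M.hom_induction with
  | mem m y hy =>
    rw [odd_of_mem (M.sgn_mem hy), odd_of_mem hy, M.sgn_of_mem hy]
    split_ifs with h
    · simp
    · simp [Int.negOnePow_odd _ (Int.not_even_iff_odd.1 h)]
  | zero => simp
  | add y z hy hz => simp only [map_add, hy, hz, neg_add]

theorem sgn_tmul (x : M) (y : N) :
    (M.tensor N).sgn (x ⊗ₜ[k] y : M ⊗[k] N) = (M.sgn x ⊗ₜ[k] N.sgn y : M ⊗[k] N) := by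
  induction x using M.hom_induction with
  | mem m x hx =>
    induction y using N.hom_induction with
    | mem n y hy =>
      rw [GrMod.sgn_of_mem _ (show (x ⊗ₜ[k] y : M ⊗[k] N) ∈ (M.tensor N).gr (m + n) from
        tmul_mem hx hy rfl), M.sgn_of_mem hx, N.sgn_of_mem hy, Int.negOnePow_add]
      refine Eq.trans (b := (((m.negOnePow * n.negOnePow : ℤˣ) : ℤ) • x ⊗ₜ[k] y : M ⊗[k] N)) rfl ?_
      rw [TensorProduct.tmul_smul, ← TensorProduct.smul_tmul', smul_smul, Units.val_mul, mul_comm]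
    | zero => rw [TensorProduct.tmul_zero, map_zero, TensorProduct.tmul_zero]; exact map_zero _
    | add y z hy hz =>
      rw [TensorProduct.tmul_add, map_add, TensorProduct.tmul_add, ← hy, ← hz]
      exact map_add (M.tensor N).sgn _ _
  | zero => rw [TensorProduct.zero_tmul, map_zero, TensorProduct.zero_tmul]; exact map_zero _
  | add y z hy hz =>
    rw [TensorProduct.add_tmul, map_add, TensorProduct.add_tmul, ← hy, ← hz]
    exact map_add (M.tensor N).sgn _ _

end GrMod

/-! ### Acyclic and flat complexes -/

namespace Cpx

variable {k : Type u} [CommRing k] (M N : Cpx k)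

theorem proj_d (n : ℤ) (x : M) : M.proj (n + 1) (M.d x) = M.d (M.proj n x) :=
  GrMod.proj_map M.d (fun _ _ h => M.d_mem h) n x

theorem d_even (x : M) : M.d (M.even x) = M.odd (M.d x) := by
  induction x using M.hom_induction with
  | mem m y hy =>
    rw [GrMod.even_of_mem hy, GrMod.odd_of_mem (M.d_mem hy)]
    by_cases h : Even m <;> simp [h]
  | zero => simp
  | add y z hy hz => simp only [map_add, hy, hz]

theorem d_odd (x : M) : M.d (M.odd x) = M.even (M.d x) := by
  induction x using M.hom_induction with
  | mem m y hy =>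
    rw [GrMod.odd_of_mem hy, GrMod.even_of_mem (M.d_mem hy)]
    by_cases h : Even m <;> simp [h]
  | zero => simp
  | add y z hy hz => simp only [map_add, hy, hz]

variable {M N}

theorem proj_cocycle {x : M} (hx : M.d x = 0) (n : ℤ) : M.d (M.proj n x) = 0 := by
  rw [← proj_d, hx, map_zero]

/-- The differential has degree `1`, so the homogeneous components of a cocycle are cocycles and can
be bounded one at a time. `IsAcyclic` itself quantifies over all elements, homogeneous or not. -/
theorem isAcyclic_of_homogeneous
    (h : ∀ n x, x ∈ M.gr n → M.d x = 0 → ∃ y, M.d y = x) : M.IsAcyclic := by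
  intro x hx
  obtain ⟨s, hs⟩ := GrMod.sum_proj x
  choose y hy using fun n => h n (M.proj n x) (GrMod.proj_mem n x) (proj_cocycle hx n)
  exact ⟨∑ n ∈ s, y n, by rw [map_sum, Finset.sum_congr rfl fun n _ => hy n, hs]⟩

/-- Acyclicity is inherited by retracts. -/
theorem IsAcyclic.of_retract (h : N.IsAcyclic) (φ : M →ₗ[k] N) (ψ : N →ₗ[k] M)
    (hφ : ∀ x, N.d (φ x) = φ (M.d x)) (hψ : ∀ x, M.d (ψ x) = ψ (N.d x))
    (e : ∀ x, ψ (φ x) = x) : M.IsAcyclic := by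
  intro x hx
  obtain ⟨y, hy⟩ := h (φ x) (by rw [hφ, hx, map_zero])
  exact ⟨ψ y, by rw [hψ, hy, e]⟩

theorem tensor_ext {P : Type*} [AddCommGroup P] [Module k P] {φ ψ : M ⊗[k] N →ₗ[k] P}
    (h : ∀ x y, φ (x ⊗ₜ y) = ψ (x ⊗ₜ y)) (z : M ⊗[k] N) : φ z = ψ z :=
  LinearMap.congr_fun (TensorProduct.ext' h) z

/-- The sign in the tensor differential sees only the first factor, so a map applied to the second
factor has to commute with `d` but need not respect degrees. -/
theorem lTensor_tensorD (C : Cpx k) (φ : M →ₗ[k] N) (hφ : ∀ x, N.d (φ x) = φ (M.d x))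
    (z : C ⊗[k] M) : tensorD C N (φ.lTensor C z) = φ.lTensor C (tensorD C M z) := by
  refine tensor_ext (φ := tensorD C N ∘ₗ φ.lTensor C) (ψ := φ.lTensor C ∘ₗ tensorD C M)
    (fun x y => ?_) z
  simp [tensorD_tmul, hφ]

/-- Here the map acts on the factor that carries the sign, hence the additional hypothesis `hs`. -/
theorem rTensor_tensorD (C : Cpx k) (φ : M →ₗ[k] N) (hφ : ∀ x, N.d (φ x) = φ (M.d x))
    (hs : ∀ x, N.sgn (φ x) = φ (M.sgn x)) (z : M ⊗[k] C) :
    tensorD N C (φ.rTensor C z) = φ.rTensor C (tensorD M C z) := by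
  refine tensor_ext (φ := tensorD N C ∘ₗ φ.rTensor C) (ψ := φ.rTensor C ∘ₗ tensorD M C)
    (fun x y => ?_) z
  simp [tensorD_tmul, hφ, hs]

/-- Flatness is inherited by retracts. -/
theorem IsHoFlat.of_retract (h : N.IsHoFlat) (φ : M →ₗ[k] N) (ψ : N →ₗ[k] M)
    (hφ : ∀ x, N.d (φ x) = φ (M.d x)) (hψ : ∀ x, M.d (ψ x) = ψ (N.d x))
    (e : ∀ x, ψ (φ x) = x) : M.IsHoFlat := fun C hC =>
  -- The maps act on the second factor, so they need not preserve degrees. This is what later allows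
  -- shifts to be ignored in questions of flatness.
  (h C hC).of_retract (φ.lTensor C) (ψ.lTensor C) (lTensor_tensorD C φ hφ)
    (lTensor_tensorD C ψ hψ)
    (tensor_ext (M := C) (N := M) (φ := ψ.lTensor C ∘ₗ φ.lTensor C) (ψ := LinearMap.id)
      fun x y => by simp [e])

variable (M) in
/-- The complex with the opposite differential. -/
def neg : Cpx k where
  toGrMod := M.toGrMod
  d := -M.d
  d_mem h := neg_mem (M.d_mem h)
  d_d x := by
    change -(M.d (-(M.d x))) = 0
    rw [map_neg, M.d_d, neg_zero, neg_zero]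

/-- The sign involution anticommutes with `d`, so it is an isomorphism between the complex and the
one with the opposite differential. -/
theorem IsHoFlat.neg (h : M.IsHoFlat) : M.neg.IsHoFlat :=
  h.of_retract (M := M.neg) (N := M) M.sgn M.sgn
    (fun x => M.d_sgn x |>.trans (map_neg M.sgn _).symm)
    (fun x => (congrArg Neg.neg (M.d_sgn x)).trans (neg_neg _)) M.sgn_sgn

/-- The tensor product of flat complexes is flat. -/
theorem IsHoFlat.tensor (hM : M.IsHoFlat) (hN : N.IsHoFlat) : (M.tensor N).IsHoFlat := by
  intro C hC
  let a := TensorProduct.assoc k C M N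
  have ha : ∀ z, tensorD (C.tensor M) N (a.symm z) =
      a.symm (tensorD C (M.tensor N) z) := by
    intro z
    refine LinearMap.congr_fun (f := tensorD (C.tensor M) N ∘ₗ a.symm.toLinearMap)
      (g := a.symm.toLinearMap ∘ₗ tensorD C (M.tensor N)) ?_ z
    refine TensorProduct.ext' fun x w => ?_
    refine LinearMap.congr_fun (f := (tensorD (C.tensor M) N ∘ₗ a.symm.toLinearMap) ∘ₗ
        TensorProduct.mk k C (M ⊗[k] N) x) (g := (a.symm.toLinearMap ∘ₗ
          tensorD C (M.tensor N)) ∘ₗ TensorProduct.mk k C (M ⊗[k] N) x) ?_ w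
    refine TensorProduct.ext' fun y t => ?_
    have h₁ : tensorD (C.tensor M) N (TensorProduct.tmul k (M := (C.tensor M).carrier)
        (x ⊗ₜ[k] y : C ⊗[k] M) t) = TensorProduct.tmul k (M := (C.tensor M).carrier)
          (tensorD C M (x ⊗ₜ[k] y)) t + TensorProduct.tmul k (M := (C.tensor M).carrier)
            (C.sgn x ⊗ₜ[k] M.sgn y : C ⊗[k] M) (N.d t) :=
      (tensorD_tmul (C.tensor M) N _ t).trans (congrArg (fun s : (C.tensor M).carrier =>
        TensorProduct.tmul k (M := (C.tensor M).carrier) (tensorD C M (x ⊗ₜ[k] y)) t +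
          TensorProduct.tmul k (M := (C.tensor M).carrier) s (N.d t))
            (GrMod.sgn_tmul (M := C.toGrMod) (N := M.toGrMod) x y))
    refine h₁.trans ?_
    change _ = a.symm (C.d x ⊗ₜ[k] (y ⊗ₜ[k] t) + C.sgn x ⊗ₜ[k] tensorD M N (y ⊗ₜ[k] t))
    rw [tensorD_tmul, tensorD_tmul, TensorProduct.tmul_add, map_add, map_add, ← add_assoc]
    refine congrArg (fun s : (C.tensor M).carrier ⊗[k] N.carrier => s +
      TensorProduct.tmul k (M := (C.tensor M).carrier) (C.sgn x ⊗ₜ[k] M.sgn y : C ⊗[k] M) (N.d t)) ?_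
    exact TensorProduct.add_tmul (M := (C.tensor M).carrier) _ _ t
  -- Flatness of `M` makes `C ⊗ M` acyclic, and flatness of `N` then makes `(C ⊗ M) ⊗ N` acyclic.
  -- The associator, compatible with the differentials by `ha`, transports this.
  refine (hN _ (hM C hC)).of_retract (M := C.tensor (M.tensor N))
    a.symm.toLinearMap a.toLinearMap ha (fun z => ?_) (fun z => a.apply_symm_apply z)
  obtain ⟨w, rfl⟩ := a.symm.surjective z
  refine Eq.trans (congrArg (tensorD C (M.tensor N)) (a.apply_symm_apply w)) ?_
  refine Eq.trans ?_ (congrArg a (ha w)).symm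
  exact (a.apply_symm_apply _).symm

variable (M N) in
/-- The symmetry of the tensor product: `x ⊗ y ↦ (-1)ᵐⁿ y ⊗ x` for `x` of degree `m` and `y` of
degree `n`. -/
noncomputable def braid : M ⊗[k] N →ₗ[k] N ⊗[k] M :=
  -- The sign `(-1)ᵐⁿ` is `1` for `x` even and `(-1)ⁿ` for `x` odd, which makes it expressible
  -- through linear maps.
  TensorProduct.map LinearMap.id M.even ∘ₗ (TensorProduct.comm k M N).toLinearMap +
    TensorProduct.map N.sgn M.odd ∘ₗ (TensorProduct.comm k M N).toLinearMap

theorem braid_tmul (x : M) (y : N) :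
    braid M N (x ⊗ₜ y) = y ⊗ₜ M.even x + N.sgn y ⊗ₜ M.odd x := rfl

theorem braid_braid (z : M ⊗[k] N) : braid N M (braid M N z) = z := by
  refine tensor_ext (φ := braid N M ∘ₗ braid M N) (ψ := LinearMap.id) (fun x y => ?_) z
  have h₁ : M.sgn (M.even x) = M.even x := by
    rw [← GrMod.even_add_odd (M.sgn (M.even x)), GrMod.even_sgn, GrMod.odd_sgn, GrMod.even_even,
      GrMod.odd_even, neg_zero, add_zero]
  have h₂ : M.sgn (M.odd x) = -M.odd x := by
    rw [← GrMod.even_add_odd (M.sgn (M.odd x)), GrMod.even_sgn, GrMod.odd_sgn, GrMod.odd_odd,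
      GrMod.even_odd, zero_add]
  simp only [LinearMap.comp_apply, braid_tmul, map_add, GrMod.even_sgn, GrMod.odd_sgn, h₁, h₂,
    LinearMap.id_apply]
  nth_rewrite 5 [← GrMod.even_add_odd x]
  nth_rewrite 5 [← GrMod.even_add_odd y]
  simp only [TensorProduct.add_tmul, TensorProduct.tmul_add, TensorProduct.neg_tmul,
    TensorProduct.tmul_neg]
  abel

theorem braid_tensorD (z : M ⊗[k] N) :
    tensorD N M (braid M N z) = braid M N (tensorD M N z) := by
  refine tensor_ext (φ := tensorD N M ∘ₗ braid M N) (ψ := braid M N ∘ₗ tensorD M N)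
    (fun x y => ?_) z
  simp only [LinearMap.comp_apply, braid_tmul, tensorD_tmul, map_add, GrMod.even_sgn,
    GrMod.odd_sgn, d_even, d_odd, d_sgn, GrMod.sgn_sgn, TensorProduct.neg_tmul,
    TensorProduct.tmul_neg]
  abel

/-- For flat `M` and acyclic `C`, `M ⊗ C` is acyclic. -/
theorem IsHoFlat.tensor_right (hM : M.IsHoFlat) {C : Cpx k} (hC : C.IsAcyclic) :
    (M.tensor C).IsAcyclic :=
  (hM C hC).of_retract (M := M.tensor C) (N := C.tensor M) (braid M C) (braid C M) braid_tensorD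
    braid_tensorD braid_braid

end Cpx

end DG

namespace DG

/-! ### Embedding a complex into an acyclic one by attaching free cells -/

/-- Formal cells over a module `M`: `mk p n c a t` is a cell of degree `p - 1` whose boundary is
meant to be `c + ∑ a i • t i`. -/
inductive Cell (k M : Type u) : Type u
  | mk (p : ℤ) (n : ℕ) (c : M) (a : Fin n → k) (t : Fin n → Cell k M) : Cell k M

namespace Cell

variable {k M : Type u}

/-- The degree of a cell. -/
def deg : Cell k M → ℤ
  | mk p _ _ _ _ => p - 1

/-- The rank of a cell: it exceeds the ranks of the cells in its boundary. -/
def rank : Cell k M → ℕ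
  | mk _ _ _ _ t => (Finset.univ.sup fun i => rank (t i)) + 1

end Cell

namespace Cpx

variable {k : Type u} [CommRing k] (C : Cpx k)

/-- The module of the complex obtained from `C` by attaching all cells. -/
abbrev HullMod : Type u := C × (Cell k C →₀ k)

open scoped Classical in
/-- The boundary of a cell: the cycle it is meant to bound, or `0` if this is not a homogeneous
cycle of the right degree. -/
noncomputable def bd : Cell k C → HullMod C
  | .mk p _ c a t =>
    -- The last clause says that `c + ∑ a i • t i` is a cocycle, with its differential written out
    -- because `hullD` is itself defined through `bd`. With the default value `0`, the boundary of
    -- every formal cell is a cocycle.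
    if c ∈ C.gr p ∧ (∀ i, (t i).deg = p) ∧ ((C.d c, 0) : HullMod C) + ∑ i, a i • bd (t i) = 0
    then (c, ∑ i, Finsupp.single (t i) (a i)) else 0

/-- The differential of the hull. -/
noncomputable def hullD : HullMod C →ₗ[k] HullMod C :=
  LinearMap.coprod (LinearMap.inl k C (Cell k C →₀ k) ∘ₗ C.d) (Finsupp.linearCombination k C.bd)

theorem hullD_inl (c : C) : hullD C (c, 0) = (C.d c, 0) := by
  simp [hullD]

theorem hullD_single (t : Cell k C) (a : k) :
    hullD C (0, Finsupp.single t a) = a • C.bd t := by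
  simp [hullD]

theorem inl_add_sum (c : C) {n : ℕ} (a : Fin n → k) (t : Fin n → Cell k C) :
    ((c, ∑ i, Finsupp.single (t i) (a i)) : HullMod C) =
      (c, 0) + ∑ i, (0, Finsupp.single (t i) (a i)) := by
  refine Prod.ext ?_ ?_
  · simp [Prod.fst_sum]
  · simp [Prod.snd_sum]

theorem hullD_pair (c : C) {n : ℕ} (a : Fin n → k) (t : Fin n → Cell k C) :
    hullD C (c, ∑ i, Finsupp.single (t i) (a i)) = (C.d c, 0) + ∑ i, a i • C.bd (t i) := by
  rw [inl_add_sum, map_add, map_sum, hullD_inl]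
  simp only [hullD_single]

theorem hullD_bd (t : Cell k C) : hullD C (C.bd t) = 0 := by
  cases t with
  | mk p n c a t =>
    rw [bd]
    split_ifs with h
    · rw [hullD_pair, h.2.2]
    · rw [map_zero]

theorem hullD_hullD (x : HullMod C) : hullD C (hullD C x) = 0 := by
  obtain ⟨c, v⟩ := x
  have h : ((c, v) : HullMod C) = (c, 0) + LinearMap.inr k C (Cell k C →₀ k) v := by simp
  rw [h, map_add, map_add, hullD_inl, hullD_inl, C.d_d, Prod.mk_zero_zero]
  have h' : hullD C ∘ₗ hullD C ∘ₗ LinearMap.inr k C (Cell k C →₀ k) = 0 := by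
    refine Finsupp.lhom_ext fun t a => ?_
    simp [hullD_single, hullD_bd]
  exact (zero_add _).trans (LinearMap.congr_fun h' v)

/-- The degree `n` part of the hull. -/
noncomputable def hullGr (n : ℤ) : Submodule k (HullMod C) :=
  (C.gr n).prod (Finsupp.supported k k {t | t.deg = n})

theorem single_mem_hullGr (t : Cell k C) (a : k) :
    ((0, Finsupp.single t a) : HullMod C) ∈ hullGr C t.deg :=
  ⟨zero_mem _, Finsupp.single_mem_supported k a rfl⟩

theorem inl_mem_hullGr {n : ℤ} {c : C} (hc : c ∈ C.gr n) : ((c, 0) : HullMod C) ∈ hullGr C n :=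
  ⟨hc, zero_mem _⟩

theorem bd_mem (t : Cell k C) : C.bd t ∈ hullGr C (t.deg + 1) := by
  cases t with
  | mk p n c a t =>
    rw [bd, Cell.deg, sub_add_cancel]
    split_ifs with h
    · exact ⟨h.1, sum_mem fun i _ => Finsupp.single_mem_supported k _ (h.2.1 i)⟩
    · exact zero_mem _

/-- The coaction describing the grading of the hull. -/
noncomputable def hullCoact : HullMod C →ₗ[k] ℤ →₀ HullMod C :=
  LinearMap.coprod (Finsupp.mapRange.linearMap (LinearMap.inl k C (Cell k C →₀ k)) ∘ₗ C.coact)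
    (Finsupp.lsum k fun t => Finsupp.lsingle t.deg ∘ₗ LinearMap.inr k C (Cell k C →₀ k) ∘ₗ
      Finsupp.lsingle t)

/-- The graded module obtained from `C` by attaching all cells. -/
noncomputable def hullGrMod : GrMod k where
  carrier := HullMod C
  gr := hullGr C
  isInternal := GrMod.isInternal_of_coact _ (hullCoact C)
    (by
      rintro n ⟨c, v⟩ ⟨hc, hv⟩
      rw [hullCoact, LinearMap.coprod_apply, LinearMap.comp_apply, C.coact_of_mem hc]
      have h : (Finsupp.lsum k fun t => Finsupp.lsingle t.deg ∘ₗ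
          LinearMap.inr k C (Cell k C →₀ k) ∘ₗ Finsupp.lsingle t) v =
            Finsupp.single n ((0, v) : HullMod C) := by
        have hv' : (v : Cell k C →₀ k) = v.sum Finsupp.single := (Finsupp.sum_single v).symm
        rw [Finsupp.lsum_apply]
        have h₁ : ∀ t ∈ v.support, (Finsupp.lsingle t.deg ∘ₗ
          LinearMap.inr k C (Cell k C →₀ k) ∘ₗ Finsupp.lsingle t) (v t) =
            Finsupp.lsingle (R := k) n (LinearMap.inr k C (Cell k C →₀ k)
              (Finsupp.single t (v t))) := by
          intro t ht
          have : t.deg = n := hv ht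
          simp [this]
        rw [Finsupp.sum, Finset.sum_congr rfl h₁, ← map_sum, ← map_sum]
        conv_rhs => rw [hv', Finsupp.sum]
        rfl
      rw [h]
      simp [← Finsupp.single_add])
    (by
      rintro ⟨c, v⟩
      have h : ((c, v) : HullMod C) = LinearMap.inl k C (Cell k C →₀ k) c +
          LinearMap.inr k C (Cell k C →₀ k) v := by simp
      rw [h]
      refine add_mem ?_ ?_
      · induction c using C.hom_induction with
        | mem n y hy => exact Submodule.mem_iSup_of_mem n (inl_mem_hullGr C hy)
        | zero => rw [map_zero]; exact zero_mem _
        | add y z hy hz =>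
          rw [map_add]; exact add_mem (hy (by simp)) (hz (by simp))
      · induction v using Finsupp.induction_linear with
        | zero => rw [map_zero]; exact zero_mem _
        | add v w hv hw => rw [map_add]; exact add_mem (hv (by simp)) (hw (by simp))
        | single t a => exact Submodule.mem_iSup_of_mem t.deg (single_mem_hullGr C t a))

/-- The acyclic complex obtained from `C` by attaching all cells. -/
noncomputable def hull : Cpx k where
  toGrMod := hullGrMod C
  d := hullD C
  d_mem {n x} hx := by
    obtain ⟨c, v⟩ := x
    have hx : ((c, v) : HullMod C) ∈ hullGr C n := hx
    change hullD C (c, v) ∈ hullGr C (n + 1)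
    have h : ((c, v) : HullMod C) = (c, 0) + LinearMap.inr k C (Cell k C →₀ k) v := by simp
    rw [h, map_add, hullD_inl]
    refine add_mem (inl_mem_hullGr C (C.d_mem hx.1)) ?_
    simp only [hullD, LinearMap.coprod_apply, LinearMap.inr_apply, map_zero, zero_add]
    rw [Finsupp.linearCombination_apply]
    refine sum_mem fun t ht => Submodule.smul_mem _ _ ?_
    have ht' : t.deg = n := hx.2 ht
    exact ht' ▸ C.bd_mem t
  d_d := hullD_hullD C

/-- A homogeneous cocycle of degree `p` is an element of `C` plus a finite combination of cells, and
exactly these data name a cell of degree `p - 1` having it as boundary. Since cells over cells are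
already included in the inductive type, nothing has to be iterated. -/
theorem hull_isAcyclic : C.hull.IsAcyclic := by
  refine isAcyclic_of_homogeneous fun p x hx hd => ?_
  obtain ⟨c, v⟩ := x
  have hx : ((c, v) : HullMod C) ∈ hullGr C p := hx
  have hd : hullD C (c, v) = 0 := hd
  let e := v.support.equivFin.symm
  have hv : v = ∑ i, Finsupp.single (e i : Cell k C) (v (e i)) := by
    conv_lhs => rw [← Finsupp.sum_single v, Finsupp.sum]
    rw [← Finset.sum_coe_sort, ← e.sum_comp]
  refine ⟨((0, Finsupp.single (Cell.mk p _ c (fun i => v (e i)) fun i => (e i : Cell k C)) 1) :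
    HullMod C), ?_⟩
  change hullD C _ = _
  rw [hullD_single, one_smul, bd, if_pos, ← hv]
  refine ⟨hx.1, fun i => hx.2 (e i).2, ?_⟩
  rw [← hullD_pair, ← hv, hd]

/-- The inclusion of `C` into its hull. -/
noncomputable def toHull : C →ₗ[k] C.hull := LinearMap.inl k C (Cell k C →₀ k)

/-- The cells as elements of the hull. -/
noncomputable def cell (t : Cell k C) : C.hull := ((0, Finsupp.single t 1) : HullMod C)

theorem hull_d_toHull (c : C) : C.hull.d (C.toHull c) = C.toHull (C.d c) := hullD_inl C c

/-- The boundary of a cell as an element of the hull. -/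
noncomputable def bdry (t : Cell k C) : C.hull := C.bd t

theorem bdry_mem (t : Cell k C) : C.bdry t ∈ C.hull.gr (t.deg + 1) := C.bd_mem t

theorem hull_d_bdry (t : Cell k C) : C.hull.d (C.bdry t) = 0 := C.hullD_bd t

theorem hull_d_cell (t : Cell k C) : C.hull.d (C.cell t) = C.bdry t :=
  (hullD_single C t 1).trans (one_smul _ _)

theorem toHull_mem {n : ℤ} {c : C} (hc : c ∈ C.gr n) : C.toHull c ∈ C.hull.gr n :=
  inl_mem_hullGr C hc

theorem cell_mem (t : Cell k C) : C.cell t ∈ C.hull.gr t.deg := single_mem_hullGr C t 1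

theorem sgn_toHull (c : C) : C.hull.sgn (C.toHull c) = C.toHull (C.sgn c) :=
  GrMod.sgn_map (M := C.toGrMod) (N := C.hull.toGrMod) C.toHull (fun _ _ h => C.toHull_mem h) c

/-- The coefficient of a cell. -/
noncomputable def coeff (t : Cell k C) : C.hull →ₗ[k] k :=
  Finsupp.lapply t ∘ₗ LinearMap.snd k C (Cell k C →₀ k)

theorem coeff_toHull (t : Cell k C) (c : C) : C.coeff t (C.toHull c) = 0 := rfl

open scoped Classical in
theorem coeff_cell (t t' : Cell k C) : C.coeff t (C.cell t') = if t' = t then 1 else 0 :=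
  Finsupp.single_apply

/-- The projection of the hull to `C`. -/
noncomputable def ofHull : C.hull →ₗ[k] C := LinearMap.fst k C (Cell k C →₀ k)

theorem ofHull_toHull (c : C) : C.ofHull (C.toHull c) = c := rfl

/-- The set `S` may be larger than the support, so that an expansion can be taken over a closed set
of cells. -/
theorem hull_eq_sum (x : C.hull) (S : Finset (Cell k C)) (h : ∀ t, C.coeff t x ≠ 0 → t ∈ S) :
    x = C.toHull (C.ofHull x) + ∑ t ∈ S, C.coeff t x • C.cell t := by
  obtain ⟨c, v⟩ := x
  have h₁ : ∑ t ∈ S, v t • ((0, Finsupp.single t 1) : HullMod C) =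
      LinearMap.inr k C (Cell k C →₀ k) v := by
    have h₂ : v = ∑ t ∈ S, Finsupp.single t (v t) := by
      conv_lhs => rw [← Finsupp.sum_single v]
      exact Finsupp.sum_of_support_subset _ (fun t ht => h t (Finsupp.mem_support_iff.1 ht)) _
        (by simp)
    conv_rhs => rw [h₂, map_sum]
    exact Finset.sum_congr rfl fun t _ => by simp
  have h₃ : ((c, v) : HullMod C) = LinearMap.inl k C (Cell k C →₀ k) c +
          LinearMap.inr k C (Cell k C →₀ k) v := by simp
  exact h₃.trans (congrArg _ h₁.symm)

/-- The cells in the boundary of `mk p n c a t` are among the `t i`. Ranks make it possible to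
descend along boundaries. -/
theorem rank_lt_of_coeff_bd {t t' : Cell k C} (h : C.coeff t' (C.bdry t) ≠ 0) :
    t'.rank < t.rank := by
  cases t with
  | mk p n c a t =>
    unfold bdry at h
    rw [bd] at h
    split_ifs at h with h'
    · have : (∑ i, Finsupp.single (t i) (a i)) t' ≠ 0 := h
      rw [Finsupp.finsetSum_apply] at this
      obtain ⟨i, -, hi⟩ := Finset.exists_ne_zero_of_sum_ne_zero this
      have e : t i = t' := by
        by_contra e
        exact hi (Finsupp.single_eq_of_ne (Ne.symm e))
      rw [Cell.rank, ← e]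
      exact Nat.lt_succ_of_le (Finset.le_sup (f := fun i => (t i).rank) (Finset.mem_univ i))
    · exact absurd (map_zero (C.coeff t')) h

/-- A finite set of cells is closed if it contains the boundaries of its elements. -/
def IsClosedCells (S : Finset (Cell k C)) : Prop :=
  ∀ t ∈ S, ∀ t', C.coeff t' (C.bdry t) ≠ 0 → t' ∈ S

-- Each boundary involves finitely many cells, all of smaller rank, so adding boundaries repeatedly
-- stops after finitely many steps. The induction is on a bound for the ranks.
open scoped Classical in
theorem exists_isClosedCells (S : Finset (Cell k C)) : ∃ S', S ⊆ S' ∧ C.IsClosedCells S' := by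
  have key : ∀ (N : ℕ) (S : Finset (Cell k C)), (∀ t ∈ S, t.rank < N) →
      ∃ S', S ⊆ S' ∧ C.IsClosedCells S' := by
    intro N
    induction N with
    | zero =>
      intro S hS
      refine ⟨S, subset_rfl, fun t ht => absurd (hS t ht) (Nat.not_lt_zero _)⟩
    | succ N ih =>
      intro S hS
      let R : Finset (Cell k C) := S.biUnion fun t => (show HullMod C from C.bdry t).2.support
      obtain ⟨R', hR', hc⟩ := ih R fun t' ht' => by
        obtain ⟨t, ht, h⟩ := Finset.mem_biUnion.1 ht'
        have := C.rank_lt_of_coeff_bd (t := t) (t' := t') (Finsupp.mem_support_iff.1 h)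
        have := hS t ht
        omega
      refine ⟨S ∪ R', Finset.subset_union_left, fun t ht t' h => ?_⟩
      rcases Finset.mem_union.1 ht with ht | ht
      · exact Finset.mem_union_right _ (hR' (Finset.mem_biUnion.2
          ⟨t, ht, Finsupp.mem_support_iff.2 h⟩))
      · exact Finset.mem_union_right _ (hc t ht t' h)
  exact key ((S.sup Cell.rank) + 1) S fun t ht => Nat.lt_succ_of_le (Finset.le_sup ht)

open scoped Classical in
/-- Closed sets of cells may be built by adding one cell at a time. -/
theorem closedCells_induction {P : Finset (Cell k C) → Prop} (empty : P ∅)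
    (insert : ∀ S t, C.IsClosedCells S → t ∉ S → (∀ t', C.coeff t' (C.bdry t) ≠ 0 → t' ∈ S) →
      P S → P (insert t S)) (S : Finset (Cell k C)) (hS : C.IsClosedCells S) : P S := by
  induction hn : S.card generalizing S with
  | zero => rwa [Finset.card_eq_zero.1 hn]
  | succ n ih =>
    -- A cell of maximal rank in `S` occurs in no boundary of a cell of `S`, so removing it leaves a
    -- closed set.
    obtain ⟨t, ht, hmax⟩ := S.exists_max_image Cell.rank (Finset.card_pos.1 (by omega))
    have hne : ∀ t' ∈ S, C.coeff t (C.bdry t') = 0 := by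
      intro t' ht'
      by_contra h
      have := C.rank_lt_of_coeff_bd h
      have := hmax t' ht'
      omega
    have hc : C.IsClosedCells (S.erase t) := by
      intro t' ht' t'' h
      have ht₁ := Finset.mem_of_mem_erase ht'
      refine Finset.mem_erase.2 ⟨fun e => ?_, hS t' ht₁ t'' h⟩
      exact h (e ▸ hne t' ht₁)
    rw [← Finset.insert_erase ht]
    refine insert _ _ hc (Finset.notMem_erase _ _) (fun t' h => Finset.mem_erase.2 ⟨?_,
      hS t ht t' h⟩) (ih _ hc (by rw [Finset.card_erase_of_mem ht]; omega))
    rintro rfl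
    exact h (hne t' ht)

end Cpx

end DG

/-! ### Maps out of the hull, and tensors expanded in cells -/

namespace DG

namespace Cpx

variable {k : Type u} [CommRing k] (C : Cpx k)

section lift

variable {P : Type u} [AddCommGroup P] [Module k P]

/-- A linear map out of the hull of `C` is given by a linear map out of `C` and the images of the
cells. -/
noncomputable def hullLift (α : C →ₗ[k] P) (ψ : Cell k C → P) : C.hull →ₗ[k] P :=
  LinearMap.coprod α (Finsupp.linearCombination k ψ)

theorem hullLift_toHull (α : C →ₗ[k] P) (ψ : Cell k C → P) (c : C) :
    C.hullLift α ψ (C.toHull c) = α c := by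
  refine (LinearMap.coprod_apply α (Finsupp.linearCombination k ψ) _).trans ?_
  exact (congrArg _ (map_zero _)).trans (add_zero _)

theorem hullLift_cell (α : C →ₗ[k] P) (ψ : Cell k C → P) (t : Cell k C) :
    C.hullLift α ψ (C.cell t) = ψ t := by
  refine (LinearMap.coprod_apply α (Finsupp.linearCombination k ψ) _).trans ?_
  refine Eq.trans (congrArg₂ _ (map_zero _) (Finsupp.linearCombination_single k 1 t)) ?_
  rw [zero_add, one_smul]

theorem hullLift_eq (α : C →ₗ[k] P) (ψ : Cell k C → P) (x : C.hull) (S : Finset (Cell k C))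
    (h : ∀ t, C.coeff t x ≠ 0 → t ∈ S) :
    C.hullLift α ψ x = α (C.ofHull x) + ∑ t ∈ S, C.coeff t x • ψ t := by
  conv_lhs => rw [C.hull_eq_sum x S h]
  simp only [map_add, map_sum, map_smul, hullLift_toHull, hullLift_cell]

end lift

theorem ofHull_mem {n : ℤ} {x : C.hull} (hx : x ∈ C.hull.gr n) : C.ofHull x ∈ C.gr n := hx.1

theorem deg_of_coeff {n : ℤ} {x : C.hull} (hx : x ∈ C.hull.gr n) {t : Cell k C}
    (h : C.coeff t x ≠ 0) : t.deg = n := hx.2 (Finsupp.mem_support_iff.2 h)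

open scoped Classical in
theorem exists_finset_coeff (x : C.hull) : ∃ S : Finset (Cell k C), ∀ t, C.coeff t x ≠ 0 → t ∈ S :=
  ⟨(show HullMod C from x).2.support, fun _ h => Finsupp.mem_support_iff.2 h⟩

variable {C} (M : Cpx k)

/-- Elements of `M ⊗ hull C` are sums of an element of `M ⊗ C` and of terms `m ⊗ t`. -/
theorem tensor_hull_repr (y : M ⊗[k] C.hull) : ∃ S₀ : Finset (Cell k C), ∀ S, S₀ ⊆ S →
    ∃ (y' : M ⊗[k] C) (g : Cell k C → M),
      y = C.toHull.lTensor M y' + ∑ t ∈ S, g t ⊗ₜ[k] C.cell t := by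
  classical
  induction y using TensorProduct.induction_on with
  | zero => exact ⟨∅, fun S _ => ⟨0, fun _ => 0, by simp⟩⟩
  | tmul m x =>
    obtain ⟨S₀, h₀⟩ := C.exists_finset_coeff x
    refine ⟨S₀, fun S hS => ⟨m ⊗ₜ C.ofHull x, fun t => C.coeff t x • m, ?_⟩⟩
    conv_lhs => rw [C.hull_eq_sum x S fun t ht => hS (h₀ t ht)]
    simp only [TensorProduct.tmul_add, TensorProduct.tmul_sum, LinearMap.lTensor_tmul,
      TensorProduct.tmul_smul, TensorProduct.smul_tmul']
  | add y₁ y₂ h₁ h₂ =>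
    obtain ⟨S₁, h₁⟩ := h₁
    obtain ⟨S₂, h₂⟩ := h₂
    refine ⟨S₁ ∪ S₂, fun S hS => ?_⟩
    obtain ⟨z₁, g₁, e₁⟩ := h₁ S (Finset.union_subset_left hS)
    obtain ⟨z₂, g₂, e₂⟩ := h₂ S (Finset.union_subset_right hS)
    refine ⟨z₁ + z₂, fun t => g₁ t + g₂ t, ?_⟩
    rw [e₁, e₂, map_add]
    simp only [TensorProduct.add_tmul, Finset.sum_add_distrib]
    abel

/-- Elements of `hull C ⊗ M` are sums of an element of `C ⊗ M` and of terms `t ⊗ m`. -/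
theorem hull_tensor_repr (y : C.hull ⊗[k] M) : ∃ S₀ : Finset (Cell k C), ∀ S, S₀ ⊆ S →
    ∃ (y' : C ⊗[k] M) (g : Cell k C → M),
      y = C.toHull.rTensor M y' + ∑ t ∈ S, C.cell t ⊗ₜ[k] g t := by
  -- No differential is involved, so the swap of the factors without signs is enough.
  obtain ⟨S₀, h⟩ := tensor_hull_repr M (TensorProduct.comm k C.hull M y)
  refine ⟨S₀, fun S hS => ?_⟩
  obtain ⟨y', g, e⟩ := h S hS
  refine ⟨TensorProduct.comm k M C y', g, ?_⟩
  have e' := congrArg (TensorProduct.comm k M C.hull) e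
  rw [map_add, map_sum] at e'
  simp only [TensorProduct.comm_tmul] at e'
  refine Eq.trans ?_ (e'.trans (congrArg (· + _) ?_))
  · exact (LinearEquiv.apply_symm_apply (TensorProduct.comm k C.hull M).symm y).symm
  · exact (tensor_ext (φ := C.toHull.rTensor M ∘ₗ (TensorProduct.comm k M C).toLinearMap)
      (ψ := (TensorProduct.comm k M C.hull).toLinearMap ∘ₗ C.toHull.lTensor M)
      (fun x y => by simp) y').symm

end Cpx

/-! ### Composition with closed morphisms of degree `0` -/

namespace DGCat

variable {k : Type u} [CommRing k] {A : DGCat k}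

theorem d_comp_closed {X Y Z : A.Obj} {s : A.Hom Y Z} (hs : s ∈ A.closed Y Z) (f : A.Hom X Y) :
    (A.Hom X Z).d (s ⊚ f) = s ⊚ (A.Hom X Y).d f := by
  have h : (A.Hom Y Z).d s = 0 := hs.2
  rw [A.leibniz f hs.1, h]
  simp

theorem comp_closed_mem {X Y Z : A.Obj} {s : A.Hom Y Z} (hs : s ∈ A.closed Y Z) {n : ℤ}
    {f : A.Hom X Y} (hf : f ∈ (A.Hom X Y).gr n) : s ⊚ f ∈ (A.Hom X Z).gr n :=
  Ho.comp_mem' hs.1 hf (zero_add n)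

theorem sgn_comp_closed {X Y Z : A.Obj} {s : A.Hom Y Z} (hs : s ∈ A.closed Y Z) (f : A.Hom X Y) :
    (A.Hom X Z).sgn (s ⊚ f) = s ⊚ (A.Hom X Y).sgn f := by
  rw [sgn_comp, Ho.Aux.sgn_closed hs]

theorem tensorD_comp_closed {X Y Z : A.Obj} {s : A.Hom Y Z} (hs : s ∈ A.closed Y Z) (D : Cpx k)
    (z : A.Hom X Y ⊗[k] D) : Cpx.tensorD (A.Hom X Z) D ((A.comp s).rTensor D z) =
      (A.comp s).rTensor D (Cpx.tensorD (A.Hom X Y) D z) :=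
  Cpx.rTensor_tensorD D (A.comp s) (d_comp_closed hs) (sgn_comp_closed hs) z

theorem rTensor_comp_comp {X Y Z W : A.Obj} (t : A.Hom Z W) (s : A.Hom Y Z) (D : Cpx k)
    (z : A.Hom X Y ⊗[k] D) : (A.comp (t ⊚ s)).rTensor D z =
      (A.comp t).rTensor D ((A.comp (X := X) s).rTensor D z) := by
  refine Cpx.tensor_ext (φ := (A.comp (t ⊚ s)).rTensor D)
    (ψ := (A.comp t).rTensor D ∘ₗ (A.comp (X := X) s).rTensor D) (fun x y => ?_) z
  simp [A.assoc]

theorem rTensor_comp_one {X Y : A.Obj} (D : Cpx k) (z : A.Hom X Y ⊗[k] D) :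
    (A.comp (A.one Y)).rTensor D z = z := by
  refine Cpx.tensor_ext (φ := (A.comp (A.one Y)).rTensor D)
    (ψ := LinearMap.id) (fun x y => ?_) z
  simp [A.one_comp]

/-! ### Killing cocycles by cones -/

variable [SP : StrongPretriangulated A] (B : Set A.Obj)

open StrongPretriangulated

/-- Compositions of inclusions `Y → cone f` for closed morphisms `f : U[r] → Y` of degree `0` with
`U` in `B`. -/
inductive Attach : ∀ {Y Y' : A.Obj}, A.Hom Y Y' → Prop
  | one (Y : A.Obj) : Attach (A.one Y)
  | step {Y Y' : A.Obj} (s : A.Hom Y Y') (U : A.Obj) (hU : U ∈ B) (r : ℤ) (f : A.Hom (sh r U) Y')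
      (hf : f ∈ A.closed (sh r U) Y') : Attach s → Attach ((cone f hf).inr ⊚ s)

variable {B}

theorem Attach.closed {Y Y' : A.Obj} {s : A.Hom Y Y'} (h : Attach B s) : s ∈ A.closed Y Y' := by
  induction h with
  | one => exact one_closed _
  | step s U hU r f hf _ ih => exact comp_closed (Ho.Aux.inr_closed _) ih

theorem Attach.comp {Y Y' Y'' : A.Obj} {s : A.Hom Y Y'} {t : A.Hom Y' Y''} (hs : Attach B s)
    (ht : Attach B t) : Attach B (t ⊚ s) := by
  induction ht with
  | one => rwa [A.one_comp]
  | step t U hU r f hf _ ih => rw [A.assoc]; exact .step _ U hU r f hf ih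

/-- A homogeneous cocycle `U → Y` with `U` in `B` becomes a coboundary after attaching a cone. -/
theorem exists_kill_homogeneous {U Y : A.Obj} (hU : U ∈ B) {p : ℤ} {f : A.Hom U Y}
    (hf : f ∈ (A.Hom U Y).gr p) (hd : (A.Hom U Y).d f = 0) :
    ∃ (Y' : A.Obj) (s : A.Hom Y Y'), Attach B s ∧
      ∃ u ∈ (A.Hom U Y').gr (p - 1), (A.Hom U Y').d u = s ⊚ f := by
  -- Shifting `U` by `-p` turns the cocycle of degree `p` into a closed morphism of degree `0`,
  -- whose cone can be formed. In that cone the inclusion of the source, precomposed with `up`,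
  -- bounds the image of `f`.
  have hc : f ⊚ dn (-p) U ∈ A.closed (sh (-p) U) Y :=
    ⟨Ho.comp_mem' hf (dn_mem _ _) (by ring), Ho.d_comp_zero hd (d_dn _ _)⟩
  let C := cone _ hc
  refine ⟨C.pt, C.inr, ?_, C.inl ⊚ up (-p) U, Ho.comp_mem' C.inl_mem (up_mem _ _) (by ring), ?_⟩
  · have := Attach.step (A.one Y) U hU (-p) _ hc (.one Y)
    rwa [A.comp_one] at this
  · rw [leibniz_sgn, C.d_inl, d_up, comp_zero, add_zero, A.assoc, A.assoc, dn_up, A.comp_one]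

/-- A cocycle `U → Y` with `U` in `B` becomes a coboundary after attaching cones. -/
theorem exists_kill {U Y : A.Obj} (hU : U ∈ B) {f : A.Hom U Y} (hd : (A.Hom U Y).d f = 0) :
    ∃ (Y' : A.Obj) (s : A.Hom Y Y'), Attach B s ∧ ∃ u, (A.Hom U Y').d u = s ⊚ f := by
  classical
  -- The components are killed one degree at a time. Later attachments are closed, so composing with
  -- them preserves the bounding elements found before.
  have key : ∀ S : Finset ℤ, ∃ (Y' : A.Obj) (s : A.Hom Y Y'), Attach B s ∧
      ∃ u, (A.Hom U Y').d u = s ⊚ ∑ n ∈ S, (A.Hom U Y).proj n f := by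
    intro S
    induction S using Finset.induction_on with
    | empty => exact ⟨Y, _, .one Y, 0, by simp⟩
    | insert n S hn ih =>
      obtain ⟨Y₁, s, hs, u, hu⟩ := ih
      obtain ⟨Y₂, t, ht, v, -, hv⟩ := exists_kill_homogeneous hU
        (comp_closed_mem hs.closed (GrMod.proj_mem n f))
        (by rw [d_comp_closed hs.closed, Cpx.proj_cocycle hd, comp_zero])
      refine ⟨Y₂, t ⊚ s, hs.comp ht, v + t ⊚ u, ?_⟩
      rw [Finset.sum_insert hn, map_add, map_add, hv, d_comp_closed ht.closed, hu, A.assoc, A.assoc]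
  obtain ⟨S, hS⟩ := GrMod.sum_proj f
  have := key S
  rwa [hS] at this

/-- If all `Hom(U, Y)` are flat, then any cocycle of `Hom(U, Y) ⊗ D` becomes a coboundary after
attaching cones to `Y`. -/
theorem exists_kill_tensor_of_flat_left {U Y : A.Obj} (hU : U ∈ B)
    (hflat : ∀ Y, (A.Hom U Y).IsHoFlat) (D : Cpx k) (z : A.Hom U Y ⊗[k] D)
    (hz : Cpx.tensorD (A.Hom U Y) D z = 0) :
    ∃ (Y' : A.Obj) (s : A.Hom Y Y'), Attach B s ∧
      ∃ ω, Cpx.tensorD (A.Hom U Y') D ω = (A.comp s).rTensor D z := by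
  classical
  -- Since `Hom(U, Y)` is flat and the hull of `D` is acyclic, `z` bounds once `D` is enlarged to
  -- its hull.
  obtain ⟨y, hy⟩ := (hflat Y).tensor_right D.hull_isAcyclic (D.toHull.lTensor _ z) (by
    refine (Cpx.lTensor_tensorD (A.Hom U Y) D.toHull D.hull_d_toHull z).trans ?_
    rw [hz]; exact map_zero _)
  obtain ⟨S₀, h₀⟩ := Cpx.tensor_hull_repr _ y
  obtain ⟨S, hS, hcl⟩ := D.exists_isClosedCells S₀
  obtain ⟨y', g, rfl⟩ := h₀ S hS
  change Cpx.tensorD (A.Hom U Y) D.hull _ = _ at hy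
  clear hz h₀ hS
  -- The cells of the bounding element are eliminated from the top down. Every elimination changes
  -- `Y`, `z`, `y'` and `g`, so all of them are generalized.
  refine D.closedCells_induction (P := fun S => ∀ (Y : A.Obj) (z y' : A.Hom U Y ⊗[k] D)
    (g : Cell k D → A.Hom U Y), Cpx.tensorD (A.Hom U Y) D.hull (D.toHull.lTensor _ y' +
      ∑ t ∈ S, g t ⊗ₜ[k] D.cell t) = D.toHull.lTensor _ z →
    ∃ (Y' : A.Obj) (s : A.Hom Y Y'), Attach B s ∧
      ∃ ω, Cpx.tensorD (A.Hom U Y') D ω = (A.comp s).rTensor D z) ?_ ?_ S hcl Y z y' g hy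
  · intro Y z y' g hy
    refine ⟨Y, _, .one Y, y', ?_⟩
    rw [Finset.sum_empty, add_zero, Cpx.lTensor_tensorD _ _ D.hull_d_toHull] at hy
    -- The projection `ofHull` need not commute with `d`; it serves as a linear left inverse that
    -- cancels the inclusion of `D`.
    have h : ∀ w : A.Hom U Y ⊗[k] D, D.ofHull.lTensor _ (D.toHull.lTensor _ w) = w :=
      Cpx.tensor_ext (φ := D.ofHull.lTensor _ ∘ₗ D.toHull.lTensor _) (ψ := LinearMap.id)
        fun x y => by simp [Cpx.ofHull_toHull]
    rw [rTensor_comp_one, ← h z, ← hy, h]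
  · intro S t hSc htS htb ih Y z y' g hy
    rw [Finset.sum_insert htS] at hy
    have hdt : ∀ t', Cpx.tensorD (A.Hom U Y) D.hull (g t' ⊗ₜ[k] D.cell t') =
        (A.Hom U Y).d (g t') ⊗ₜ[k] D.cell t' + (A.Hom U Y).sgn (g t') ⊗ₜ[k] D.bdry t' := fun t' => by
      rw [Cpx.tensorD_tmul, Cpx.hull_d_cell]
    let cf : A.Hom U Y ⊗[k] D.hull →ₗ[k] A.Hom U Y :=
      (TensorProduct.rid k _).toLinearMap ∘ₗ (D.coeff t).lTensor _
    have cf_tmul : ∀ m x, cf (m ⊗ₜ x) = D.coeff t x • m := fun m x => by simp [cf]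
    have cf_toHull : ∀ w, cf (D.toHull.lTensor _ w) = 0 := fun w =>
      Cpx.tensor_ext (φ := cf ∘ₗ D.toHull.lTensor _) (ψ := 0)
        (fun x y => by simp [cf, Cpx.coeff_toHull]) w
    -- Compare the coefficients of `t` in `hy`. The cell `t` lies in no boundary of a cell of `S` or
    -- of `t` itself, and `z` involves no cells, so only `d (g t)` remains.
    have hgt : (A.Hom U Y).d (g t) = 0 := by
      have h := congrArg cf hy
      have hbt : D.coeff t (D.bdry t) = 0 := by
        by_contra h; exact htS (htb t h)
      rw [map_add, map_add, map_add, map_add, map_sum, map_sum,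
        Cpx.lTensor_tensorD _ _ D.hull_d_toHull, cf_toHull, cf_toHull, hdt, map_add, cf_tmul,
        cf_tmul, Cpx.coeff_cell, if_pos rfl, hbt, Finset.sum_eq_zero] at h
      · simpa using h
      · intro t' ht'
        have hbt' : D.coeff t (D.bdry t') = 0 := by
          by_contra h; exact htS (hSc t' ht' t h)
        rw [hdt, map_add, cf_tmul, cf_tmul, Cpx.coeff_cell, if_neg (fun e : t' = t => htS (e ▸ ht')), hbt']
        simp
    obtain ⟨Y₁, s, hs, u, hu⟩ := exists_kill hU hgt
    -- Subtract `d(u ⊗ t) = (s ∘ g t) ⊗ t + sgn u ⊗ ∂t` from the bounding element. The term at `t`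
    -- disappears, and expanding `∂t` over `D` and `S` gives the corrections to `y'` and to `g`.
    have key := ih Y₁ ((A.comp s).rTensor D z) ((A.comp s).rTensor D y' -
      (A.Hom U Y₁).sgn u ⊗ₜ[k] D.ofHull (D.bdry t))
      (fun t' => s ⊚ g t' - D.coeff t' (D.bdry t) • (A.Hom U Y₁).sgn u) ?_
    · obtain ⟨Y₂, s', hs', ω, hω⟩ := key
      exact ⟨Y₂, s' ⊚ s, hs.comp hs', ω, by rw [hω, rTensor_comp_comp]⟩
    · have hcomm : ∀ w : A.Hom U Y ⊗[k] D, D.toHull.lTensor _ ((A.comp s).rTensor D w) =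
          (A.comp s).rTensor D.hull (D.toHull.lTensor _ w) :=
        Cpx.tensor_ext (φ := D.toHull.lTensor _ ∘ₗ (A.comp s).rTensor D)
          (ψ := (A.comp s).rTensor D.hull ∘ₗ D.toHull.lTensor _) fun x y => by simp
      have e : D.toHull.lTensor _ ((A.comp s).rTensor D y' -
          (A.Hom U Y₁).sgn u ⊗ₜ[k] D.ofHull (D.bdry t)) +
          ∑ t' ∈ S, (s ⊚ g t' - D.coeff t' (D.bdry t) • (A.Hom U Y₁).sgn u) ⊗ₜ[k] D.cell t' =
          (A.comp s).rTensor D.hull (D.toHull.lTensor _ y' +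
            (g t ⊗ₜ[k] D.cell t + ∑ t' ∈ S, g t' ⊗ₜ[k] D.cell t')) -
              Cpx.tensorD (A.Hom U Y₁) D.hull (u ⊗ₜ[k] D.cell t) := by
        rw [Cpx.tensorD_tmul, Cpx.hull_d_cell, hu]
        conv_rhs => rw [D.hull_eq_sum (D.bdry t) S htb]
        rw [map_sub, hcomm]
        simp only [map_add, map_sum, LinearMap.rTensor_tmul, LinearMap.lTensor_tmul,
          TensorProduct.sub_tmul, TensorProduct.tmul_add, TensorProduct.tmul_sum,
          TensorProduct.tmul_smul, TensorProduct.smul_tmul', Finset.sum_sub_distrib]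
        abel
      rw [e, map_sub, tensorD_comp_closed hs.closed, hy, hcomm]
      have h0 := (Cpx.tensor (A.Hom U Y₁) D.hull).d_d (u ⊗ₜ[k] D.cell t : _ ⊗[k] _)
      change Cpx.tensorD _ _ (Cpx.tensorD _ _ _) = 0 at h0
      rw [h0, sub_zero]

open scoped Classical in
/-- A finite closed set of cells of the hull of `Hom(U, Y)` can be realized in `Hom(U, Y')` after
attaching cones to `Y`. -/
theorem exists_realize_cells {U Y : A.Obj} (hU : U ∈ B) (S : Finset (Cell k (A.Hom U Y)))
    (hS : (A.Hom U Y).IsClosedCells S) :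
    ∃ (Y' : A.Obj) (s : A.Hom Y Y'), Attach B s ∧ ∃ ψ : Cell k (A.Hom U Y) → A.Hom U Y',
      ∀ t ∈ S, ψ t ∈ (A.Hom U Y').gr t.deg ∧
        (A.Hom U Y').d (ψ t) = (A.Hom U Y).hullLift (A.comp s) ψ ((A.Hom U Y).bdry t) := by
  refine (A.Hom U Y).closedCells_induction (P := fun S =>
    ∃ (Y' : A.Obj) (s : A.Hom Y Y'), Attach B s ∧ ∃ ψ : Cell k (A.Hom U Y) → A.Hom U Y',
      ∀ t ∈ S, ψ t ∈ (A.Hom U Y').gr t.deg ∧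
        (A.Hom U Y').d (ψ t) = (A.Hom U Y).hullLift (A.comp s) ψ ((A.Hom U Y).bdry t)) ?_ ?_ S hS
  · exact ⟨Y, _, .one Y, fun _ => 0, by simp⟩
  · rintro S t hSc htS htb ⟨Y₁, s, hs, ψ, hψ⟩
    -- The boundary of `t` involves only cells of `S`, which are already realized. Its image must be
    -- shown to be a homogeneous cocycle, so that the next cone can bound it.
    have hmem : (A.Hom U Y).hullLift (A.comp s) ψ ((A.Hom U Y).bdry t) ∈
        (A.Hom U Y₁).gr (t.deg + 1) := by
      have hb := (A.Hom U Y).bdry_mem t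
      rw [Cpx.hullLift_eq _ _ _ _ S htb]
      refine add_mem (comp_closed_mem hs.closed ((A.Hom U Y).ofHull_mem hb)) (sum_mem fun t' ht' => ?_)
      by_cases h : (A.Hom U Y).coeff t' ((A.Hom U Y).bdry t) = 0
      · rw [h, zero_smul]; exact zero_mem _
      · refine Submodule.smul_mem _ _ ?_
        rw [← (A.Hom U Y).deg_of_coeff hb h]
        exact (hψ t' ht').1
    -- The lift commutes with `d` on `Hom(U, Y)` and on the cells of `S`, and the boundary of `t` is
    -- a cocycle of the hull supported there.
    have hd : (A.Hom U Y₁).d ((A.Hom U Y).hullLift (A.comp s) ψ ((A.Hom U Y).bdry t)) = 0 := by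
      have h := (A.Hom U Y).hull_d_bdry t
      rw [(A.Hom U Y).hull_eq_sum ((A.Hom U Y).bdry t) S htb] at h ⊢
      have h' := congrArg ((A.Hom U Y).hullLift (A.comp s) ψ) h
      simp only [map_add, map_sum, map_smul, map_zero, Cpx.hull_d_toHull, Cpx.hull_d_cell,
        Cpx.hullLift_toHull, Cpx.hullLift_cell] at h' ⊢
      rw [d_comp_closed hs.closed, Finset.sum_congr rfl fun t' ht' => by rw [(hψ t' ht').2], h']
    obtain ⟨Y₂, s', hs', u, hu, hdu⟩ := exists_kill_homogeneous hU hmem hd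
    -- The new cell goes to the element bounding the image of its boundary, and the others are
    -- carried along by `s'`.
    let ψ' : Cell k (A.Hom U Y) → A.Hom U Y₂ := fun t' => if t' = t then u else s' ⊚ ψ t'
    have hψ't : ψ' t = u := if_pos rfl
    have hψ' : ∀ t' ∈ S, ψ' t' = s' ⊚ ψ t' := fun t' ht' => if_neg fun (e : t' = t) => htS (e ▸ ht')
    have hlift : ∀ x, (∀ t', (A.Hom U Y).coeff t' x ≠ 0 → t' ∈ S) →
        (A.Hom U Y).hullLift (A.comp (s' ⊚ s)) ψ' x =
          s' ⊚ (A.Hom U Y).hullLift (A.comp s) ψ x := by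
      intro x hx
      rw [Cpx.hullLift_eq _ _ _ _ S hx, Cpx.hullLift_eq _ _ _ _ S hx, map_add, map_sum, A.assoc,
        Finset.sum_congr rfl fun t' ht' => by rw [hψ' t' ht', ← map_smul]]
    refine ⟨Y₂, s' ⊚ s, hs.comp hs', ψ', fun t' ht' => ?_⟩
    rcases Finset.mem_insert.1 ht' with rfl | ht'
    · rw [hψ't, hlift _ htb]
      exact ⟨by simpa using hu, hdu⟩
    · rw [hψ' t' ht', hlift _ (hSc t' ht'), d_comp_closed hs'.closed, (hψ t' ht').2]
      exact ⟨comp_closed_mem hs'.closed (hψ t' ht').1, rfl⟩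

/-- If `D` is flat, then any cocycle of `Hom(U, Y) ⊗ D` becomes a coboundary after attaching cones
to `Y`. -/
theorem exists_kill_tensor_of_flat_right {U Y : A.Obj} (hU : U ∈ B) (D : Cpx k) (hD : D.IsHoFlat)
    (z : A.Hom U Y ⊗[k] D) (hz : Cpx.tensorD (A.Hom U Y) D z = 0) :
    ∃ (Y' : A.Obj) (s : A.Hom Y Y'), Attach B s ∧
      ∃ ω, Cpx.tensorD (A.Hom U Y') D ω = (A.comp s).rTensor D z := by
  classical
  -- Now the other factor is enlarged: `D` is flat, so `z` bounds in the tensor product of the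
  -- acyclic hull of `Hom(U, Y)` with `D`.
  obtain ⟨y, hy⟩ := hD _ (A.Hom U Y).hull_isAcyclic ((A.Hom U Y).toHull.rTensor _ z) (by
    refine (Cpx.rTensor_tensorD D (A.Hom U Y).toHull (A.Hom U Y).hull_d_toHull
      (A.Hom U Y).sgn_toHull z).trans ?_
    rw [hz]; exact map_zero _)
  obtain ⟨S₀, h₀⟩ := Cpx.hull_tensor_repr _ y
  obtain ⟨S, hS, hcl⟩ := (A.Hom U Y).exists_isClosedCells S₀
  obtain ⟨y', g, rfl⟩ := h₀ S hS
  change Cpx.tensorD (A.Hom U Y).hull D _ = _ at hy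
  obtain ⟨Y', s, hs, ψ, hψ⟩ := exists_realize_cells hU S hcl
  -- This map is known to be compatible with differentials only on `Hom(U, Y)` and on the cells of
  -- `S`. These are all that the bounding element involves.
  let φ := (A.Hom U Y).hullLift (A.comp s) ψ
  have hφ : ∀ w : A.Hom U Y ⊗[k] D, φ.rTensor D ((A.Hom U Y).toHull.rTensor D w) =
      (A.comp s).rTensor D w :=
    Cpx.tensor_ext (φ := φ.rTensor D ∘ₗ (A.Hom U Y).toHull.rTensor D)
      (ψ := (A.comp s).rTensor D) fun x y => by simp [φ, Cpx.hullLift_toHull]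
  refine ⟨Y', s, hs, (A.comp s).rTensor D y' + ∑ t ∈ S, ψ t ⊗ₜ[k] g t, ?_⟩
  have h := congrArg (φ.rTensor D) hy
  rw [hφ, map_add, map_add, Cpx.rTensor_tensorD D _ (A.Hom U Y).hull_d_toHull
    (A.Hom U Y).sgn_toHull, hφ, map_sum, map_sum] at h
  rw [← h, map_add, tensorD_comp_closed hs.closed, map_sum]
  -- For `t` in `S` the cell and its realization have the same degree, so the signs in the two
  -- tensor differentials agree.
  refine congrArg _ (Finset.sum_congr rfl fun t ht => ?_)
  rw [Cpx.tensorD_tmul, Cpx.tensorD_tmul, map_add, LinearMap.rTensor_tmul, LinearMap.rTensor_tmul,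
    Cpx.hull_d_cell, GrMod.sgn_of_mem _ (Cpx.cell_mem _ t), GrMod.sgn_of_mem _ (hψ t ht).1,
    (hψ t ht).2, map_zsmul]
  simp only [φ, Cpx.hullLift_cell]

end DGCat

end DG

namespace DG

namespace DGCat

namespace Quot

variable {k : Type u} [CommRing k] {A : DGCat k} {B : Set A.Obj} {X Y Z : A.Obj}

/-! ### The complexes of words -/

/-- The part of the differential of a word which preserves its length. -/
noncomputable def wd : ∀ (l : List B) {Y : A.Obj}, Word A B X l Y →ₗ[k] Word A B X l Y
  | [], Y => (A.Hom X Y).d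
  | U :: l, Y => wlift U l (wcons U l ∘ₗ (A.Hom U.1 Y).d -
      (wcons U l ∘ₗ (A.Hom U.1 Y).sgn).compl₂ (wd l))

theorem wd_wcons (U : B) (l : List B) (f : A.Hom U.1 Y) (w : Word A B X l U.1) :
    wd (U :: l) (wcons U l f w) = wcons U l ((A.Hom U.1 Y).d f) w -
      wcons U l ((A.Hom U.1 Y).sgn f) (wd l w) :=
  wlift_wcons U l _ f w

theorem word_ext {U : B} {l : List B} {P : Type u} [AddCommGroup P] [Module k P]
    {φ ψ : Word A B X (U :: l) Y →ₗ[k] P} (h : ∀ f w, φ (wcons U l f w) = ψ (wcons U l f w))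
    (w : Word A B X (U :: l) Y) : φ w = ψ w :=
  LinearMap.congr_fun (f := (φ : A.Hom U.1 Y ⊗[k] Word A B X l U.1 →ₗ[k] P)) (g := ψ)
    (TensorProduct.ext' h) w

theorem wcons_mem {m n p : ℤ} (U : B) (l : List B) {f : A.Hom U.1 Y} {w : Word A B X l U.1}
    (hf : f ∈ (A.Hom U.1 Y).gr m) (hw : w ∈ (Word A B X l U.1).gr n) (h : m + n = p + 1) :
    wcons U l f w ∈ (Word A B X (U :: l) Y).gr p :=
  GrMod.tmul_mem hf hw h

theorem wd_mem (l : List B) {n : ℤ} {w : Word A B X l Y} (hw : w ∈ (Word A B X l Y).gr n) :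
    wd l w ∈ (Word A B X l Y).gr (n + 1) := by
  induction l generalizing Y n with
  | nil => exact (A.Hom X Y).d_mem hw
  | cons U l ih =>
    refine GrMod.tensorGr_le (M := (A.Hom U.1 Y).toGrMod) (N := Word A B X l U.1) (n := n + 1)
        (S := ((Word A B X (U :: l) Y).gr (n + 1)).comap (wd (U :: l))) ?_ hw
    intro a b f t hf ht hab
    change wd (U :: l) (wcons U l f t) ∈ (Word A B X (U :: l) Y).gr (n + 1)
    rw [wd_wcons]
    exact sub_mem (wcons_mem U l ((A.Hom U.1 Y).d_mem hf) ht (by omega))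
      (wcons_mem U l (GrMod.sgn_mem _ hf) (ih ht) (by omega))

theorem wd_wd (l : List B) (w : Word A B X l Y) : wd l (wd l w) = 0 := by
  induction l generalizing Y with
  | nil => exact (A.Hom X Y).d_d w
  | cons U l ih =>
    refine word_ext (φ := wd (U :: l) ∘ₗ wd (U :: l)) (ψ := 0) (fun f w => ?_) w
    simp only [LinearMap.comp_apply, wd_wcons, map_sub, Cpx.d_d, Cpx.d_sgn, ih, map_zero, map_neg,
      LinearMap.zero_apply, LinearMap.neg_apply]
    simp

variable (B X Y) in
/-- The complex of words. -/
noncomputable def wordCpx (l : List B) : Cpx k where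
  toGrMod := Word A B X l Y
  d := wd l
  d_mem := wd_mem l
  d_d := wd_wd l

/-- Moving `d` past `f` of degree `p` and past `ε` of degree `-1` gives the sign `-(-1)ᵖ`. The
tensor product accounts for `(-1)ᵖ`, and the opposite differential on the second factor for the
remaining minus. -/
theorem wd_eq_tensorD (U : B) (l : List B) (w : Word A B X (U :: l) Y) :
    wd (U :: l) w = Cpx.tensorD (A.Hom U.1 Y) (wordCpx B X U.1 l).neg w := by
  refine word_ext (φ := wd (U :: l)) (ψ := Cpx.tensorD (A.Hom U.1 Y) (wordCpx B X U.1 l).neg)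
    (fun f w => (wd_wcons U l f w).trans ?_) w
  refine (sub_eq_add_neg _ _).trans (congrArg (wcons U l ((A.Hom U.1 Y).d f) w + ·) ?_)
  exact (map_neg (wcons U l ((A.Hom U.1 Y).sgn f)) (wd l w)).symm

/-- All letters of a word ending at `U` in `B` have their target in `B`, so the complex is, apart
from shifts and signs, a tensor product of flat complexes. This is where the first flatness
condition enters. -/
theorem wordCpx_isHoFlat (h : ∀ Z, (Z = X ∨ Z ∈ B) → ∀ U ∈ B, (A.Hom Z U).IsHoFlat) (l : List B)
    (U : B) : (wordCpx B X U.1 l).IsHoFlat := by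
  induction l generalizing U with
  | nil => exact h X (Or.inl rfl) U.1 U.2
  | cons V l ih =>
    exact ((h V.1 (Or.inr V.2) U.1 U.2).tensor (ih V).neg).of_retract
      (M := wordCpx B X U.1 (V :: l))
      (LinearMap.id : Word A B X (V :: l) U.1 →ₗ[k] Word A B X (V :: l) U.1)
      (LinearMap.id : Word A B X (V :: l) U.1 →ₗ[k] Word A B X (V :: l) U.1)
      (fun w => (wd_eq_tensorD V l w).symm) (fun w => wd_eq_tensorD V l w) (fun _ => rfl)

/-- Composition of words with a morphism on the left. -/
noncomputable def wmap (s : A.Hom Y Z) : ∀ l : List B, Word A B X l Y →ₗ[k] Word A B X l Z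
  | [] => A.comp s
  | U :: l => wlift U l (wcons U l ∘ₗ A.comp s)

theorem wmap_wcons (s : A.Hom Y Z) (U : B) (l : List B) (f : A.Hom U.1 Y) (w : Word A B X l U.1) :
    wmap s (U :: l) (wcons U l f w) = wcons U l (s ⊚ f) w :=
  wlift_wcons U l _ f w

theorem act_ofWord_eq (s : A.Hom Y Z) (l : List B) (w : Word A B X l Y) :
    act s (ofWord l w) = ofWord l (wmap s l w) := by
  cases l with
  | nil => exact act_incl s w
  | cons U l =>
    refine word_ext (φ := act s ∘ₗ ofWord (U :: l)) (ψ := ofWord (U :: l) ∘ₗ wmap s (U :: l))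
      (fun f w => ?_) w
    simp only [LinearMap.comp_apply, wmap_wcons, ← push_ofWord, act_push]

theorem wmap_eq_rTensor (s : A.Hom Y Z) (U : B) (l : List B) (w : Word A B X (U :: l) Y) :
    wmap s (U :: l) w = (A.comp s).rTensor (Word A B X l U.1) w :=
  word_ext (φ := wmap s (U :: l)) (ψ := (A.comp s).rTensor (Word A B X l U.1))
    (fun f w => wmap_wcons s U l f w) w

/-! ### The components of a morphism of the quotient -/

/-- The component of a morphism of `A/B` in a given module of words. -/
noncomputable def pr (l : List B) : QHomGr A B X Y →ₗ[k] Word A B X l Y := by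
  classical
  exact DirectSum.component k (List B) (fun l => Word A B X l Y) l

theorem pr_ofWord_self (l : List B) (w : Word A B X l Y) : pr l (ofWord l w) = w := by
  classical
  exact DirectSum.component.lof_self (M := fun l => Word A B X l Y) k l w

theorem pr_ofWord_ne {l l' : List B} (h : l ≠ l') (w : Word A B X l Y) :
    pr l' (ofWord l w) = 0 := by
  classical
  exact (DirectSum.component.of (M := fun l => Word A B X l Y) k l' l w).trans (dif_neg h)

open scoped Classical in
theorem exists_support (z : QHomGr A B X Y) : ∃ S : Finset (List B), ∀ l, pr l z ≠ 0 → l ∈ S := by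
  refine ⟨DFinsupp.support (show DirectSum (List B) fun l => Word A B X l Y from z), fun l h => ?_⟩
  exact DFinsupp.mem_support_iff.2 h

theorem eq_sum_pr (z : QHomGr A B X Y) {S : Finset (List B)} (hS : ∀ l, pr l z ≠ 0 → l ∈ S) :
    z = ∑ l ∈ S, ofWord l (pr l z) := by
  classical
  have h : z = ∑ l ∈ DFinsupp.support (show DirectSum (List B) fun l => Word A B X l Y from z),
      ofWord l (pr l z) :=
    (DirectSum.sum_support_of (show DirectSum (List B) fun l => Word A B X l Y from z)).symm
  refine h.trans (Finset.sum_subset (fun l hl => hS l (DFinsupp.mem_support_iff.1 hl))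
    fun l _ hl => ?_)
  have : pr l z = 0 := by
    by_contra h'
    exact hl (DFinsupp.mem_support_iff.2 h')
  rw [this, map_zero]

theorem eq_incl_of_pr (z : QHomGr A B X Y) (h : ∀ l, l ≠ [] → pr l z = 0) :
    z = incl (pr [] z) := by
  have := eq_sum_pr z (S := {[]}) fun l hl => by
    by_contra h'
    exact hl (h l (by simpa using h'))
  rwa [Finset.sum_singleton] at this

theorem pr_push_eq_zero {m : ℕ} (U : B) (g : A.Hom U.1 Y) {x : QHomGr A B X U.1}
    (hx : ∀ l, m ≤ l.length → pr l x = 0) (l : List B) (hl : m + 1 ≤ l.length) :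
    pr l (push U g x) = 0 := by
  obtain ⟨S, hS⟩ := exists_support x
  rw [eq_sum_pr x hS, map_sum, map_sum]
  refine Finset.sum_eq_zero fun l' _ => ?_
  rw [push_ofWord]
  by_cases h : U :: l' = l
  · subst h
    rw [hx l' (by simpa using hl), map_zero, map_zero, map_zero]
  · exact pr_ofWord_ne h _

/-- Apart from `wd`, the differential of a word consists of terms in which some `ε` has been
deleted, and these are strictly shorter. -/
theorem pr_dWord_sub (l : List B) (w : Word A B X l Y) (l' : List B) (h : l.length ≤ l'.length) :
    pr l' (dWord l w - ofWord l (wd l w)) = 0 := by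
  induction l generalizing Y l' with
  | nil =>
    have : dWord [] w = ofWord ([] : List B) (wd [] w) := rfl
    rw [this, sub_self, map_zero]
  | cons U l ih =>
    refine word_ext (φ := pr l' ∘ₗ (dWord (U :: l) - ofWord (U :: l) ∘ₗ wd (U :: l))) (ψ := 0)
      (fun f w => ?_) w
    have e : dWord (U :: l) (wcons U l f w) - ofWord (U :: l) (wd (U :: l) (wcons U l f w)) =
        ofWord l (wmap ((A.Hom U.1 Y).sgn f) l w) -
          push U ((A.Hom U.1 Y).sgn f) (dWord l w - ofWord l (wd l w)) := by
      rw [dWord_wcons, wd_wcons, map_sub, ← push_ofWord, ← push_ofWord, act_ofWord_eq, map_sub]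
      abel
    have hl : l.length + 1 ≤ l'.length := h
    change pr l' (dWord (U :: l) (wcons U l f w) - ofWord (U :: l) (wd (U :: l) (wcons U l f w))) = 0
    rw [e, map_sub, pr_ofWord_ne (by rintro rfl; omega),
      pr_push_eq_zero U _ (fun l'' h'' => ih w l'' h'') l' hl, sub_zero]

/-- Deleting letters `ε` only produces shorter words, so in lengths at least the maximal length of
`z` the differential is that of the complexes of words. -/
theorem pr_qd {z : QHomGr A B X Y} {n : ℕ} (hz : ∀ l, pr l z ≠ 0 → l.length ≤ n) {l : List B}
    (hl : n ≤ l.length) : pr l (qd z) = wd l (pr l z) := by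
  classical
  obtain ⟨S, hS⟩ := exists_support z
  have h : ∀ l', pr l (qd (ofWord l' (pr l' z))) = pr l (ofWord l' (wd l' (pr l' z))) := by
    intro l'
    by_cases h' : pr l' z = 0
    · rw [h']; simp only [map_zero]
    · rw [qd_ofWord, ← sub_eq_zero, ← map_sub]
      exact pr_dWord_sub l' _ l ((hz l' h').trans hl)
  rw [eq_sum_pr z hS, map_sum, map_sum, map_sum, map_sum]
  refine Finset.sum_congr rfl fun l' _ => ?_
  rw [h l']
  by_cases e : l' = l
  · subst e; rw [pr_ofWord_self, pr_ofWord_self]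
  · rw [pr_ofWord_ne e, pr_ofWord_ne e, map_zero]

theorem pr_act (s : A.Hom Y Z) (z : QHomGr A B X Y) (l : List B) :
    pr l (act s z) = wmap s l (pr l z) := by
  classical
  obtain ⟨S, hS⟩ := exists_support z
  rw [eq_sum_pr z hS, map_sum, map_sum, map_sum, map_sum]
  refine Finset.sum_congr rfl fun l' _ => ?_
  rw [act_ofWord_eq]
  by_cases e : l' = l
  · subst e; rw [pr_ofWord_self, pr_ofWord_self]
  · rw [pr_ofWord_ne e, pr_ofWord_ne e, map_zero]

/-! ### Removing words by attaching cones -/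

theorem qd_act_closed {s : A.Hom Y Z} (hs : s ∈ A.closed Y Z) (z : QHomGr A B X Y) :
    qd (act s z) = act s (qd z) := by
  have h : (A.Hom Y Z).d s = 0 := hs.2
  rw [qd_act, h, Ho.Aux.sgn_closed hs, map_zero, LinearMap.zero_apply, zero_add]

variable [StrongPretriangulated A]

/-- The words of a morphism of `A/B` whose differential comes from `A` can be removed one by one,
provided that the cocycles of the complexes of words can be killed. -/
theorem exists_reduction_aux
    (hkill : ∀ (U : B) (l : List B) (Y : A.Obj) (w : Word A B X (U :: l) Y), wd (U :: l) w = 0 →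
      ∃ (Y' : A.Obj) (s : A.Hom Y Y'), Attach B s ∧ ∃ ω, wd (U :: l) ω = wmap s (U :: l) w)
    (n : ℕ) : ∀ (L : Finset (List B)), (∀ l ∈ L, l.length = n + 1) →
      ∀ (Y : A.Obj) (z : QHomGr A B X Y), (∀ l, pr l z ≠ 0 → l.length ≤ n ∨ l ∈ L) →
      (∀ l, l ≠ [] → pr l (qd z) = 0) →
      ∃ (Y' : A.Obj) (s : A.Hom Y Y'), Attach B s ∧ ∃ w,
        ∀ l, l ≠ [] → pr l (act s z - qd w) = 0 := by
  classical
  -- If the claim holds for words of length at most `n`, then finitely many words of length `n + 1`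
  -- may be allowed as well, by induction on the set `L` of these.
  have step : ∀ n : ℕ, (∀ (Y : A.Obj) (z : QHomGr A B X Y), (∀ l, pr l z ≠ 0 → l.length ≤ n) →
      (∀ l, l ≠ [] → pr l (qd z) = 0) → ∃ (Y' : A.Obj) (s : A.Hom Y Y'), Attach B s ∧ ∃ w,
        ∀ l, l ≠ [] → pr l (act s z - qd w) = 0) →
      ∀ (L : Finset (List B)), (∀ l ∈ L, l.length = n + 1) →
      ∀ (Y : A.Obj) (z : QHomGr A B X Y), (∀ l, pr l z ≠ 0 → l.length ≤ n ∨ l ∈ L) →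
      (∀ l, l ≠ [] → pr l (qd z) = 0) →
      ∃ (Y' : A.Obj) (s : A.Hom Y Y'), Attach B s ∧ ∃ w,
        ∀ l, l ≠ [] → pr l (act s z - qd w) = 0 := by
    intro n base L
    induction L using Finset.induction_on with
    | empty => exact fun _ Y z hz hd => base Y z (fun l hl => by simpa using hz l hl) hd
    | insert l₀ L hl₀ ih =>
    intro hL Y z hz hd
    have hlen := hL l₀ (Finset.mem_insert_self _ _)
    obtain ⟨U, l₁, rfl⟩ : ∃ U l₁, l₀ = U :: l₁ := List.exists_cons_of_ne_nil (by
      rintro rfl; simp at hlen)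
    have hz' : ∀ l, pr l z ≠ 0 → l.length ≤ (U :: l₁).length := fun l hl => by
      rcases hz l hl with h | h
      · omega
      · rw [hL l h, hlen]
    -- The component at a word type of maximal length is a cocycle of the complex of words, because
    -- `qd z` has no components of positive length.
    obtain ⟨Y₁, s, hs, ω, hω⟩ := hkill U l₁ Y (pr (U :: l₁) z) (by
      rw [← pr_qd hz' le_rfl, hd _ (List.cons_ne_nil _ _)])
    have hω' : ∀ l, pr l (ofWord (U :: l₁) ω) ≠ 0 → l.length ≤ (U :: l₁).length := fun l hl => by
      by_cases e : U :: l₁ = l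
      · rw [e]
      · exact absurd (pr_ofWord_ne e ω) hl
    -- Subtracting the coboundary of `ω` removes the component at `U :: l₁` and creates no other
    -- component of length `n + 1`: the remaining terms of its differential are shorter.
    have h₁ : ∀ l, pr l (act s z - qd (ofWord (U :: l₁) ω)) ≠ 0 → l.length ≤ n ∨ l ∈ L := by
      intro l hl
      by_contra hcon
      rw [not_or, not_le] at hcon
      refine hl ?_
      have hll : (U :: l₁).length ≤ l.length := by omega
      rw [map_sub, pr_act, pr_qd hω' hll]
      by_cases e : U :: l₁ = l
      · subst e
        rw [pr_ofWord_self, hω, sub_self]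
      · have : pr l z = 0 := by
          by_contra h
          rcases hz l h with h' | h'
          · omega
          · rcases Finset.mem_insert.1 h' with h' | h'
            · exact e h'.symm
            · exact hcon.2 h'
        rw [this, pr_ofWord_ne e, map_zero, map_zero, sub_zero]
    have h₂ : ∀ l, l ≠ [] → pr l (qd (act s z - qd (ofWord (U :: l₁) ω))) = 0 := by
      intro l hl
      rw [map_sub, qd_qd, sub_zero, qd_act_closed hs.closed, pr_act, hd l hl, map_zero]
    obtain ⟨Y₂, t, ht, w, hw⟩ := ih (fun l hl => hL l (Finset.mem_insert_of_mem hl)) Y₁ _ h₁ h₂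
    refine ⟨Y₂, t ⊚ s, hs.comp ht, w + act t (ofWord (U :: l₁) ω), fun l hl => ?_⟩
    rw [← hw l hl, map_sub (act t), act_act, map_add qd, qd_act_closed ht.closed]
    congr 1
    abel
  induction n with
  | zero =>
    refine step 0 fun Y z hz _ => ⟨Y, _, .one Y, 0, fun l hl => ?_⟩
    rw [map_zero, sub_zero, act_one]
    by_contra h
    exact hl (List.length_eq_zero_iff.1 (Nat.le_zero.1 (hz l h)))
  | succ n ihn =>
    -- The support is finite, so the words of length `n + 1` occurring in `z` form an admissible `L`
    -- for the previous stage.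
    refine step (n + 1) fun Y z hz hd => ?_
    obtain ⟨S, hS⟩ := exists_support z
    refine ihn (S.filter fun l => l.length = n + 1) (fun l hl => (Finset.mem_filter.1 hl).2)
      Y z (fun l hl => ?_) hd
    have := hz l hl
    by_cases e : l.length = n + 1
    · exact Or.inr (Finset.mem_filter.2 ⟨hS l hl, e⟩)
    · exact Or.inl (by omega)

/-- Under the flatness assumptions, a morphism `X → Y` of `A/B` whose differential comes from `A`
becomes, after attaching cones to `Y`, a morphism of `A` up to a coboundary. -/
theorem exists_reduction (hflat : (∀ Z, (Z = X ∨ Z ∈ B) → ∀ U ∈ B, (A.Hom Z U).IsHoFlat) ∨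
      ∀ U ∈ B, ∀ Y, (A.Hom U Y).IsHoFlat) (z : QHomGr A B X Y) (a : A.Hom X Y)
    (hz : qd z = incl a) :
    ∃ (Y' : A.Obj) (s : A.Hom Y Y'), Attach B s ∧ ∃ w b, act s z - qd w = incl b := by
  classical
  -- The first condition makes the complex of shorter words flat, the second the complexes `Hom(U,
  -- Y)`. Either one kills cocycles of the tensor product after attachments.
  have hkill : ∀ (U : B) (l : List B) (Y : A.Obj) (w : Word A B X (U :: l) Y),
      wd (U :: l) w = 0 →
      ∃ (Y' : A.Obj) (s : A.Hom Y Y'), Attach B s ∧ ∃ ω, wd (U :: l) ω = wmap s (U :: l) w := by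
    intro U l Y w hw
    rw [wd_eq_tensorD] at hw
    have : ∃ (Y' : A.Obj) (s : A.Hom Y Y'), Attach B s ∧ ∃ ω, Cpx.tensorD (A.Hom U.1 Y')
        (wordCpx B X U.1 l).neg ω = (A.comp s).rTensor _ w := by
      rcases hflat with h | h
      · exact exists_kill_tensor_of_flat_right U.2 (wordCpx B X U.1 l).neg (wordCpx_isHoFlat h l U).neg w hw
      · exact exists_kill_tensor_of_flat_left U.2 (h U.1 U.2) (wordCpx B X U.1 l).neg w hw
    obtain ⟨Y', s, hs, ω, hω⟩ := this
    exact ⟨Y', s, hs, ω, (wd_eq_tensorD U l ω).trans (hω.trans (wmap_eq_rTensor s U l w).symm)⟩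
  obtain ⟨S, hS⟩ := exists_support z
  -- With `n` bounding all lengths occurring in `z`, no extra words are needed and `L` is empty.
  obtain ⟨Y', s, hs, w, hw⟩ := exists_reduction_aux hkill (S.sup List.length) ∅ (by simp) Y z
    (fun l hl => Or.inl (Finset.le_sup (f := List.length) (hS l hl))) (fun l hl => by
      rw [hz]; exact pr_ofWord_ne hl.symm a)
  exact ⟨Y', s, hs, w, _, eq_incl_of_pr _ hw⟩

end Quot

end DGCat

end DG

namespace DG

/-- The composition of DG functors. -/
def DGFunctor.comp {k : Type u} [CommRing k] {A C D : DGCat k} (F : DGFunctor A C)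
    (G : DGFunctor C D) : DGFunctor A D where
  obj X := G.obj (F.obj X)
  map := G.map ∘ₗ F.map
  map_mem h := G.map_mem (F.map_mem h)
  map_d f := (congrArg G.map (F.map_d f)).trans (G.map_d _)
  map_one X := (congrArg G.map (F.map_one X)).trans (G.map_one _)
  map_comp g f := (congrArg G.map (F.map_comp g f)).trans (G.map_comp _ _)

namespace DGCat

variable {k : Type u} [CommRing k] {A : DGCat k} {B : Set A.Obj}

/-! ### Extending functors to the quotient -/

namespace Quot

variable {C : DGCat k} (F : DGFunctor A C) (ε : ∀ U : B, C.Hom (F.obj U.1) (F.obj U.1))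
  {X Y Z : A.Obj}

/-- The extension of a DG functor `F` to words, sending the adjoined morphisms to `ε`. -/
noncomputable def extendWord : ∀ (l : List B) {Y : A.Obj},
    Word A B X l Y →ₗ[k] C.Hom (F.obj X) (F.obj Y)
  | [], _ => F.map
  | U :: l, _ => wlift U l ((C.comp ∘ₗ C.comp.flip (ε U) ∘ₗ F.map).compl₂ (extendWord l))

/-- The extension of a DG functor `F` to the morphisms of `A/B`, sending the adjoined morphisms to
`ε`. -/
noncomputable def extend : QHomGr A B X Y →ₗ[k] C.Hom (F.obj X) (F.obj Y) :=
  qlift fun l => extendWord F ε l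

theorem extend_ofWord (l : List B) (w : Word A B X l Y) :
    extend F ε (ofWord l w) = extendWord F ε l w :=
  qlift_ofWord (fun l => extendWord F ε l) l w

theorem extend_incl (f : A.Hom X Y) : extend F ε (incl f) = F.map f :=
  extend_ofWord F ε [] f

theorem extend_push (U : B) (f : A.Hom U.1 Y) (t : QHomGr A B X U.1) :
    extend F ε (push U f t) = (F.map f ⊚ ε U) ⊚ extend F ε t := by
  refine LinearMap.congr_fun (push_ext (φ := extend F ε ∘ₗ push U f)
    (ψ := C.comp (F.map f ⊚ ε U) ∘ₗ extend F ε) fun l w => ?_) t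
  simp only [LinearMap.comp_apply, push_ofWord, extend_ofWord]
  exact wlift_wcons U l _ f w

theorem extend_act (h : A.Hom Y Z) (x : QHomGr A B X Y) :
    extend F ε (act h x) = F.map h ⊚ extend F ε x := by
  refine q_induction (P := fun {Y} x => ∀ h : A.Hom Y Z,
    extend F ε (act h x) = F.map h ⊚ extend F ε x) x ?_ ?_ ?_ ?_ h
  · intros; simp
  · intro Y x y hx hy h; simp only [map_add, hx, hy]
  · intro Y f h; rw [act_incl, extend_incl, extend_incl, F.map_comp]
  · intro Y U f t _ h; rw [act_push, extend_push, extend_push, F.map_comp, C.assoc, C.assoc, C.assoc]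

/-- This is the universal property of freely adjoining a contraction: `dε = 1` yields the term with
`ε` deleted, and degree `-1` yields the minus sign of the last term in `qd_push`. -/
theorem extend_qd (hε : ∀ U, ε U ∈ (C.Hom (F.obj U.1) (F.obj U.1)).gr (-1))
    (dε : ∀ U, (C.Hom (F.obj U.1) (F.obj U.1)).d (ε U) = C.one _) (x : QHomGr A B X Y) :
    extend F ε (qd x) = (C.Hom (F.obj X) (F.obj Y)).d (extend F ε x) := by
  refine q_induction (P := fun {Y} x =>
    extend F ε (qd x) = (C.Hom (F.obj X) (F.obj Y)).d (extend F ε x)) x ?_ ?_ ?_ ?_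
  · intros; simp
  · intro Y x y hx hy; simp only [map_add, hx, hy]
  · intro Y f; rw [qd_incl, extend_incl, extend_incl, F.map_d]
  · intro Y U f t ht
    have hs : (C.Hom (F.obj U.1) (F.obj U.1)).sgn (ε U) = -ε U := by
      simp [GrMod.sgn_of_mem _ (hε U)]
    rw [qd_push, map_sub, map_add, extend_push, extend_act, extend_push, extend_push, ht,
      leibniz_sgn, leibniz_sgn, sgn_comp, hs, dε, C.comp_one, F.map_d, F.map_sgn]
    simp only [map_add, LinearMap.add_apply, map_neg, LinearMap.neg_apply]
    abel

end Quot

/-! ### Entries of morphisms of twisted complexes -/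

theorem twistD_zero {X Y : A.Obj} (f : A.Hom X Y) :
    twistD (0 : A.Hom X X) (0 : A.Hom Y Y) f = (A.Hom X Y).d f := by
  rw [twistD_apply, zero_comp, comp_zero, add_zero, sub_zero]

theorem mc_zero (X : A.Obj) :
    (A.Hom X X).d (0 : A.Hom X X) + (0 : A.Hom X X) ⊚ (0 : A.Hom X X) = 0 := by
  rw [map_zero, zero_comp, add_zero]

namespace TwCpx

/-- The entries of a morphism of twisted complexes. -/
def ent {K L : TwCpx A} (f : A.pretr.Hom K L) (i : Fin L.n) (j : Fin K.n) :
    A.Hom (K.C j) (L.C i) := f i j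

/-- The entries of a morphism of twisted complexes, as linear maps. -/
def entₗ (K L : TwCpx A) (i : Fin L.n) (j : Fin K.n) :
    A.pretr.Hom K L →ₗ[k] A.Hom (K.C j) (L.C i) where
  toFun f := ent f i j
  map_add' _ _ := rfl
  map_smul' _ _ := rfl

variable {K L : TwCpx A}

theorem hom_ext {f g : A.pretr.Hom K L} (h : ∀ i j, ent f i j = ent g i j) : f = g :=
  funext fun i => funext fun j => h i j

/-- If both twistings vanish, the differential is computed entrywise. -/
theorem ent_d (hK : K.q = 0) (hL : L.q = 0) (f : A.pretr.Hom K L) (i : Fin L.n) (j : Fin K.n) :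
    ent ((A.pretr.Hom K L).d f) i j = ((L.r i).negOnePow : ℤ) • (A.Hom _ _).d (ent f i j) := by
  have h : (A.pretr.Hom K L).d f = (A.sums.Hom K.toFam L.toFam).d f := by
    refine Eq.trans ?_ (twistD_zero (A := A.sums) f)
    exact congrArg₂ (fun q q' => twistD (A := A.sums) q q' f) hK hL
  rw [h]
  rfl

/-- The twisted complex `X[r]` for an object `X`. -/
def single (X : A.Obj) (r : ℤ) : TwCpx A where
  n := 1
  C _ := X
  r _ := r
  q := 0
  q_mem := zero_mem _
  q_tri _ _ _ := rfl
  mc := mc_zero (A := A.sums) _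

end TwCpx

open TwCpx

variable (A) in
/-- The DG functor from `A` to the twisted complexes over `A`. -/
noncomputable def toPretr : DGFunctor A A.pretr where
  obj X := single X 0
  map {X Y} :=
    { toFun := fun f => (fun _ _ => f : A.pretr.Hom (single X 0) (single Y 0))
      map_add' := fun _ _ => rfl
      map_smul' := fun _ _ => rfl }
  map_mem {X Y n f} hf i j := by
    have e : n + 0 - 0 = n := by ring
    exact e.symm ▸ hf
  map_d {X Y} f := hom_ext fun i j => by
    refine Eq.trans ?_ (ent_d (K := single X 0) (L := single Y 0) rfl rfl _ i j).symm
    exact (one_smul ℤ _).symm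
  map_one X := hom_ext (K := single X 0) (L := single X 0) fun i j => by
    obtain rfl : i = j := Subsingleton.elim (α := Fin 1) i j
    exact (delta_self (A := A) (single X 0).C i).symm
  map_comp g f := funext fun i => funext fun j => (Fin.sum_univ_one (fun _ => g ⊚ f)).symm

/-! ### Comparison of the quotient of the category of twisted complexes with the category of
twisted complexes over the quotient -/

variable (B) in
/-- The objects of `B` as twisted complexes. -/
def singles : Set A.pretr.Obj := {K | ∃ U ∈ B, K = single U 0}

theorem singles_mem (K : singles (A := A) B) (i : Fin (TwCpx.toFam (A := A) K.1).n) :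
    (TwCpx.toFam (A := A) K.1).C i ∈ B := by
  obtain ⟨K, U, hU, rfl⟩ := K
  exact hU

/-- An object of `B` as a twisted complex. -/
def toSingles (U : B) : singles (A := A) B := ⟨single U.1 0, U.1, U.2, rfl⟩

variable (B) in
/-- The functor from twisted complexes over `A` to twisted complexes over `A/B`. -/
noncomputable abbrev toQuotPretr : DGFunctor A.pretr (A.quot B).pretr := (A.toQuot B).pretr

/-- The contraction of a twisted complex in `singles B`. -/
noncomputable def epsSingles (K : singles (A := A) B) :
    (A.quot B).pretr.Hom ((toQuotPretr B).obj K.1) ((toQuotPretr B).obj K.1) := fun i j =>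
  -- The complex is only known to be equal to some `single U 0`, so the 1 × 1 matrix is written as a
  -- diagonal matrix of unspecified size.
  if e : i = j then e ▸ eps ⟨_, singles_mem K i⟩ else 0

theorem ent_epsSingles (U : B) (i j : Fin 1) :
    ent (K := (A.toQuot B).twObj (single U.1 0)) (L := (A.toQuot B).twObj (single U.1 0))
      (epsSingles (toSingles U)) i j = eps U := by
  obtain rfl := Subsingleton.elim i j
  exact dif_pos rfl

theorem map_zero_q (X : A.Obj) (r : ℤ) : ((A.toQuot B).twObj (single X r)).q = 0 :=
  map_zero (A.toQuot B).sums.map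

theorem epsSingles_mem (K : singles (A := A) B) : epsSingles K ∈
    ((A.quot B).pretr.Hom ((toQuotPretr B).obj K.1) ((toQuotPretr B).obj K.1)).gr (-1) := by
  obtain ⟨K, U, hU, rfl⟩ := K
  intro i j
  have e : (-1 : ℤ) + 0 - 0 = -1 := by ring
  have h : eps (⟨U, hU⟩ : B) ∈ ((A.quot B).Hom U U).gr ((-1 : ℤ) + 0 - 0) := by
    rw [e]
    exact eps_mem ⟨U, hU⟩
  exact Set.mem_of_eq_of_mem (ent_epsSingles ⟨U, hU⟩ i j) h

theorem d_epsSingles (K : singles (A := A) B) :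
    ((A.quot B).pretr.Hom ((toQuotPretr B).obj K.1) ((toQuotPretr B).obj K.1)).d (epsSingles K) =
      (A.quot B).pretr.one _ := by
  obtain ⟨K, U, hU, rfl⟩ := K
  refine hom_ext (K := (A.toQuot B).twObj (single U 0)) (L := (A.toQuot B).twObj (single U 0))
    fun i j => (ent_d (map_zero_q U 0) (map_zero_q U 0) _ i j).trans ?_
  refine (one_smul ℤ _).trans ?_
  refine (congrArg _ (ent_epsSingles ⟨U, hU⟩ i j)).trans ((d_eps _).trans ?_)
  obtain rfl : i = j := Subsingleton.elim (α := Fin 1) i j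
  exact (delta_self (A := A.quot B) ((A.toQuot B).twObj (single U 0)).C i).symm

/-- The comparison map from the quotient of the category of twisted complexes to the category of
twisted complexes over the quotient. -/
noncomputable def compare {K L : A.pretr.Obj} : QHomGr A.pretr (singles B) K L →ₗ[k]
    (A.quot B).pretr.Hom ((toQuotPretr B).obj K) ((toQuotPretr B).obj L) :=
  Quot.extend (toQuotPretr B) epsSingles

/-- The inclusion of the quotient of `A` into the quotient of the category of twisted complexes. -/
noncomputable def quotToPretr {X Y : A.Obj} : QHomGr A B X Y →ₗ[k]
    QHomGr A.pretr (singles B) (A.toPretr.obj X) (A.toPretr.obj Y) :=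
  Quot.extend (C := A.pretr.quot (singles B)) (A.toPretr.comp (A.pretr.toQuot (singles B)))
    fun U => eps (toSingles U)

theorem quotToPretr_incl {X Y : A.Obj} (f : A.Hom X Y) :
    quotToPretr (B := B) (Quot.incl f) = Quot.incl (A.toPretr.map f) :=
  Quot.extend_incl (C := A.pretr.quot (singles B))
    (A.toPretr.comp (A.pretr.toQuot (singles B))) _ f

theorem quotToPretr_push {X Y : A.Obj} (U : B) (f : A.Hom U.1 Y) (t : QHomGr A B X U.1) :
    quotToPretr (Quot.push U f t) =
      Quot.push (toSingles U) (A.toPretr.map f) (quotToPretr t) := by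
  refine (Quot.extend_push (C := A.pretr.quot (singles B))
    (A.toPretr.comp (A.pretr.toQuot (singles B))) _ U f t).trans ?_
  refine ((A.pretr.quot (singles B)).assoc _ _ _).trans ?_
  exact (push_eq (toSingles U) (A.toPretr.map f) _).symm

theorem ent_comp_twObj_single {C : DGCat k} (F : DGFunctor A C) {X : A.Obj} {r : ℤ}
    {K L : TwCpx C} (g : C.pretr.Hom (F.twObj (single X r)) L)
    (f : C.pretr.Hom K (F.twObj (single X r))) (i : Fin L.n) (j : Fin K.n) :
    ent (g ⊚ f) i j = ent (K := F.twObj (single X r)) g i (0 : Fin 1) ⊚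
      ent (L := F.twObj (single X r)) f (0 : Fin 1) j :=
  Fin.sum_univ_one (fun l => ent (K := F.twObj (single X r)) g i l ⊚
      ent (L := F.twObj (single X r)) f l j)

/-- The entries of the first column of a morphism starting at a single object. -/
noncomputable def col {X : A.Obj} {L : TwCpx A} (i : Fin L.n) :
    A.pretr.Hom (single X 0) L →ₗ[k] A.Hom X (L.C i) :=
  entₗ (single X 0) L i (0 : Fin 1)

/-- The entries of the first column of a morphism over `A/B` starting at a single object. -/
noncomputable def qcol {X : A.Obj} {L : TwCpx A} (i : Fin L.n) :
    (A.quot B).pretr.Hom ((toQuotPretr B).obj (single X 0)) ((toQuotPretr B).obj L) →ₗ[k]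
      QHomGr A B X (L.C i) :=
  entₗ (A := A.quot B) ((A.toQuot B).twObj (single X 0)) ((A.toQuot B).twObj L) i (0 : Fin 1)

theorem qhom_ext {X : A.Obj} {L : TwCpx A}
    {f g : (A.quot B).pretr.Hom ((toQuotPretr B).obj (single X 0)) ((toQuotPretr B).obj L)}
    (h : ∀ i : Fin L.n, qcol i f = qcol i g) : f = g := by
  refine hom_ext (K := (A.toQuot B).twObj (single X 0)) (L := (A.toQuot B).twObj L) fun i' j => ?_
  obtain rfl : j = (0 : Fin 1) := Subsingleton.elim (α := Fin 1) j _
  exact h i'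

theorem qcol_comp {X Y : A.Obj} {L : TwCpx A}
    (g : (A.quot B).pretr.Hom ((toQuotPretr B).obj (single Y 0)) ((toQuotPretr B).obj L))
    (f : (A.quot B).pretr.Hom ((toQuotPretr B).obj (single X 0)) ((toQuotPretr B).obj (single Y 0)))
    (i : Fin L.n) : qcol i (g ⊚ f) = Quot.comp (qcol i g) (qcol (0 : Fin 1) f) :=
  ent_comp_twObj_single (A.toQuot B) g f i (0 : Fin 1)

theorem qcol_epsSingles (U : B) : qcol (0 : Fin 1) (epsSingles (toSingles U)) = eps U :=
  ent_epsSingles U 0 0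

theorem compare_incl {K L : A.pretr.Obj} (f : A.pretr.Hom K L) :
    compare (B := B) (Quot.incl f) = (toQuotPretr B).map f :=
  Quot.extend_incl (toQuotPretr B) epsSingles f

/-- The index of the term of `L` is seen only by the leftmost letter, since the letters `ε` act on
complexes with a single term. This recursion makes the comparison computable word by word. -/
theorem compare_push {X : A.Obj} {L : TwCpx A} (U : B) (f : A.pretr.Hom (single U.1 0) L)
    (t : QHomGr A.pretr (singles B) (single X 0) (single U.1 0)) (i : Fin L.n) :
    qcol i (compare (Quot.push (toSingles U) f t)) =
      Quot.push U (col i f) (qcol (0 : Fin 1) (compare t)) := by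
  have h : compare (Quot.push (toSingles U) f t) = (toQuotPretr B).map f ⊚
      epsSingles (toSingles U) ⊚ compare t :=
    (Quot.extend_push (toQuotPretr B) epsSingles (toSingles U) f t).trans
      ((A.quot B).pretr.assoc _ _ _)
  have e : qcol (0 : Fin 1) (epsSingles (toSingles U) ⊚ compare t) =
      Quot.comp (eps U) (qcol (0 : Fin 1) (compare t)) :=
    (qcol_comp _ _ _).trans (congrArg (fun s => Quot.comp s _) (qcol_epsSingles U))
  exact (congrArg (qcol i) h).trans ((qcol_comp _ _ _).trans
    ((congrArg (Quot.comp _) e).trans (push_eq U (col i f) _).symm))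

/-- Both maps are the evident ones on morphisms of `A` and send `ε` to `ε`, so their composite fixes
every word. -/
theorem compare_quotToPretr {X Y : A.Obj} (x : QHomGr A B X Y) :
    qcol (L := single Y 0) (0 : Fin 1) (compare (quotToPretr x)) = x := by
  let φ : ∀ Y, QHomGr A B X Y →ₗ[k] QHomGr A B X Y := fun Y =>
    qcol (L := single Y 0) (0 : Fin 1) ∘ₗ compare ∘ₗ quotToPretr
  refine Quot.q_induction (P := fun {Y} x => φ Y x = x) x ?_ ?_ ?_ ?_
  · intro Y; exact map_zero _
  · intro Y x y hx hy; rw [map_add, hx, hy]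
  · intro Y f
    exact (congrArg (fun s => qcol (L := single Y 0) (0 : Fin 1) (compare s))
      (quotToPretr_incl f)).trans (congrArg (qcol (L := single Y 0) (0 : Fin 1))
        (compare_incl (A.toPretr.map f)))
  · intro Y U f t ht
    exact (congrArg (fun s => qcol (L := single Y 0) (0 : Fin 1) (compare s))
      (quotToPretr_push U f t)).trans ((compare_push U (A.toPretr.map f) (quotToPretr t)
        (0 : Fin 1)).trans (congrArg (Quot.push U f) ht))

/-! ### The inverse of the comparison map -/

/-- The inclusion of a term of a twisted complex. -/
def inj (L : TwCpx A) (i : Fin L.n) : A.pretr.Hom (single (L.C i) 0) L := fun i' _ =>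
  delta L.C i' i

theorem col_inj_comp {X : A.Obj} {L : TwCpx A} (i i' : Fin L.n) (f : A.Hom X (L.C i)) :
    col i' (inj L i ⊚ A.toPretr.map f) = delta L.C i' i ⊚ f :=
  Fin.sum_univ_one fun l => ent (inj L i) i' l ⊚ ent (A.toPretr.map f) l (0 : Fin 1)

theorem sum_inj {X : A.Obj} {L : TwCpx A} (f : A.pretr.Hom (single X 0) L) :
    ∑ i, inj L i ⊚ A.toPretr.map (col i f) = f := by
  refine hom_ext fun i' j => ?_
  obtain rfl : j = (0 : Fin 1) := Subsingleton.elim (α := Fin 1) j _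
  exact (map_sum (col i') (fun i => inj L i ⊚ A.toPretr.map (col i f)) Finset.univ).trans
    ((Finset.sum_congr rfl fun i _ => col_inj_comp i i' (col i f)).trans
      (sum_delta_comp L.C i' fun l => col l f))

/-- The inverse of the comparison map. -/
noncomputable def compareInv {X : A.Obj} {L : TwCpx A} :
    (A.quot B).pretr.Hom ((toQuotPretr B).obj (single X 0)) ((toQuotPretr B).obj L) →ₗ[k]
      QHomGr A.pretr (singles B) (single X 0) L :=
  -- The inclusions of the terms need be neither closed nor of degree `0`, so no compatibility with
  -- `d` is visible here. None is needed: a linear inverse of `compare`, which commutes with `d`,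
  -- suffices.
  ∑ i : Fin L.n, Quot.act (A := A.pretr) (inj L i) ∘ₗ quotToPretr (B := B) ∘ₗ qcol i

theorem compareInv_apply {X : A.Obj} {L : TwCpx A}
    (z : (A.quot B).pretr.Hom ((toQuotPretr B).obj (single X 0)) ((toQuotPretr B).obj L)) :
    compareInv z = ∑ i : Fin L.n, Quot.act (A := A.pretr) (inj L i)
      (quotToPretr (B := B) (qcol i z)) :=
  LinearMap.sum_apply _ _ _

theorem compareInv_incl {X : A.Obj} {L : TwCpx A} (f : A.pretr.Hom (single X 0) L) :
    compareInv ((toQuotPretr B).map f) = Quot.incl f := by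
  have h : ∀ i : Fin L.n, Quot.act (A := A.pretr) (inj L i) (quotToPretr (B := B)
      (Quot.incl (col i f))) = Quot.incl (inj L i ⊚ A.toPretr.map (col i f)) := fun i =>
    (congrArg (Quot.act (A := A.pretr) (inj L i)) (quotToPretr_incl (col i f))).trans
      (Quot.act_incl (A := A.pretr) _ _)
  exact (compareInv_apply _).trans ((Finset.sum_congr rfl fun i _ => h i).trans
    ((map_sum Quot.incl _ _).symm.trans (congrArg Quot.incl (sum_inj f))))

theorem inj_single (X : A.Obj) : inj (single X 0) (0 : Fin 1) = A.pretr.one (single X 0) :=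
  hom_ext fun i j => by
    obtain rfl : j = (0 : Fin 1) := Subsingleton.elim (α := Fin 1) j _
    rfl

theorem act_inj_push {X : A.Obj} {L : TwCpx A} (U : B) (f : A.pretr.Hom (single U.1 0) L)
    (t : QHomGr A.pretr (singles B) (single X 0) (single U.1 0)) (i : Fin L.n)
    (ht : quotToPretr (B := B) (qcol (L := single U.1 0) (0 : Fin 1) (compare t)) = t) :
    Quot.act (A := A.pretr) (inj L i) (quotToPretr (B := B)
      (qcol i (compare (Quot.push (A := A.pretr) (toSingles U) f t)))) =
        Quot.push (A := A.pretr) (toSingles U) (inj L i ⊚ A.toPretr.map (col i f)) t := by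
  have h₁ : quotToPretr (B := B) (qcol i (compare (Quot.push (A := A.pretr) (toSingles U) f t))) =
      Quot.push (A := A.pretr) (toSingles U) (A.toPretr.map (col i f)) t :=
    (congrArg quotToPretr (compare_push U f t i)).trans ((quotToPretr_push U (col i f) _).trans
        (congrArg (Quot.push (A := A.pretr) (toSingles U) (A.toPretr.map (col i f))) ht))
  exact (congrArg (Quot.act (A := A.pretr) (inj L i)) h₁).trans
    (Quot.act_push (A := A.pretr) _ _ _ _)

theorem compareInv_push {X : A.Obj} {L : TwCpx A} (U : B) (f : A.pretr.Hom (single U.1 0) L)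
    (t : QHomGr A.pretr (singles B) (single X 0) (single U.1 0))
    (ht : quotToPretr (B := B) (qcol (L := single U.1 0) (0 : Fin 1) (compare t)) = t) :
    compareInv (compare (Quot.push (A := A.pretr) (toSingles U) f t)) =
      Quot.push (A := A.pretr) (toSingles U) f t := by
  refine (compareInv_apply _).trans ((Finset.sum_congr rfl fun i _ =>
    act_inj_push U f t i ht).trans ?_)
  refine Eq.trans ?_ (congrArg (fun s => Quot.push (A := A.pretr) (toSingles U) s t) (sum_inj f))
  exact (map_sum ((Quot.push (A := A.pretr) (toSingles U)).flip t) _ _).symm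

theorem compareInv_single {X U : A.Obj}
    (z : (A.quot B).pretr.Hom ((toQuotPretr B).obj (single X 0))
      ((toQuotPretr B).obj (single U 0))) :
    compareInv (L := single U 0) z = quotToPretr (B := B) (qcol (L := single U 0) (0 : Fin 1) z) :=
  (compareInv_apply (L := single U 0) z).trans <| (Fin.sum_univ_one _).trans <|
    (congrArg (fun s => Quot.act (A := A.pretr) s _) (inj_single U)).trans
      (Quot.act_one (A := A.pretr) _)

/-- Words are peeled off from the left. After the first `ε` the remaining word ends at some `single
U 0`, where `compareInv` reduces to `quotToPretr`; this turns the induction hypothesis into the one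
required by `compareInv_push`. -/
theorem compareInv_compare {X : A.Obj} {L : TwCpx A}
    (x : QHomGr A.pretr (singles B) (single X 0) L) : compareInv (compare x) = x := by
  let φ : ∀ L, QHomGr A.pretr (singles B) (single X 0) L →ₗ[k]
    QHomGr A.pretr (singles B) (single X 0) L := fun L => compareInv ∘ₗ compare
  refine Quot.q_induction (A := A.pretr) (P := fun {L} x => φ L x = x) x ?_ ?_ ?_ ?_
  · intro L; exact map_zero _
  · intro L x y hx hy
    exact (map_add _ _ _).trans (congrArg₂ _ hx hy)
  · intro L f
    exact (congrArg compareInv (compare_incl f)).trans (compareInv_incl f)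
  · rintro L ⟨_, U, hU, rfl⟩ f t ht
    exact compareInv_push ⟨U, hU⟩ f t ((compareInv_single (compare t)).symm.trans ht)

/-- Row by row, composing with the inclusion of the term `i` becomes multiplication by a column of
the identity matrix, and summing over `i` recovers the entry. -/
theorem compare_compareInv {X : A.Obj} {L : TwCpx A}
    (z : (A.quot B).pretr.Hom ((toQuotPretr B).obj (single X 0)) ((toQuotPretr B).obj L)) :
    compare (compareInv z) = z := by
  refine qhom_ext fun i' => ?_
  have h : ∀ i : Fin L.n, qcol i' (compare (Quot.act (A := A.pretr) (inj L i)
      (quotToPretr (B := B) (qcol i z)))) = (A.quot B).comp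
        (delta ((A.toQuot B).twObj L).C i' i) (qcol i z) := by
    intro i
    refine (congrArg (qcol i') (Quot.extend_act (toQuotPretr B) epsSingles (inj L i) _)).trans ?_
    refine (qcol_comp _ _ _).trans ?_
    exact congrArg₂ (fun s t => (A.quot B).comp s t) ((A.toQuot B).map_delta L.C i' i)
      (compare_quotToPretr _)
  refine (congrArg (fun s => qcol i' (compare s)) (compareInv_apply z)).trans ?_
  refine (map_sum (qcol i' ∘ₗ compare) _ _).trans ((Finset.sum_congr rfl fun i _ => h i).trans ?_)
  exact sum_delta_comp ((A.toQuot B).twObj L).C i' fun i => qcol (B := B) (L := L) i z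

theorem compare_qd {K L : A.pretr.Obj} (x : QHomGr A.pretr (singles B) K L) :
    compare (Quot.qd x) = ((A.quot B).pretr.Hom ((toQuotPretr B).obj K)
      ((toQuotPretr B).obj L)).d (compare x) :=
  Quot.extend_qd (toQuotPretr B) epsSingles epsSingles_mem d_epsSingles x

end DGCat

end DG

namespace DG

namespace DGCat

variable {k : Type u} [CommRing k] {A : DGCat k}

open TwCpx

/-! ### Twisted complexes as iterated cones -/

namespace TwCpx

theorem sum_fin_split {M : Type*} [AddCommMonoid M] {m n : ℕ} (hm : m + 1 = n) (g : Fin n → M) :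
    ∑ t, g t = ∑ i : Fin m, g ⟨i, by omega⟩ + g ⟨m, by omega⟩ := by
  subst hm
  exact Fin.sum_univ_castSucc g

/-- This and `sum_zero` evaluate the right-hand side of `ent_d_of_mem` for the structure maps of
`initCone`, whose entries are closed: here for degree `0`, there when the last sum vanishes. -/
theorem sum_even {M : Type*} [AddCommGroup M] (e : ℤ) {a b c b' c' z : M} (ha : a = 0)
    (hb : b = b') (hc : c = c') (h : b' - c' = z) :
    e • a + b - ((0 : ℤ).negOnePow : ℤ) • c = z := by
  subst ha hb hc h
  simp

theorem sum_zero {M : Type*} [AddCommGroup M] (e e' : ℤ) {a b c z : M} (ha : a = 0)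
    (hb : b = z) (hc : c = 0) : e • a + b - e' • c = z := by
  subst ha hb hc
  simp

variable {K L : TwCpx A}

theorem ent_d_of_mem {n : ℤ} {f : A.pretr.Hom K L} (hf : f ∈ (A.pretr.Hom K L).gr n)
    (i : Fin L.n) (j : Fin K.n) :
    ent ((A.pretr.Hom K L).d f) i j = ((L.r i).negOnePow : ℤ) • (A.Hom _ _).d (ent f i j) +
      ∑ l, entry L.q i l ⊚ ent f l j - (n.negOnePow : ℤ) • ∑ l, ent f i l ⊚ entry K.q l j := by
  have h : (A.pretr.Hom K L).d f = (A.sums.Hom K.toFam L.toFam).d f + A.sums.comp L.q f -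
      (n.negOnePow : ℤ) • A.sums.comp f K.q := by
    refine (twistD_apply (A := A.sums) K.q L.q f).trans ?_
    refine congrArg (fun s => (A.sums.Hom K.toFam L.toFam).d f + A.sums.comp L.q f - s) ?_
    refine (congrArg (fun s => A.sums.comp s K.q)
      (GrMod.sgn_of_mem (A.sums.Hom K.toFam L.toFam).toGrMod hf)).trans ?_
    exact map_zsmul (A.sums.comp.flip K.q) _ f
  exact congrArg (fun s => ent s i j) h

variable (K) {m : ℕ} (hm : m + 1 = K.n)

/-- The last index of a twisted complex. -/
def lastIdx : Fin K.n := ⟨m, by omega⟩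

/-- The indices other than the last one. -/
def initIdx (i : Fin m) : Fin K.n := ⟨i, by omega⟩

theorem initIdx_injective : Function.Injective (initIdx K hm) := fun _ _ h =>
  Fin.ext (Fin.mk.inj h)

theorem initIdx_ne_lastIdx (i : Fin m) : initIdx K hm i ≠ lastIdx K hm := fun h =>
  absurd (Fin.mk.inj h) i.2.ne

theorem le_lastIdx (t : Fin K.n) : t ≤ lastIdx K hm :=
  Fin.le_def.2 (Nat.le_of_lt_succ (t.2.trans_eq hm.symm))

theorem sum_split {M : Type*} [AddCommMonoid M] (g : Fin K.n → M) :
    ∑ t, g t = ∑ i, g (initIdx K hm i) + g (lastIdx K hm) :=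
  sum_fin_split hm g

theorem entry_q_lastIdx (t : Fin K.n) : entry K.q (lastIdx K hm) t = 0 :=
  K.q_tri _ _ (le_lastIdx K hm t)

theorem mc_entry (i j : Fin K.n) : ((K.r i).negOnePow : ℤ) • (A.Hom _ _).d (entry K.q i j) +
    ∑ l, entry K.q i l ⊚ entry K.q l j = 0 :=
  congrArg (fun s => entry (A := A) (X := K.toFam) (Y := K.toFam) s i j) K.mc

/-- The twisted complex obtained by removing the last term. -/
def init : TwCpx A where
  n := m
  C i := K.C (initIdx K hm i)
  r i := K.r (initIdx K hm i)
  q i j := entry K.q (initIdx K hm i) (initIdx K hm j)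
  q_mem i j := K.q_mem (initIdx K hm i) (initIdx K hm j)
  q_tri i j h := K.q_tri _ _ h
  mc := funext fun i => funext fun j => by
    have h := mc_entry K (initIdx K hm i) (initIdx K hm j)
    rw [sum_split K hm, entry_q_lastIdx, comp_zero, add_zero] at h
    exact h

/-- The last term of a twisted complex, shifted by `-1`. -/
def lastTerm : TwCpx A := single (K.C (lastIdx K hm)) (K.r (lastIdx K hm) - 1)

/-- The morphism whose cone is the given twisted complex. -/
def connecting : A.pretr.Hom (lastTerm K hm) (init K hm) := fun i _ =>
  entry K.q (initIdx K hm i) (lastIdx K hm)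

theorem connecting_mem :
    connecting K hm ∈ (A.pretr.Hom (lastTerm K hm) (init K hm)).gr 0 := fun i j => by
  have h : entry K.q (initIdx K hm i) (lastIdx K hm) ∈ (A.Hom _ _).gr
    (1 + K.r (initIdx K hm i) - K.r (lastIdx K hm)) := K.q_mem _ _
  have e : 1 + K.r (initIdx K hm i) - K.r (lastIdx K hm) =
    0 + K.r (initIdx K hm i) - (K.r (lastIdx K hm) - 1) := by ring
  rw [e] at h
  exact h

theorem connecting_closed :
    connecting K hm ∈ A.pretr.closed (lastTerm K hm) (init K hm) := by
  refine ⟨connecting_mem K hm, LinearMap.mem_ker.2 (hom_ext fun i j => ?_)⟩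
  refine (ent_d_of_mem (connecting_mem K hm) i j).trans ?_
  have h := mc_entry K (initIdx K hm i) (lastIdx K hm)
  rw [sum_split K hm, entry_q_lastIdx, comp_zero, add_zero] at h
  refine (sub_eq_zero_of_eq ?_).trans rfl
  refine Eq.trans h ?_
  symm
  refine smul_eq_zero_of_right _ (Finset.sum_eq_zero fun l _ => ?_)
  exact comp_zero _

theorem sum_initIdx_delta_comp {X : A.Obj} (t : Fin K.n) (f : ∀ l, A.Hom X (K.C l)) :
    ∑ i, delta K.C t (initIdx K hm i) ⊚ f (initIdx K hm i) =
      f t - delta K.C t (lastIdx K hm) ⊚ f (lastIdx K hm) := by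
  rw [← sum_delta_comp K.C t f, sum_split K hm, add_sub_cancel_right]

theorem sum_initIdx_comp_delta {X : A.Obj} (t : Fin K.n) (f : ∀ l, A.Hom (K.C l) X) :
    ∑ i, f (initIdx K hm i) ⊚ delta K.C (initIdx K hm i) t =
      f t - f (lastIdx K hm) ⊚ delta K.C (lastIdx K hm) t := by
  rw [← sum_comp_delta K.C t f, sum_split K hm, add_sub_cancel_right]

/-- The inclusion of all terms but the last one. -/
def initInr : A.pretr.Hom (init K hm) K := fun t j => delta K.C t (initIdx K hm j)

/-- The projection to the last term. -/
def initFst : A.pretr.Hom K (lastTerm K hm) := fun _ t => delta K.C (lastIdx K hm) t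

/-- The inclusion of the last term. -/
def initInl : A.pretr.Hom (lastTerm K hm) K := fun t _ => delta K.C t (lastIdx K hm)

/-- The projection to all terms but the last one. -/
def initSnd : A.pretr.Hom K (init K hm) := fun i t => delta K.C (initIdx K hm i) t

theorem initInr_mem : initInr K hm ∈ (A.pretr.Hom (init K hm) K).gr 0 := fun t j =>
  delta_mem K.C fun h => by
    subst h
    have e : (0 : ℤ) + K.r (initIdx K hm j) - K.r (initIdx K hm j) = 0 := by ring
    exact e

theorem initFst_mem : initFst K hm ∈ (A.pretr.Hom K (lastTerm K hm)).gr 1 := fun _ t =>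
  delta_mem K.C fun h => by
    subst h
    have e : (1 : ℤ) + (K.r (lastIdx K hm) - 1) - K.r (lastIdx K hm) = 0 := by ring
    exact e

theorem initInl_mem : initInl K hm ∈ (A.pretr.Hom (lastTerm K hm) K).gr (-1) := fun t _ =>
  delta_mem K.C fun h => by
    subst h
    have e : (-1 : ℤ) + K.r (lastIdx K hm) - (K.r (lastIdx K hm) - 1) = 0 := by ring
    exact e

theorem initSnd_mem : initSnd K hm ∈ (A.pretr.Hom K (init K hm)).gr 0 := fun i t =>
  delta_mem K.C fun h => by
    subst h
    have e : (0 : ℤ) + K.r (initIdx K hm i) - K.r (initIdx K hm i) = 0 := by ring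
    exact e

theorem initFst_initInl : initFst K hm ⊚ initInl K hm = A.pretr.one (lastTerm K hm) :=
  hom_ext fun i j => by
    obtain rfl : i = j := Subsingleton.elim (α := Fin 1) i j
    refine (sum_delta_comp K.C (lastIdx K hm) fun t => delta K.C t (lastIdx K hm)).trans ?_
    exact (delta_self K.C _).trans (delta_self (lastTerm K hm).C i).symm

theorem initSnd_initInr : initSnd K hm ⊚ initInr K hm = A.pretr.one (init K hm) :=
  hom_ext fun i j => (sum_delta_comp K.C (initIdx K hm i) fun t =>
    delta K.C t (initIdx K hm j)).trans (delta_comp_inj K.C _ (initIdx_injective K hm) i j)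

theorem initFst_initInr : initFst K hm ⊚ initInr K hm = 0 :=
  hom_ext fun _ j => (sum_delta_comp K.C (lastIdx K hm) fun t =>
    delta K.C t (initIdx K hm j)).trans (delta_ne K.C (initIdx_ne_lastIdx K hm j).symm)

theorem initSnd_initInl : initSnd K hm ⊚ initInl K hm = 0 :=
  hom_ext fun i _ => (sum_delta_comp K.C (initIdx K hm i) fun t =>
    delta K.C t (lastIdx K hm)).trans (delta_ne K.C (initIdx_ne_lastIdx K hm i))

theorem init_total : initInl K hm ⊚ initFst K hm + initInr K hm ⊚ initSnd K hm = A.pretr.one K :=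
  hom_ext fun t t' => by
    have h₁ : ent (initInl K hm ⊚ initFst K hm) t t' =
        delta K.C t (lastIdx K hm) ⊚ delta K.C (lastIdx K hm) t' := Fin.sum_univ_one fun _ => _
    have h₂ : ent (initInr K hm ⊚ initSnd K hm) t t' = delta K.C t t' -
        delta K.C t (lastIdx K hm) ⊚ delta K.C (lastIdx K hm) t' :=
      sum_initIdx_delta_comp K hm t fun l => delta K.C l t'
    exact (congrArg₂ (fun x y => x + y) h₁ h₂).trans (add_sub_cancel _ _)

theorem d_initInr : (A.pretr.Hom (init K hm) K).d (initInr K hm) = 0 :=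
  hom_ext fun t j => by
    refine (ent_d_of_mem (initInr_mem K hm) t j).trans ?_
    have h₁ : (A.Hom _ _).d (ent (initInr K hm) t j) = 0 := d_delta K.C _ _
    have h₂ : ∑ l, entry K.q t l ⊚ ent (initInr K hm) l j = entry K.q t (initIdx K hm j) :=
      sum_comp_delta K.C _ fun l => entry K.q t l
    have h₃ : ∑ l, ent (initInr K hm) t l ⊚ entry (init K hm).q l j =
        entry K.q t (initIdx K hm j) := by
      refine (sum_initIdx_delta_comp K hm t fun l => entry K.q l (initIdx K hm j)).trans ?_
      rw [entry_q_lastIdx, comp_zero, sub_zero]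
    exact sum_even _ h₁ h₂ h₃ (sub_self _)

theorem d_initFst : (A.pretr.Hom K (lastTerm K hm)).d (initFst K hm) = 0 :=
  hom_ext fun i t => by
    refine (ent_d_of_mem (initFst_mem K hm) i t).trans ?_
    have h₁ : (A.Hom _ _).d (ent (initFst K hm) i t) = 0 := d_delta K.C _ _
    have h₂ : ∑ l, entry (lastTerm K hm).q i l ⊚ ent (initFst K hm) l t = 0 :=
      Finset.sum_eq_zero fun l _ => zero_comp _
    have h₃ : ∑ l, ent (initFst K hm) i l ⊚ entry K.q l t = 0 :=
      (sum_delta_comp K.C (lastIdx K hm) fun l => entry K.q l t).trans (entry_q_lastIdx K hm t)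
    exact sum_zero _ _ h₁ h₂ h₃

theorem d_initInl : (A.pretr.Hom (lastTerm K hm) K).d (initInl K hm) =
    initInr K hm ⊚ connecting K hm :=
  hom_ext fun t j => by
    refine (ent_d_of_mem (initInl_mem K hm) t j).trans ?_
    have h₁ : (A.Hom _ _).d (ent (initInl K hm) t j) = 0 := d_delta K.C _ _
    have h₂ : ∑ l, entry K.q t l ⊚ ent (initInl K hm) l j = entry K.q t (lastIdx K hm) :=
      sum_comp_delta K.C _ fun l => entry K.q t l
    have h₃ : ∑ l, ent (initInl K hm) t l ⊚ entry (lastTerm K hm).q l j = 0 :=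
      Finset.sum_eq_zero fun l _ => comp_zero _
    have h₄ : ent (initInr K hm ⊚ connecting K hm) t j = entry K.q t (lastIdx K hm) := by
      refine (sum_initIdx_delta_comp K hm t fun l => entry K.q l (lastIdx K hm)).trans ?_
      rw [entry_q_lastIdx, comp_zero, sub_zero]
    exact (sum_zero _ _ h₁ h₂ h₃).trans h₄.symm

theorem d_initSnd : (A.pretr.Hom K (init K hm)).d (initSnd K hm) =
    -(connecting K hm ⊚ initFst K hm) :=
  hom_ext fun i t => by
    refine (ent_d_of_mem (initSnd_mem K hm) i t).trans ?_
    have h₁ : (A.Hom _ _).d (ent (initSnd K hm) i t) = 0 := d_delta K.C _ _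
    have h₂ : ∑ l, entry (init K hm).q i l ⊚ ent (initSnd K hm) l t =
        entry K.q (initIdx K hm i) t -
          entry K.q (initIdx K hm i) (lastIdx K hm) ⊚ delta K.C (lastIdx K hm) t :=
      sum_initIdx_comp_delta K hm t fun l => entry K.q (initIdx K hm i) l
    have h₃ : ∑ l, ent (initSnd K hm) i l ⊚ entry K.q l t = entry K.q (initIdx K hm i) t :=
      sum_delta_comp K.C (initIdx K hm i) fun l => entry K.q l t
    have h₄ : ent (connecting K hm ⊚ initFst K hm) i t =
        entry K.q (initIdx K hm i) (lastIdx K hm) ⊚ delta K.C (lastIdx K hm) t :=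
      Fin.sum_univ_one fun _ => _
    exact (sum_even _ h₁ h₂ h₃ (sub_sub_cancel_left _ _)).trans (congrArg (fun x => -x) h₄.symm)

/-- A twisted complex is the cone of a morphism from the last term to the other ones. -/
def initCone : Cone (A := A.pretr) (connecting K hm) where
  pt := K
  inr := initInr K hm
  fst := initFst K hm
  inl := initInl K hm
  snd := initSnd K hm
  inr_mem := initInr_mem K hm
  fst_mem := initFst_mem K hm
  inl_mem := initInl_mem K hm
  snd_mem := initSnd_mem K hm
  fst_inl := initFst_initInl K hm
  snd_inr := initSnd_initInr K hm
  fst_inr := initFst_initInr K hm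
  snd_inl := initSnd_initInl K hm
  total := init_total K hm
  d_inr := d_initInr K hm
  d_fst := d_initFst K hm
  d_inl := d_initInl K hm
  d_snd := d_initSnd K hm

end TwCpx

/-- To prove a property of twisted complexes with terms in `S`, it suffices to prove it for the
zero complexes and for the complexes `X[r]`, and that it is inherited by cones. -/
theorem pretr_induction {S : Set A.Obj} {P : A.pretr.Obj → Prop}
    (zero : ∀ K, A.pretr.one K = 0 → P K) (single : ∀ X ∈ S, ∀ r, P (single X r))
    (cone : ∀ {K L : A.pretr.Obj} (f : A.pretr.Hom K L), f ∈ A.pretr.closed K L →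
      ∀ C : Cone f, P K → P L → P C.pt)
    (K : TwCpx A) (hK : ∀ i, K.C i ∈ S) : P K := by
  obtain ⟨m, hm⟩ : ∃ m, K.n = m := ⟨_, rfl⟩
  induction m generalizing K with
  | zero => exact zero K (funext fun i => (Fin.cast hm i).elim0)
  | succ m ih =>
    -- One-sidedness puts the last term at the end of the twisting: no entry of `q` leads into it.
    -- So `K` is the cone of a morphism from the last term, shifted by `-1`, to the complex of the
    -- others.
    exact cone (connecting K hm.symm) (connecting_closed K hm.symm) (initCone K hm.symm)
      (single _ (hK _) _) (ih (init K hm.symm) (fun i => hK _) rfl)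

end DGCat

end DG

namespace DG

/-! ### A criterion for a localization to be an equivalence -/

section Localization

variable {C : Type*} [Category C] {D : Type*} [Category D] {W : MorphismProperty C} (F : C ⥤ D)
  (hF : W.IsInvertedBy F) (S : MorphismProperty C)

theorem isIso_map_of_isIso_Q (hF : W.IsInvertedBy F) {X Y : C} {s : X ⟶ Y}
    (h : IsIso (W.Q.map s)) : IsIso (F.map s) := by
  have h' : IsIso ((W.Q ⋙ Localization.Construction.lift F hF).map s) :=
    Functor.map_isIso (Localization.Construction.lift F hF) (W.Q.map s)
  rwa [Localization.Construction.fac F hF] at h'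

theorem lift_map_Q {X Y : C} (f : X ⟶ Y) :
    (Localization.Construction.lift F hF).map (W.Q.map f) = F.map f := by
  have h := Functor.congr_hom (Localization.Construction.fac F hF) f
  exact h.trans ((Category.id_comp _).trans (Category.comp_id _))

/-- Right fractions with denominators in `S`. -/
def IsFraction (W S : MorphismProperty C) {X Y : C} (α : W.Q.obj X ⟶ W.Q.obj Y) : Prop :=
  ∃ (Y' : C) (s : Y ⟶ Y') (g : X ⟶ Y'), S s ∧ α ≫ W.Q.map s = W.Q.map g

/-- An Ore square comes from `F`: lift `F(s)⁻¹ F(h)` to a fraction with numerator `h₁` and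
denominator `s₁`. Then `s ≫ h₁` and `h ≫ s₁` agree after `F`, hence after one more element of `S`.
-/
theorem IsFraction.comp (hF : W.IsInvertedBy F) [S.IsMultiplicative]
    (hS : ∀ {X Y : C} (s : X ⟶ Y), S s → IsIso (W.Q.map s))
    (full : ∀ {X Y : C} (φ : F.obj X ⟶ F.obj Y), ∃ (Y' : C) (s : Y ⟶ Y') (g : X ⟶ Y'),
      S s ∧ F.map g = φ ≫ F.map s)
    (faithful : ∀ {X Y : C} (g h : X ⟶ Y), F.map g = F.map h →
      ∃ (Y' : C) (s : Y ⟶ Y'), S s ∧ g ≫ s = h ≫ s) {X Y Z : C} {α : W.Q.obj X ⟶ W.Q.obj Y}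
    {β : W.Q.obj Y ⟶ W.Q.obj Z} (hα : IsFraction W S α) (hβ : IsFraction W S β) :
    IsFraction W S (α ≫ β) := by
  obtain ⟨Y', s, g, hs, hg⟩ := hα
  obtain ⟨Z', t, h, ht, hh⟩ := hβ
  have := isIso_map_of_isIso_Q F hF (hS s hs)
  obtain ⟨Z₁, s₁, h₁, hs₁, e₁⟩ := full (inv (F.map s) ≫ F.map h)
  obtain ⟨Z₂, s₂, hs₂, e₂⟩ := faithful (s ≫ h₁) (h ≫ s₁) (by
    rw [F.map_comp, F.map_comp, e₁, Category.assoc, IsIso.hom_inv_id_assoc])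
  refine ⟨Z₂, t ≫ s₁ ≫ s₂, g ≫ h₁ ≫ s₂, S.comp_mem _ _ ht (S.comp_mem _ _ hs₁ hs₂), ?_⟩
  have e₃ := congrArg W.Q.map e₂
  simp only [Functor.map_comp, Category.assoc] at e₃ ⊢
  rw [reassoc_of% hh, ← e₃, reassoc_of% hg]

/-- Lift `F(w)⁻¹` to a fraction `g`, `s`. Since `w ≫ g` and `s` have the same image under `F`, they
agree after some `s₂` in `S`, and this fraction represents the formal inverse of `w`. -/
theorem isFraction_inv (hF : W.IsInvertedBy F) [S.IsMultiplicative]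
    (full : ∀ {X Y : C} (φ : F.obj X ⟶ F.obj Y), ∃ (Y' : C) (s : Y ⟶ Y') (g : X ⟶ Y'),
      S s ∧ F.map g = φ ≫ F.map s)
    (faithful : ∀ {X Y : C} (g h : X ⟶ Y), F.map g = F.map h →
      ∃ (Y' : C) (s : Y ⟶ Y'), S s ∧ g ≫ s = h ≫ s) {X Y : C} (w : X ⟶ Y) (hw : W w) :
    IsFraction W S (Localization.Construction.wInv w hw) := by
  have := hF w hw
  obtain ⟨X₁, s, g, hs, e⟩ := full (inv (F.map w))
  obtain ⟨X₂, s₂, hs₂, e₂⟩ := faithful (w ≫ g) s (by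
    rw [F.map_comp, e, IsIso.hom_inv_id_assoc])
  refine ⟨X₂, s ≫ s₂, g ≫ s₂, S.comp_mem _ _ hs hs₂, ?_⟩
  refine (Iso.inv_comp_eq (Localization.Construction.wIso w hw)).2 ?_
  refine Eq.trans ?_ (W.Q.map_comp _ _)
  rw [← e₂, Category.assoc]

/-- Morphisms in the localization are right fractions with denominators in a class `S` of morphisms
such that morphisms in the image of `F` lift up to elements of `S`. -/
theorem localization_exists_fraction (hF : W.IsInvertedBy F) [S.IsMultiplicative]
    (hS : ∀ {X Y : C} (s : X ⟶ Y), S s → IsIso (W.Q.map s))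
    (full : ∀ {X Y : C} (φ : F.obj X ⟶ F.obj Y), ∃ (Y' : C) (s : Y ⟶ Y') (g : X ⟶ Y'),
      S s ∧ F.map g = φ ≫ F.map s)
    (faithful : ∀ {X Y : C} (g h : X ⟶ Y), F.map g = F.map h →
      ∃ (Y' : C) (s : Y ⟶ Y'), S s ∧ g ≫ s = h ≫ s) {X Y : C} (α : W.Q.obj X ⟶ W.Q.obj Y) :
    IsFraction W S α := by
  let P : MorphismProperty W.Localization := fun X Y α =>
    IsFraction W S (X := (Localization.Construction.objEquiv W).symm X)
      (Y := (Localization.Construction.objEquiv W).symm Y) α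
  have hP : P.IsStableUnderComposition :=
    ⟨fun _ _ hα hβ => IsFraction.comp F S hF hS full faithful hα hβ⟩
  -- The localization is generated under composition by images of morphisms and formal inverses, so
  -- closure under composition and these two cases suffice.
  have top : P = ⊤ := Localization.Construction.morphismProperty_eq_top P
    (fun X Y f => ⟨Y, 𝟙 Y, f, S.id_mem Y,
      (congrArg (W.Q.map f ≫ ·) (W.Q.map_id Y)).trans (Category.comp_id _)⟩)
    fun X Y w hw => isFraction_inv F S hF full faithful w hw
  exact (top.symm ▸ trivial : P α)

/-- A functor inverting `W` which is full, faithful and essentially surjective up to a class of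
morphisms which become invertible in the localization with respect to `W` induces an equivalence on
the localization. -/
theorem localization_lift_isEquivalence [F.EssSurj] [S.IsMultiplicative]
    (hS : ∀ {X Y : C} (s : X ⟶ Y), S s → IsIso (W.Q.map s))
    (full : ∀ {X Y : C} (φ : F.obj X ⟶ F.obj Y), ∃ (Y' : C) (s : Y ⟶ Y') (g : X ⟶ Y'),
      S s ∧ F.map g = φ ≫ F.map s)
    (faithful : ∀ {X Y : C} (g h : X ⟶ Y), F.map g = F.map h →
      ∃ (Y' : C) (s : Y ⟶ Y'), S s ∧ g ≫ s = h ≫ s) :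
    (Localization.Construction.lift F hF).IsEquivalence where
  essSurj := ⟨fun Y => ⟨W.Q.obj (F.objPreimage Y), ⟨F.objObjPreimageIso Y⟩⟩⟩
  full := ⟨fun {X Y} φ => by
    obtain ⟨X, rfl⟩ := (Localization.Construction.objEquiv W).surjective X
    obtain ⟨Y, rfl⟩ := (Localization.Construction.objEquiv W).surjective Y
    let L := Localization.Construction.lift F hF
    suffices h : ∀ φ : L.obj (W.Q.obj X) ⟶ L.obj (W.Q.obj Y), ∃ ψ, L.map ψ = φ from h φ
    intro φ
    obtain ⟨Y', s, g, hs, e⟩ := full (X := X) (Y := Y) φ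
    have := hS s hs
    have h' := isIso_map_of_isIso_Q F hF this
    -- The denominator `s` is invertible in the localization, so the numerator divided by it is a
    -- preimage of `φ`.
    refine ⟨W.Q.map g ≫ (asIso (W.Q.map s)).inv, ?_⟩
    rw [← lift_map_Q F hF] at h'
    rw [← cancel_mono (L.map (W.Q.map s)), ← L.map_comp, Category.assoc, asIso_inv,
      IsIso.inv_hom_id, Category.comp_id]
    exact (lift_map_Q F hF g).trans (e.trans (congrArg (φ ≫ ·) (lift_map_Q F hF s).symm))⟩
  faithful := ⟨fun {X Y α β} h => by
    obtain ⟨X, rfl⟩ := (Localization.Construction.objEquiv W).surjective X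
    obtain ⟨Y, rfl⟩ := (Localization.Construction.objEquiv W).surjective Y
    change W.Q.obj X ⟶ W.Q.obj Y at α β
    -- Bring `α` and `β` to a common denominator `s ≫ t`. Their numerators `g ≫ t` and `g'` then
    -- have equal images under `F`, hence agree after some `u` in `S`.
    obtain ⟨Y', s, g, hs, e⟩ := localization_exists_fraction F S hF hS full faithful α
    obtain ⟨Y'', t, g', ht, e'⟩ := localization_exists_fraction F S hF hS full faithful
      (β ≫ W.Q.map s)
    obtain ⟨Z, u, hu, e''⟩ := faithful g' (g ≫ t) (by
      rw [← lift_map_Q F hF, ← lift_map_Q F hF, ← e', Functor.map_comp W.Q, ← e]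
      simp only [Functor.map_comp]
      exact congrArg (fun x => (x ≫ _) ≫ _) h.symm)
    have := hS _ (S.comp_mem _ _ hs (S.comp_mem _ _ ht hu))
    refine (cancel_mono (W.Q.map (s ≫ t ≫ u))).1 ?_
    have e₃ := congrArg W.Q.map e''
    simp only [Functor.map_comp, Category.assoc] at e₃ ⊢
    rw [reassoc_of% e, ← e₃, ← reassoc_of% e']⟩

end Localization

end DG

namespace DG

namespace DGCat

variable {k : Type u} [CommRing k] {A C : DGCat k}

/-! ### Flatness of complexes of morphisms into cones -/

theorem isHoFlat_of_eq_zero {M : Cpx k} (h : ∀ x : M, x = 0) : M.IsHoFlat := fun C _ z _ =>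
  ⟨0, (Cpx.tensor_ext (φ := (0 : C ⊗[k] M →ₗ[k] C ⊗[k] M)) (ψ := LinearMap.id)
    (fun x y => by simp [h y]) z)⟩

/-- The sequence `0 → Hom(U, L) → Hom(U, cone) → Hom(U, K)[1] → 0` splits as graded modules, so it
stays exact after tensoring. The proof is the acyclicity argument for the middle term, carried out
on elements. -/
theorem isHoFlat_cone {U K L : A.Obj} {f : A.Hom K L} (D : Cone f) (hK : (A.Hom U K).IsHoFlat)
    (hL : (A.Hom U L).IsHoFlat) : (A.Hom U D.pt).IsHoFlat := by
  intro M hM z hz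
  change M ⊗[k] A.Hom U D.pt at z
  change Cpx.tensorD M (A.Hom U D.pt) z = 0 at hz
  -- The projection `fst` has degree `1` and anticommutes with `d`, so it is a chain map to `Hom(U,
  -- K)` with the opposite differential.
  have hfst : ∀ z, Cpx.tensorD M (A.Hom U K).neg ((A.comp D.fst).lTensor M z) =
      (A.comp D.fst).lTensor M (Cpx.tensorD M (A.Hom U D.pt) z) :=
    Cpx.lTensor_tensorD (N := (A.Hom U K).neg) M (A.comp D.fst) fun x => by
      have h : (A.Hom U K).d (D.fst ⊚ x) = -(D.fst ⊚ (A.Hom U D.pt).d x) := by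
        rw [leibniz_sgn, D.d_fst, Ho.Aux.sgn_fst]
        simp
      exact (congrArg Neg.neg h).trans (neg_neg _)
  have hinr : ∀ z, Cpx.tensorD M (A.Hom U D.pt) ((A.comp D.inr).lTensor M z) =
      (A.comp D.inr).lTensor M (Cpx.tensorD M (A.Hom U L) z) :=
    Cpx.lTensor_tensorD M (A.comp D.inr) (d_comp_closed (Ho.Aux.inr_closed D))
  have hinl : ∀ z : M ⊗[k] A.Hom U K, Cpx.tensorD M (A.Hom U D.pt) ((A.comp D.inl).lTensor M z) =
      (A.comp D.inl).lTensor M (Cpx.tensorD M (A.Hom U K).neg z) +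
        (A.comp D.inr).lTensor M (TensorProduct.map M.sgn (A.comp f) z) := by
    intro z
    refine Cpx.tensor_ext (φ := Cpx.tensorD M (A.Hom U D.pt) ∘ₗ (A.comp D.inl).lTensor M)
      (ψ := ((A.comp D.inl).lTensor M ∘ₗ Cpx.tensorD M (A.Hom U K).neg :
        M ⊗[k] A.Hom U K →ₗ[k] M ⊗[k] A.Hom U D.pt) +
        (A.comp D.inr).lTensor M ∘ₗ TensorProduct.map M.sgn (A.comp (X := U) f)) (fun x y => ?_) z
    have hneg : Cpx.tensorD M (A.Hom U K).neg (x ⊗ₜ[k] y) =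
        (M.d x ⊗ₜ[k] y - M.sgn x ⊗ₜ[k] (A.Hom U K).d y : M ⊗[k] A.Hom U K) :=
      (congrArg (M.d x ⊗ₜ[k] y + ·) (TensorProduct.tmul_neg _ _)).trans (sub_eq_add_neg _ _).symm
    refine Eq.trans ?_ (congrArg (fun t => (A.comp D.inl).lTensor M t +
      (A.comp D.inr).lTensor M (TensorProduct.map M.sgn (A.comp f) (x ⊗ₜ[k] y))) hneg).symm
    simp only [LinearMap.comp_apply, LinearMap.lTensor_tmul, Cpx.tensorD_tmul,
      TensorProduct.map_tmul, map_sub, leibniz_sgn, D.d_inl, Ho.Aux.sgn_inl, A.assoc,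
      TensorProduct.tmul_add, map_neg, LinearMap.neg_apply, TensorProduct.tmul_neg]
    abel
  have hsnd : ∀ z : M ⊗[k] A.Hom U L, (A.comp D.snd).lTensor M ((A.comp D.inr).lTensor M z) = z :=
    Cpx.tensor_ext (φ := (A.comp D.snd).lTensor M ∘ₗ (A.comp D.inr).lTensor M)
      (ψ := LinearMap.id) fun x y => by simp [Ho.Aux.snd_inr_assoc]
  have htot : (A.comp D.inl).lTensor M ((A.comp D.fst).lTensor M z) +
      (A.comp D.inr).lTensor M ((A.comp D.snd).lTensor M z) = z :=
    Cpx.tensor_ext (φ := (A.comp D.inl).lTensor M ∘ₗ (A.comp (X := U) D.fst).lTensor M +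
      (A.comp D.inr).lTensor M ∘ₗ (A.comp D.snd).lTensor M) (ψ := LinearMap.id)
      (fun x y => by
        simp only [LinearMap.comp_apply, LinearMap.add_apply, LinearMap.lTensor_tmul,
          ← TensorProduct.tmul_add, Ho.Aux.inr_snd_assoc, add_sub_cancel, LinearMap.id_apply]) z
  obtain ⟨w, hw⟩ := hK.neg M hM ((A.comp D.fst).lTensor M z)
    ((hfst z).trans ((congrArg _ hz).trans (map_zero _)))
  change M ⊗[k] A.Hom U K at w
  change Cpx.tensorD M (A.Hom U K).neg w = _ at hw
  -- Once the image of `z` in the quotient is bounded by `w`, the difference `z - d(inl w)` lies in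
  -- the image of `Hom(U, L)`, and `v` is its preimage.
  let v := (A.comp D.snd).lTensor M z - TensorProduct.map M.sgn (A.comp f) w
  have hv : (A.comp D.inr).lTensor M v =
      z - Cpx.tensorD M (A.Hom U D.pt) ((A.comp D.inl).lTensor M w) := by
    rw [eq_sub_iff_add_eq, map_sub, hinl, hw]
    exact Eq.trans (by abel) htot
  have hdv : Cpx.tensorD M (A.Hom U L) v = 0 := by
    have h0 := (Cpx.tensor M (A.Hom U D.pt)).d_d ((A.comp D.inl).lTensor M w : _ ⊗[k] _)
    change Cpx.tensorD _ _ (Cpx.tensorD _ _ _) = 0 at h0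
    rw [← hsnd (Cpx.tensorD M (A.Hom U L) v), ← hinr, hv, map_sub, hz, h0, sub_zero, map_zero]
  obtain ⟨y, hy⟩ := hL M hM v hdv
  change M ⊗[k] A.Hom U L at y
  change Cpx.tensorD M (A.Hom U L) y = _ at hy
  refine ⟨(A.comp D.inl).lTensor M w + (A.comp D.inr).lTensor M y, ?_⟩
  change Cpx.tensorD M (A.Hom U D.pt) _ = _
  rw [map_add, hinr, hy, hv, add_sub_cancel]

/-! ### Lifting morphisms up to attaching cones -/

variable [StrongPretriangulated A] (F : DGFunctor A C) (B : Set A.Obj)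

/-- Any morphism starting at `F X` whose differential is in the image of `F` is, after attaching
cones to its target, in the image of `F` up to a coboundary. -/
def LiftsFrom (X : A.Obj) : Prop :=
  ∀ (Y : A.Obj) (z : C.Hom (F.obj X) (F.obj Y)) (a : A.Hom X Y), (C.Hom _ _).d z = F.map a →
    ∃ (Y' : A.Obj) (s : A.Hom Y Y'), Attach B s ∧ ∃ w b, F.map s ⊚ z - (C.Hom _ _).d w = F.map b

variable {F B}

theorem liftsFrom_of_one_eq_zero {X : A.Obj} (h : A.one X = 0) : LiftsFrom F B X := by
  intro Y z a _
  have hz : z = 0 := by rw [← C.comp_one z, ← F.map_one, h, map_zero, comp_zero]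
  exact ⟨Y, _, .one Y, 0, 0, by simp [hz]⟩

/-- The maps only have to be closed and satisfy `u ∘ v = 1`. Their degrees are arbitrary, so the
property passes from `X[0]` to `X[r]`. -/
theorem LiftsFrom.of_iso {X X' : A.Obj} (h : LiftsFrom F B X) (u : A.Hom X X') (v : A.Hom X' X)
    (hu : (A.Hom _ _).d u = 0) (hv : (A.Hom _ _).d v = 0) (huv : u ⊚ v = A.one X') :
    LiftsFrom F B X' := by
  intro Y z a hz
  obtain ⟨Y', s, hs, w, b, e⟩ := h Y (z ⊚ F.map u) (a ⊚ u) (by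
    rw [leibniz_sgn, hz, ← F.map_d, hu, map_zero, comp_zero, add_zero, F.map_comp])
  refine ⟨Y', s, hs, w ⊚ F.map v, b ⊚ v, ?_⟩
  rw [leibniz_sgn, ← F.map_d, hv, map_zero, comp_zero, add_zero, F.map_comp, ← e, map_sub,
    LinearMap.sub_apply, C.assoc, C.assoc, ← F.map_comp, huv, F.map_one, C.comp_one]

/-- A morphism out of the cone is given by its restrictions to `L` and, twisted by `f`, to `K`. The
restriction to `L` is lifted first, and the one to `K` after `z` has been corrected accordingly. -/
theorem LiftsFrom.cone {K L : A.Obj} (hK : LiftsFrom F B K) (hL : LiftsFrom F B L)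
    {f : A.Hom K L} (D : Cone f) : LiftsFrom F B D.pt := by
  intro Y z a hz
  obtain ⟨Y₁, s₁, hs₁, w₁, b₁, e₁⟩ := hL Y (z ⊚ F.map D.inr) (a ⊚ D.inr) (by
    rw [leibniz_sgn, hz, ← F.map_d, D.d_inr, map_zero, comp_zero, add_zero, F.map_comp])
  -- Subtracting the coboundary of `w₁ ∘ snd` makes the restriction to `L` equal to `F b₁` exactly,
  -- not just up to a coboundary.
  let z₁ := F.map s₁ ⊚ z - (C.Hom _ _).d (w₁ ⊚ F.map D.snd)
  have hz₁ : (C.Hom _ _).d z₁ = F.map (s₁ ⊚ a) := by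
    rw [map_sub, Cpx.d_d, sub_zero, d_comp_closed (F.map_closed hs₁.closed), hz, F.map_comp]
  have hi : z₁ ⊚ F.map D.inr = F.map b₁ := by
    rw [← e₁, map_sub, LinearMap.sub_apply, leibniz_sgn, map_add, LinearMap.add_apply, ← F.map_d,
      D.d_snd, map_neg, F.map_comp]
    simp only [C.assoc, A.assoc, map_neg, LinearMap.neg_apply, ← F.map_comp, D.fst_inr, D.snd_inr, F.map_one,
      C.comp_one, map_zero]
    simp
  -- Because `d inl = inr ∘ f` and `z₁` restricted to `L` comes from `A`, the differential of `z₁ ∘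
  -- inl` comes from `A` as well.
  obtain ⟨Y₂, s₂, hs₂, w₂, b₂, e₂⟩ := hK Y₁ (z₁ ⊚ F.map D.inl)
    ((s₁ ⊚ a) ⊚ D.inl + (A.Hom _ _).sgn b₁ ⊚ f) (by
      have hs : (C.Hom _ _).sgn z₁ ⊚ F.map D.inr = F.map ((A.Hom _ _).sgn b₁) := by
        rw [F.map_sgn, ← hi, sgn_comp, ← F.map_sgn, Ho.Aux.sgn_inr]
      rw [leibniz_sgn, hz₁, ← F.map_d, D.d_inl, F.map_comp D.inr, ← C.assoc, hs, ← F.map_comp,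
        ← F.map_comp, map_add])
  refine ⟨Y₂, s₂ ⊚ s₁, hs₁.comp hs₂, F.map s₂ ⊚ w₁ ⊚ F.map D.snd + w₂ ⊚ F.map D.fst,
    b₂ ⊚ D.fst + s₂ ⊚ b₁ ⊚ D.snd, ?_⟩
  have e : F.map s₂ ⊚ z₁ = F.map s₂ ⊚ (z₁ ⊚ F.map D.inl) ⊚ F.map D.fst +
      F.map s₂ ⊚ F.map b₁ ⊚ F.map D.snd := by
    rw [← hi, ← map_add, C.assoc, C.assoc, ← map_add, ← F.map_comp, ← F.map_comp, ← map_add,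
      D.total, F.map_one, C.comp_one]
  have e' : (C.Hom _ _).d (w₂ ⊚ F.map D.fst) = (C.Hom _ _).d w₂ ⊚ F.map D.fst := by
    rw [leibniz_sgn, ← F.map_d, D.d_fst, map_zero, comp_zero, add_zero]
  have e'' : F.map s₂ ⊚ z₁ = F.map s₂ ⊚ F.map s₁ ⊚ z -
      (C.Hom _ _).d (F.map s₂ ⊚ w₁ ⊚ F.map D.snd) := by
    rw [d_comp_closed (F.map_closed hs₂.closed), ← map_sub]
  rw [map_add, map_add F.map, F.map_comp, F.map_comp, F.map_comp, F.map_comp, ← e₂, map_sub, LinearMap.sub_apply,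
    ← e', C.assoc (F.map s₂) (z₁ ⊚ _), sub_add_eq_add_sub, ← e, e'', C.assoc]
  abel

end DGCat

end DG

/-! ### Cones in homotopy categories; lifting along a DG functor up to attachments -/

namespace DG

namespace DGCat

variable {k : Type u} [CommRing k] {A C : DGCat k}

open Ho Pretriangulated StrongPretriangulated Limits

/-- The image of a cone under a DG functor. -/
def Cone.map {X Y : A.Obj} {f : A.Hom X Y} (D : Cone f) (F : DGFunctor A C) : Cone (F.map f) where
  pt := F.obj D.pt
  inr := F.map D.inr
  fst := F.map D.fst
  inl := F.map D.inl
  snd := F.map D.snd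
  inr_mem := F.map_mem D.inr_mem
  fst_mem := F.map_mem D.fst_mem
  inl_mem := F.map_mem D.inl_mem
  snd_mem := F.map_mem D.snd_mem
  fst_inl := by rw [← F.map_comp, D.fst_inl, F.map_one]
  snd_inr := by rw [← F.map_comp, D.snd_inr, F.map_one]
  fst_inr := by rw [← F.map_comp, D.fst_inr, map_zero]
  snd_inl := by rw [← F.map_comp, D.snd_inl, map_zero]
  total := by rw [← F.map_comp, ← F.map_comp, ← map_add, D.total, F.map_one]
  d_inr := by rw [← F.map_d, D.d_inr, map_zero]
  d_fst := by rw [← F.map_d, D.d_fst, map_zero]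
  d_inl := by rw [← F.map_d, D.d_inl, F.map_comp]
  d_snd := by rw [← F.map_d, D.d_snd, map_neg, F.map_comp]

namespace Ho

theorem comp_inv_comp_eq {D : Type*} [Category D] {X Y Y' K L : D} {eX : X ≅ K} {eY : Y ≅ L}
    {f : K ⟶ L} {s : Y ≅ Y'} {g : X ⟶ Y'} (e : g = (eX.hom ≫ f ≫ eY.inv) ≫ s.hom) :
    g ≫ (s.symm ≪≫ eY).hom = eX.hom ≫ f := by
  simp [e]

theorem isZero_of_homotopic [StrongPretriangulated A] {X : A.Obj} (h : Homotopic (A.one X) 0) :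
    IsZero (⟨X⟩ : Ho A) :=
  (IsZero.iff_id_eq_zero _).2 (cls_eq_iff (hf := one_closed X) (hg := zero_mem _) |>.2 h)

theorem homotopic_of_isZero [StrongPretriangulated A] {X : A.Obj} (h : IsZero (⟨X⟩ : Ho A)) :
    Homotopic (A.one X) 0 :=
  cls_eq_iff (X := ⟨X⟩) (Y := ⟨X⟩) (hf := one_closed X) (hg := zero_mem _) |>.1
    ((IsZero.iff_id_eq_zero _).1 h)

variable [StrongPretriangulated A]

theorem stdTriangle_mem {X Y : A.Obj} (f : A.Hom X Y) (hf : f ∈ A.closed X Y) (D : Cone f) :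
    stdTriangle f hf D ∈ distTriang (Ho A) :=
  ⟨X, Y, f, hf, D, ⟨Iso.refl _⟩⟩

/-- The cone of a morphism between contractible objects is contractible. -/
theorem homotopic_cone {X Y : A.Obj} {f : A.Hom X Y} (hf : f ∈ A.closed X Y) (D : Cone f)
    (hX : Homotopic (A.one X) 0) (hY : Homotopic (A.one Y) 0) : Homotopic (A.one D.pt) 0 :=
  homotopic_of_isZero (Triangle.isZero₃_of_isZero₁₂ _ (stdTriangle_mem f hf D)
    (isZero_of_homotopic hX) (isZero_of_homotopic hY))

theorem isIso_of_homotopic_cone {X Y : A.Obj} {f : A.Hom X Y} (hf : f ∈ A.closed X Y) (D : Cone f)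
    (h : Homotopic (A.one D.pt) 0) : IsIso (cls f hf : (⟨X⟩ : Ho A) ⟶ ⟨Y⟩) :=
  (Triangle.isZero₃_iff_isIso₁ _ (stdTriangle_mem f hf D)).1 (isZero_of_homotopic h)

end Ho

section

variable [StrongPretriangulated A] [StrongPretriangulated C] (F : DGFunctor A C)

/-- If a DG functor sends the objects of a subcategory to contractible objects, the induced functor
on homotopy categories inverts the morphisms whose cones are in the subcategory. -/
theorem ho_isInvertedBy {P : ObjectProperty (Ho A)}
    (h : ∀ Z, P Z → Homotopic (C.one (F.obj Z.obj)) 0) : P.trW.IsInvertedBy F.ho := by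
  rintro X Y φ ⟨Z, g, δ, ⟨X', Y', f, hf, D, ⟨e⟩⟩, hZ⟩
  have e₃ : F.ho.obj Z ≅ (⟨F.obj D.pt⟩ : Ho C) := F.ho.mapIso (Triangle.π₃.mapIso e)
  -- A DG functor preserves cones, so the cone of the image of `f` is isomorphic to the image of
  -- `Z`, which is contractible.
  have hi : IsIso (F.ho.map (cls f hf : (⟨X'⟩ : Ho A) ⟶ ⟨Y'⟩)) :=
    isIso_of_homotopic_cone (F.map_closed hf) (D.map F)
      (homotopic_of_isZero ((isZero_of_homotopic (h Z hZ)).of_iso e₃.symm))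
  obtain ⟨a, b, ha, hb, hab⟩ : ∃ (a : X ⟶ ⟨X'⟩) (b : Y ⟶ ⟨Y'⟩), IsIso a ∧ IsIso b ∧
      φ ≫ b = a ≫ (cls f hf : (⟨X'⟩ : Ho A) ⟶ ⟨Y'⟩) :=
    ⟨e.hom.hom₁, e.hom.hom₂, (Triangle.π₁.mapIso e).isIso_hom, (Triangle.π₂.mapIso e).isIso_hom,
      e.hom.comm₁⟩
  rw [(IsIso.eq_comp_inv b).2 hab, F.ho.map_comp, F.ho.map_comp]
  infer_instance

end

section

variable [StrongPretriangulated A] (B : Set A.Obj)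

/-- The classes in the homotopy category of compositions of inclusions into cones of morphisms from
shifts of objects of `B`. -/
def attachments : MorphismProperty (Ho A) := fun X Y φ =>
  ∃ (s : A.Hom X.obj Y.obj) (hs : Attach B s), φ = cls s hs.closed

instance : (attachments B).IsMultiplicative where
  id_mem X := ⟨_, .one X.obj, rfl⟩
  comp_mem := by
    rintro X Y Z _ _ ⟨s, hs, rfl⟩ ⟨t, ht, rfl⟩
    exact ⟨_, hs.comp ht, rfl⟩

variable {B}

/-- Rotating the triangle of a morphism `U[r] → Y` shows that the cone of the inclusion `Y → cone`
is `U[r][1]`, which `hP` places in `P`. -/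
theorem isIso_Q_map_attachments {P : ObjectProperty (Ho A)}
    (hP : ∀ U ∈ B, ∀ r, P ⟨sh 1 (sh r U)⟩) {X Y : Ho A} (φ : X ⟶ Y) (h : attachments B φ) :
    IsIso (P.trW.Q.map φ) := by
  obtain ⟨s, hs, rfl⟩ := h
  obtain ⟨X⟩ := X
  obtain ⟨Y⟩ := Y
  change A.Hom X Y at s
  change Attach B s at hs
  induction hs with
  | one =>
    refine (?_ : IsIso (P.trW.Q.map (𝟙 _)))
    infer_instance
  | step s U hU r f hf hs ih =>
    have h₁ := ih
    have h₂ : IsIso (P.trW.Q.map (cls (cone f hf).inr (Aux.inr_closed _) :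
        (⟨_⟩ : Ho A) ⟶ ⟨_⟩)) :=
      P.trW.Q_inverts _ (ObjectProperty.trW.mk P
        (rot_of_distTriang _ (stdTriangle_mem f hf (cone f hf))) (hP U hU r))
    have h₃ := IsIso.comp_isIso' h₁ h₂
    rw [← Functor.map_comp] at h₃
    exact h₃

variable (F : DGFunctor A C)

/-- This is `LiftsFrom` with `a = 0`. The lift is then cut down to its degree `0` part, which is
closed because `F` is injective on morphisms. -/
theorem exists_closed_lift (hinj : ∀ {X Y} (f : A.Hom X Y), F.map f = 0 → f = 0) {X Y : A.Obj}
    (hlift : LiftsFrom F B X) {z : C.Hom (F.obj X) (F.obj Y)}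
    (hz : z ∈ C.closed (F.obj X) (F.obj Y)) :
    ∃ (Y' : A.Obj) (s : A.Hom Y Y'), Attach B s ∧
      ∃ b ∈ A.closed X Y', Homotopic (F.map b) (F.map s ⊚ z) := by
  have hdz : (C.Hom _ _).d z = 0 := hz.2
  obtain ⟨Y', s, hs, w, b, e⟩ := hlift Y z 0 (hdz.trans (map_zero _).symm)
  -- Take the degree `0` components of `e`: on `w` this selects degree `-1`, and `F.map s ⊚ z`
  -- already has degree `0`.
  have e₀ : F.map s ⊚ z - (C.Hom _ _).d ((C.Hom _ _).proj (-1) w) =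
      F.map ((A.Hom _ _).proj 0 b) := by
    have h := congrArg ((C.Hom _ _).proj 0) e
    have hw := (C.Hom (F.obj X) (F.obj Y')).proj_d (-1) w
    have hb := GrMod.proj_map (r := 0) (F.map (X := X) (Y := Y'))
      (fun n x hx => (add_zero n).symm ▸ F.map_mem hx) 0 b
    rw [neg_add_cancel] at hw
    rw [add_zero] at hb
    rw [map_sub, GrMod.proj_of_mem (comp_closed (F.map_closed hs.closed) hz).1, hw, hb] at h
    exact h
  have hb : (A.Hom _ _).proj 0 b ∈ A.closed X Y' := by
    refine ⟨GrMod.proj_mem _ _, hinj _ ?_⟩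
    rw [F.map_d, ← e₀, map_sub, Cpx.d_d, d_comp_closed (F.map_closed hs.closed), hdz]
    simp
  refine ⟨Y', s, hs, _, hb, -(C.Hom _ _).proj (-1) w, neg_mem (GrMod.proj_mem _ _), ?_⟩
  rw [map_neg, ← e₀]
  abel

theorem ho_full_up_to_attachments (hinj : ∀ {X Y} (f : A.Hom X Y), F.map f = 0 → f = 0)
    (hlift : ∀ X, LiftsFrom F B X) {X Y : Ho A} (φ : F.ho.obj X ⟶ F.ho.obj Y) :
    ∃ (Y' : Ho A) (s : Y ⟶ Y') (g : X ⟶ Y'), attachments B s ∧ F.ho.map g = φ ≫ F.ho.map s := by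
  obtain ⟨z, hz, rfl⟩ := cls_surjective φ
  obtain ⟨Y', s, hs, b, hb, e⟩ := exists_closed_lift F hinj (hlift X.obj) hz
  exact ⟨⟨Y'⟩, cls s hs.closed, cls b hb, ⟨s, hs, rfl⟩,
    cls_eq_iff (X := F.ho.obj X) (Y := ⟨F.obj Y'⟩) (hf := F.map_closed hb)
      (hg := comp_closed (F.map_closed hs.closed) hz) |>.2 e⟩

/-- `LiftsFrom` is applied to the homotopy itself, whose differential is `F (g - h)`. The coboundary
correction is a cocycle of the form `dw`, so the lifted homotopy has differential `s ∘ g - s ∘ h`.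
-/
theorem exists_homotopic_lift (hinj : ∀ {X Y} (f : A.Hom X Y), F.map f = 0 → f = 0) {X Y : A.Obj}
    (hlift : LiftsFrom F B X) {g h : A.Hom X Y} (hg : g ∈ A.closed X Y) (hh : h ∈ A.closed X Y)
    (H : Homotopic (F.map g) (F.map h)) :
    ∃ (Y' : A.Obj) (s : A.Hom Y Y'), Attach B s ∧ Homotopic (s ⊚ g) (s ⊚ h) := by
  obtain ⟨z, -, hz⟩ := H
  obtain ⟨Y', s, hs, w, b, e'⟩ := hlift Y z (g - h) (hz.trans (map_sub _ _ _).symm)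
  have hd : (A.Hom _ _).d b = s ⊚ g - s ⊚ h := by
    refine sub_eq_zero.1 (hinj _ ?_)
    rw [map_sub, F.map_d, ← e', map_sub, Cpx.d_d, d_comp_closed (F.map_closed hs.closed), hz,
      map_sub, map_sub, F.map_comp, F.map_comp]
    abel
  refine ⟨Y', s, hs, (A.Hom _ _).proj (-1) b, GrMod.proj_mem _ _, ?_⟩
  have hw := (A.Hom X Y').proj_d (-1) b
  rw [neg_add_cancel, hd] at hw
  rw [← hw]
  exact GrMod.proj_of_mem (sub_mem (comp_closed hs.closed hg).1 (comp_closed hs.closed hh).1)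

theorem ho_faithful_up_to_attachments (hinj : ∀ {X Y} (f : A.Hom X Y), F.map f = 0 → f = 0)
    (hlift : ∀ X, LiftsFrom F B X) {X Y : Ho A} (g h : X ⟶ Y) (e : F.ho.map g = F.ho.map h) :
    ∃ (Y' : Ho A) (s : Y ⟶ Y'), attachments B s ∧ g ≫ s = h ≫ s := by
  obtain ⟨g, hg, rfl⟩ := cls_surjective g
  obtain ⟨h, hh, rfl⟩ := cls_surjective h
  obtain ⟨Y', s, hs, H⟩ := exists_homotopic_lift F hinj (hlift X.obj) hg hh
    (cls_eq_iff (X := F.ho.obj X) (Y := F.ho.obj Y) (hf := F.map_closed hg)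
      (hg := F.map_closed hh) |>.1 e)
  exact ⟨⟨Y'⟩, cls s hs.closed, ⟨s, hs, rfl⟩,
    cls_eq_iff (X := X) (Y := ⟨Y'⟩) (hf := comp_closed hs.closed hg)
      (hg := comp_closed hs.closed hh) |>.2 H⟩

/-- The cone of a morphism between objects in the essential image is in the essential image. -/
theorem exists_iso_cone [StrongPretriangulated C]
    (hinj : ∀ {X Y} (f : A.Hom X Y), F.map f = 0 → f = 0) (hlift : ∀ X, LiftsFrom F B X)
    (hB : ∀ {X Y : Ho A} (s : X ⟶ Y), attachments B s → IsIso (F.ho.map s))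
    {K L : C.Obj} {f : C.Hom K L} (hf : f ∈ C.closed K L) (D : Cone f)
    (hK : ∃ X : Ho A, Nonempty (F.ho.obj X ≅ ⟨K⟩)) (hL : ∃ X : Ho A, Nonempty (F.ho.obj X ≅ ⟨L⟩)) :
    ∃ X : Ho A, Nonempty (F.ho.obj X ≅ ⟨D.pt⟩) := by
  obtain ⟨X, ⟨eX⟩⟩ := hK
  obtain ⟨Y, ⟨eY⟩⟩ := hL
  -- After an attachment, `f` is the image of a morphism `g`. Attachments are invertible after `F`,
  -- so the image of the cone of `g` is isomorphic to the cone of `f`.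
  obtain ⟨Y', s, g, hs, e⟩ := ho_full_up_to_attachments F hinj hlift
    (eX.hom ≫ (cls f hf : (⟨K⟩ : Ho C) ⟶ ⟨L⟩) ≫ eY.inv)
  have := hB s hs
  obtain ⟨g, hg, rfl⟩ := cls_surjective g
  let E := cone g hg
  refine ⟨⟨E.pt⟩, ⟨Triangle.π₃.mapIso (isoTriangleOfIso₁₂ _ _
    (stdTriangle_mem (F.map g) (F.map_closed hg) (E.map F)) (stdTriangle_mem f hf D) eX
    ((asIso (F.ho.map s)).symm ≪≫ eY) ?_)⟩⟩
  exact comp_inv_comp_eq (s := asIso (F.ho.map s)) e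

end

end DGCat

end DG

namespace DG

namespace DGCat

variable {k : Type u} [CommRing k] {A : DGCat k} {B : Set A.Obj}

open TwCpx

/-! ### The functor from twisted complexes over `A` to twisted complexes over `A/B` -/

/-- `Hom` in `A` is the direct summand of words of length `0` in `Hom` in `A/B`; this is applied to
each entry. -/
theorem toQuotPretr_map_eq_zero {K L : TwCpx A} (f : A.pretr.Hom K L)
    (h : (toQuotPretr B).map f = 0) : f = 0 :=
  hom_ext fun i j =>
    have h' : Quot.incl (B := B) (ent f i j) = 0 := congrArg (fun s => ent (K := (A.toQuot B).twObj K) (L := (A.toQuot B).twObj L) s i j) h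
    (Quot.pr_ofWord_self (X := K.C j) (Y := L.C i) ([] : List B) (ent f i j)).symm.trans
      ((congrArg (Quot.pr ([] : List B)) h').trans (map_zero _))

/-- The identity `X[r] → X[r']`. -/
def shiftIso (X : A.Obj) (r r' : ℤ) : A.pretr.Hom (single X r) (single X r') := fun _ _ => A.one X

theorem d_shiftIso (X : A.Obj) (r r' : ℤ) : (A.pretr.Hom _ _).d (shiftIso X r r') = 0 :=
  hom_ext fun i j => (ent_d (K := single X r) (L := single X r') rfl rfl _ i j).trans
    ((congrArg (fun x => ((r'.negOnePow : ℤ)) • x) (d_one X)).trans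
      (smul_zero _ : (r'.negOnePow : ℤ) • (0 : A.Hom X X) = 0))

theorem shiftIso_comp (X : A.Obj) (r r' : ℤ) :
    shiftIso X r r' ⊚ shiftIso X r' r = A.pretr.one (single X r') :=
  hom_ext fun i j => by
    obtain rfl : i = j := Subsingleton.elim (α := Fin 1) i j
    exact (Fin.sum_univ_one fun _ => A.one X ⊚ A.one X).trans
      ((A.one_comp _).trans (delta_self (single X r').C i).symm)

/-- Flatness of the complexes `Hom(X, Y)` is inherited by the complexes `Hom(X, Y[r])`. -/
theorem isHoFlat_single {X Y : A.Obj} (h : (A.Hom X Y).IsHoFlat) (r : ℤ) :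
    (A.pretr.Hom (single X 0) (single Y r)).IsHoFlat := by
  let φ : A.pretr.Hom (single X 0) (single Y r) →ₗ[k] A.Hom X Y :=
    entₗ (single X 0) (single Y r) (0 : Fin 1) (0 : Fin 1)
  let ψ : A.Hom X Y →ₗ[k] A.pretr.Hom (single X 0) (single Y r) :=
    { toFun := fun f => (fun _ _ => f : A.pretr.Hom (single X 0) (single Y r))
      map_add' := fun _ _ => rfl
      map_smul' := fun _ _ => rfl }
  have hψφ : ∀ x, ψ (φ x) = x := fun x => hom_ext fun i j => by
    obtain rfl : i = (0 : Fin 1) := Subsingleton.elim (α := Fin 1) i _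
    obtain rfl : j = (0 : Fin 1) := Subsingleton.elim (α := Fin 1) j _
    rfl
  have hφψ : ∀ x, φ (ψ x) = x := fun x => rfl
  have hφ : ∀ x, φ ((A.pretr.Hom _ _).d x) = (r.negOnePow : ℤ) • (A.Hom X Y).d (φ x) := fun x =>
    ent_d (K := single X 0) (L := single Y r) rfl rfl x (0 : Fin 1) (0 : Fin 1)
  have hψ : ∀ y, (A.pretr.Hom _ _).d (ψ y) = ψ ((r.negOnePow : ℤ) • (A.Hom X Y).d y) := fun y => by
    rw [← hψφ ((A.pretr.Hom _ _).d (ψ y)), hφ, hφψ]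
  -- Taking the entry multiplies the differential by `(-1)ʳ`, so only the parity of `r` matters. The
  -- change of degree is harmless for `IsHoFlat.of_retract`.
  rcases Int.even_or_odd r with hr | hr
  · rw [Int.negOnePow_even r hr] at hφ hψ
    exact h.of_retract φ ψ (fun x => ((hφ x).trans (one_smul ℤ _)).symm)
      (fun x => (hψ x).trans (congrArg ψ (one_smul ℤ _))) hψφ
  · rw [Int.negOnePow_odd r hr] at hφ hψ
    exact h.neg.of_retract φ ψ
      (fun x => ((hφ x).trans (neg_one_smul ℤ _)).symm)
      (fun x => (hψ x).trans (congrArg ψ (neg_one_smul ℤ _))) hψφ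

/-- Twisted complexes are iterated cones of the `X[r]`, and flatness passes to cones. It is needed
under the second condition, where attachments turn the target into an arbitrary twisted complex. -/
theorem isHoFlat_pretr {U : A.Obj} (h : ∀ X, (A.Hom U X).IsHoFlat) (L : TwCpx A) :
    (A.pretr.Hom (single U 0) L).IsHoFlat :=
  pretr_induction (S := Set.univ) (P := fun L => (A.pretr.Hom (single U 0) L).IsHoFlat)
    (fun _ hK => isHoFlat_of_eq_zero fun x => (A.pretr.one_comp x).symm.trans
      ((congrArg (fun s => A.pretr.comp s x) hK).trans (LinearMap.map_zero₂ _ x)))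
    (fun X _ r => isHoFlat_single (h X) r) (fun _ _ D hK hL => isHoFlat_cone D hK hL) L
    fun _ => trivial

/-- The reduction of words needs cones in the category being divided, so `z` is moved to the
quotient of the twisted complexes over `A` by `compareInv`, reduced there, and moved back by
`compare`. Under the first condition only `Hom` complexes between one-term complexes have to be
flat. -/
theorem liftsFrom_single (hflat : (∀ X, ∀ U ∈ B, (A.Hom X U).IsHoFlat) ∨
    (∀ X, ∀ U ∈ B, (A.Hom U X).IsHoFlat)) (X : A.Obj) :
    LiftsFrom (toQuotPretr B) (singles B) (single X 0) := by
  intro Y z a hz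
  have hflat' : (∀ Z, (Z = single X 0 ∨ Z ∈ singles (A := A) B) → ∀ U ∈ singles B,
      (A.pretr.Hom Z U).IsHoFlat) ∨ ∀ U ∈ singles B, ∀ Y, (A.pretr.Hom U Y).IsHoFlat := by
    rcases hflat with h | h
    · left
      rintro Z hZ _ ⟨U, hU, rfl⟩
      obtain ⟨X, rfl⟩ : ∃ X, Z = single X 0 := by
        rcases hZ with rfl | ⟨V, -, rfl⟩
        exacts [⟨X, rfl⟩, ⟨V, rfl⟩]
      exact isHoFlat_single (h X U hU) 0
    · right
      rintro _ ⟨U, hU, rfl⟩ Y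
      exact isHoFlat_pretr (fun X => h X U hU) Y
  -- `compare` is bijective here and commutes with `d`, so the differential of `compareInv z`
  -- corresponds to that of `z`, which comes from `a`.
  have hz' : Quot.qd (compareInv z) = Quot.incl (B := singles B) a :=
    (compareInv_compare _).symm.trans <| (congrArg compareInv ((compare_qd (compareInv z)).trans
      ((congrArg (((A.quot B).pretr.Hom _ _).d) (compare_compareInv z)).trans hz))).trans
        (compareInv_incl a)
  obtain ⟨Y', s, hs, w, b, e⟩ := Quot.exists_reduction (A := A.pretr) hflat' (compareInv z) a hz'
  have h₁ : compare (Quot.act s (compareInv z)) = (toQuotPretr B).map s ⊚ z :=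
    (Quot.extend_act (toQuotPretr B) epsSingles s _).trans
      (congrArg (fun t => (toQuotPretr B).map s ⊚ t) (compare_compareInv z))
  exact ⟨Y', s, hs, compare w, b, (congrArg₂ (· - ·) h₁ (compare_qd w)).symm.trans
    ((map_sub compare _ _).symm.trans ((congrArg compare e).trans (compare_incl b)))⟩

theorem liftsFrom_toQuotPretr (hflat : (∀ X, ∀ U ∈ B, (A.Hom X U).IsHoFlat) ∨
    (∀ X, ∀ U ∈ B, (A.Hom U X).IsHoFlat)) (K : A.pretr.Obj) :
    LiftsFrom (toQuotPretr B) (singles B) K :=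
  pretr_induction (S := Set.univ) (fun _ h => liftsFrom_of_one_eq_zero h)
    (fun X _ r => (liftsFrom_single hflat X).of_iso (shiftIso X 0 r) (shiftIso X r 0)
      (d_shiftIso X 0 r) (d_shiftIso X r 0) (shiftIso_comp X 0 r))
    (fun _ _ D hK hL => hK.cone hL D) K fun _ => trivial

/-- A twisted complex over `A/B` with terms in `B` is contractible. -/
theorem homotopic_one_zero (K : TwCpx (A.quot B)) (hK : ∀ i, K.C i ∈ B) :
    Homotopic ((A.quot B).pretr.one K) 0 := by
  refine pretr_induction (A := A.quot B) (S := B)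
    (P := fun K => Homotopic ((A.quot B).pretr.one K) 0) (fun K hK => Ho.homotopic_of_eq hK) ?_
    (fun f hf D hK hL => Ho.homotopic_cone hf D hK hL) K hK
  intro U hU r
  -- The differential on endomorphisms of `U[r]` is `(-1)ʳ` times that of `U`, and the sign
  -- compensates for this.
  let ε : (A.quot B).Hom U U := (r.negOnePow : ℤ) • eps (A := A) (B := B) ⟨U, hU⟩
  let h : (A.quot B).pretr.Hom (single U r) (single U r) := fun _ _ => ε
  refine ⟨h, fun i j => ?_, hom_ext fun i j => ?_⟩
  · have e : (-1 : ℤ) + r - r = -1 := by ring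
    have he : ε ∈ ((A.quot B).Hom U U).gr (-1 + r - r) := by
      rw [e]; exact zsmul_mem (eps_mem (A := A) (B := B) ⟨U, hU⟩) _
    exact he
  · have h₁ : ((A.quot B).Hom U U).d ε = (r.negOnePow : ℤ) • (A.quot B).one U :=
      (map_zsmul _ _ _).trans (congrArg (fun x => (r.negOnePow : ℤ) • x) (d_eps (A := A) (B := B) ⟨U, hU⟩))
    have h₂ : (r.negOnePow : ℤ) • ((A.quot B).Hom U U).d ε = (A.quot B).one U := by
      rw [h₁, smul_smul]; simp
    obtain rfl : i = j := Subsingleton.elim (α := Fin 1) i j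
    exact (ent_d (A := A.quot B) (K := single U r) (L := single U r) rfl rfl h i i).trans
      (h₂.trans ((delta_self (A := A.quot B) (single U r).C i).symm.trans (sub_zero _).symm))

theorem map_single (X : A.Obj) (r : ℤ) :
    (A.toQuot B).twObj (single X r) = single (A := A.quot B) X r := by
  have h : ∀ K L : TwCpx (A.quot B), K.toFam = L.toFam → HEq K.q L.q → K = L := by
    rintro ⟨K, q, _, _, _⟩ ⟨L, q', _, _, _⟩ (rfl : K = L) h
    obtain rfl : q = q' := eq_of_heq h
    rfl
  exact h _ _ rfl (heq_of_eq (map_zero_q X r))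

theorem tr_isInvertedBy : (trSub B).trW.IsInvertedBy (A.toQuot B).tr :=
  ho_isInvertedBy (toQuotPretr B) fun Z hZ => homotopic_one_zero ((A.toQuot B).twObj Z.obj) hZ

theorem isIso_Q_map_attachments_singles {X Y : Ho A.pretr} (s : X ⟶ Y)
    (hs : attachments (singles B) s) : IsIso ((trSub B).trW.Q.map s) :=
  isIso_Q_map_attachments (by rintro _ ⟨U, hU, rfl⟩ r i; exact hU) s hs

theorem isIso_tr_map_attachments {X Y : Ho A.pretr} (s : X ⟶ Y)
    (hs : attachments (singles B) s) : IsIso ((A.toQuot B).tr.map s) :=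
  isIso_map_of_isIso_Q _ tr_isInvertedBy (isIso_Q_map_attachments_singles s hs)

/-- The complexes `X[r]` lie in the image, every twisted complex is an iterated cone of these, and
`exists_iso_cone` shows that the essential image is closed under cones. -/
theorem tr_essSurj (hflat : (∀ X, ∀ U ∈ B, (A.Hom X U).IsHoFlat) ∨
    (∀ X, ∀ U ∈ B, (A.Hom U X).IsHoFlat)) : (A.toQuot B).tr.EssSurj where
  mem_essImage := by
    rintro ⟨K⟩
    refine pretr_induction (A := A.quot B) (S := Set.univ)
      (P := fun K => ∃ X : Ho A.pretr, Nonempty ((A.toQuot B).tr.obj X ≅ ⟨K⟩)) ?_ ?_ ?_ K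
      fun _ => trivial
    · intro K hK
      exact ⟨⟨TwCpx.zero⟩, ⟨((Ho.isZero_of_homotopic (Ho.homotopic_of_eq
        (hom_ext (K := (A.toQuot B).twObj TwCpx.zero) (L := (A.toQuot B).twObj TwCpx.zero)
          fun i => i.elim0))).iso (Ho.isZero_of_homotopic (Ho.homotopic_of_eq hK)))⟩⟩
    · intro X _ r
      exact ⟨⟨single X r⟩, ⟨eqToIso (congrArg Ho.mk (map_single (A := A) (B := B) X r))⟩⟩
    · intro K L f hf D hK hL
      exact exists_iso_cone (toQuotPretr B) toQuotPretr_map_eq_zero (liftsFrom_toQuotPretr hflat)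
        isIso_tr_map_attachments hf D hK hL

theorem lift_ho_isEquivalence {A C : DGCat k} [StrongPretriangulated A] {B : Set A.Obj}
    {P : ObjectProperty (Ho A)} (F : DGFunctor A C) (hF : P.trW.IsInvertedBy F.ho) [F.ho.EssSurj]
    (hP : ∀ U ∈ B, ∀ r, P ⟨StrongPretriangulated.sh 1 (StrongPretriangulated.sh r U)⟩)
    (hinj : ∀ {X Y} (f : A.Hom X Y), F.map f = 0 → f = 0)
    (hlift : ∀ X, LiftsFrom F B X) : (Localization.Construction.lift F.ho hF).IsEquivalence :=
  localization_lift_isEquivalence F.ho hF (attachments B) (isIso_Q_map_attachments hP)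
    (ho_full_up_to_attachments F hinj hlift) (ho_faithful_up_to_attachments F hinj hlift)

theorem lift_tr_isEquivalence (hflat : (∀ X, ∀ U ∈ B, (A.Hom X U).IsHoFlat) ∨
    (∀ X, ∀ U ∈ B, (A.Hom U X).IsHoFlat)) :
    (Localization.Construction.lift (A.toQuot B).tr tr_isInvertedBy).IsEquivalence :=
  have : (toQuotPretr B).ho.EssSurj := tr_essSurj hflat
  lift_ho_isEquivalence (toQuotPretr B) tr_isInvertedBy
    (by rintro _ ⟨U, hU, rfl⟩ r i; exact hU) toQuotPretr_map_eq_zero (liftsFrom_toQuotPretr hflat)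

end DGCat

/-! ### The identity DG functor and the conclusion -/

namespace DGFunctor

variable {k : Type u} [CommRing k] (A : DGCat k)

theorem id_isQuasiEquivalence : (DGFunctor.id A).IsQuasiEquivalence where
  injective _ _ h := h
  surjective y hy := ⟨y, hy, 0, (map_zero _).trans (sub_self y).symm⟩
  essSurj := ⟨fun X => ⟨X, ⟨Iso.refl _⟩⟩⟩

theorem id_ho : (DGFunctor.id A).ho = 𝟭 A.Ho :=
  CategoryTheory.Functor.ext (fun _ => rfl) fun X Y f => by
    obtain ⟨f, hf, rfl⟩ := DGCat.Ho.cls_surjective f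
    exact ((Category.id_comp _).trans (Category.comp_id _)).symm

theorem id_pretr : (DGFunctor.id A).pretr = DGFunctor.id A.pretr := rfl

theorem id_tr : (DGFunctor.id A).tr = 𝟭 A.pretr.Ho :=
  (congrArg DGFunctor.ho (id_pretr A)).trans (id_ho A.pretr)

end DGFunctor

end DG

theorem theorem3p4 {k : Type u} [CommRing k] (A : DG.DGCat.{u} k) (B : Set A.Obj)
    (hflat : (∀ X, ∀ U ∈ B, (A.Hom X U).IsHoFlat) ∨ (∀ X, ∀ U ∈ B, (A.Hom U X).IsHoFlat)) :
    (∃ h : (DG.DGCat.trSub B).trW.IsInvertedBy (A.toQuot B).tr,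
      (Localization.Construction.lift (A.toQuot B).tr h).IsEquivalence) ∧
    DG.DGCat.IsDGQuotient B (DG.DGFunctor.id A) (A.toQuot B) :=
  have h := DG.DGCat.lift_tr_isEquivalence hflat
  ⟨⟨_, h⟩,
    { quasiEquivalence := DG.DGFunctor.id_isQuasiEquivalence A
      essSurj := ⟨fun X => ⟨⟨X.obj⟩, ⟨Iso.refl _⟩⟩⟩
      -- With `π` the identity, the required isomorphism is the factorization of the functor through
      -- the localization, which is an equality.
      equivalence := ⟨_, ⟨eqToIso (by
        rw [Localization.Construction.fac, DG.DGFunctor.id_tr, Functor.id_comp])⟩, h⟩ }⟩
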